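/- For $n\ge 1$ let $\mathcal A_n$ be the vector space of polynomial vector fields $v=P\,\partial_x+Q\,\partial_y$ on $\mathbb C^2$ with $\deg P,\deg Q\le n$, and let $\mathrm{Aff}\,\mathbb C^2\times\mathbb C^*$ act on it by push-forward under affine automorphisms and multiplication by nonzero constants. Let $\tilde{\mathcal A}_n=\mathcal A_n/(\mathrm{Aff}\,\mathbb C^2\times\mathbb C^*)$. A field $v\in\mathcal A_n$ defines a foliation of $\mathbb{CP}^2$; it is generated near the line at infinity by $u^{n-1}v$, where $u=0$ is the local equation $u=1/x$ or $u=1/y$ of that line. Call $v$ nondegenerate if this foliation has exactly $n+1$ singular points $O_1,\dots,O_{n+1}$ on the line at infinity and exactly $n^2$ singular points $O_{n+2},\dots,O_N$ in $\mathbb C^2$, $N=n^2+n+1$, and at each of them both eigenvalues $\lambda,\mu$ of the linearization are nonzero. The Baum–Bott index at a singular point is $\nu(O)=\lambda/\mu+\mu/\lambda$. The moduli map sends a nondegenerate $v$ to $M(v)=(\nu(O_1),\dots,\nu(O_N))\in\mathbb C^N$. It is defined up to renumbering the points at infinity among themselves and the points of $\mathbb C^2$ among themselves. "Generic" means: outside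 a proper algebraic subset of $\mathcal A_n$. (a) The moduli map is algebraic. For every $n\ge1$ a generic $v\in\mathcal A_n$ is nondegenerate. The set of values of $M$ (over all numberings) is the same for all fields in one class of $\tilde{\mathcal A}_n$, so $M$ descends to a map $\mu$ defined on the classes of nondegenerate fields. The coefficients of the polynomials $$\prod_{j=1}^{n+1}\bigl(T-\nu(O_j)\bigr),\qquad \prod_{j=n+2}^{N}\bigl(T-\nu(O_j)\bigr)$$ are regular functions on the set of nondegenerate fields: near each point of this set, in the Zariski topology, they are quotients of polynomials in the coefficients of $v$. (b) For generic $v\in\mathcal A_2$ the derivative of the moduli map at $v$ has full rank $5$. That is, let $T_v$ be the tangent space at $v$ to its orbit, i.e. the space of all fields $DX\cdot v-Dv\cdot X+cv$ with $X$ an affine vector field and $c\in\mathbb C$. For generic $v\in\mathcal A_2$: $v$ is nondegenerate; $\dim\mathcal A_2/T_v=5$; the singular points of fields $w$ near $v$ can be numbered, continuously at $v$; and for every such numbering the map $w\mapsto M(w)\in\mathbb C^7$ is differentiable at $v$, and its derivative descends to a linear map $\mathcal A_2/T_v\to\mathbb C^7$ of rank $5$. -/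

import Mathlib

open scoped Topology

/-- Exponents `(i, j)` of the monomials `x ^ i * y ^ j` of degree at most `n`. -/
abbrev PlaneExp (n : ℕ) : Type := {d : Fin (n + 1) × Fin (n + 1) // (d.1 : ℕ) + (d.2 : ℕ) ≤ n}

/-- Coordinates on the space of planar polynomial vector fields of degree at most `n`:
a component (`0` for `∂/∂x`, `1` for `∂/∂y`) and a monomial. -/
abbrev VFCoord (n : ℕ) : Type := Fin 2 × PlaneExp n

/-- The vector space `𝒜ₙ` of polynomial vector fields `P ∂/∂x + Q ∂/∂y` on `ℂ²` with
`deg P, deg Q ≤ n`, given by their coefficients; its dimension is `(n + 1) * (n + 2)`. -/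
abbrev PlaneVF (n : ℕ) : Type := VFCoord n → ℂ

noncomputable section

namespace PlaneVF

variable {n : ℕ}

/-- The vector field `v = (P, Q)` as a map `ℂ² → ℂ²`. -/
def field (v : PlaneVF n) (q : ℂ × ℂ) : ℂ × ℂ :=
  (∑ d : PlaneExp n, v (0, d) * q.1 ^ (d.1.1 : ℕ) * q.2 ^ (d.1.2 : ℕ),
   ∑ d : PlaneExp n, v (1, d) * q.1 ^ (d.1.1 : ℕ) * q.2 ^ (d.1.2 : ℕ))

/-- The degree-`n` homogenizations of `P` (`i = 0`) and `Q` (`i = 1`):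
`z ^ n * P (x / z, y / z)` and `z ^ n * Q (x / z, y / z)`. -/
def homogenized (v : PlaneVF n) (i : Fin 2) (x y z : ℂ) : ℂ :=
  ∑ d : PlaneExp n,
    v (i, d) * x ^ (d.1.1 : ℕ) * y ^ (d.1.2 : ℕ) * z ^ (n - (d.1.1 : ℕ) - (d.1.2 : ℕ))

/-- The foliation of `ℂP²` in the chart `(w, u) = (y / x, 1 / x)`, where the line at infinity is
`u = 0`: it is generated by `u ^ (n - 1)` times `v`, that is by
`w' = Q̃(1, w, u) - w P̃(1, w, u)`, `u' = - u P̃(1, w, u)`. -/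
def chartX (v : PlaneVF n) (q : ℂ × ℂ) : ℂ × ℂ :=
  (v.homogenized 1 1 q.1 q.2 - q.1 * v.homogenized 0 1 q.1 q.2,
   - (q.2 * v.homogenized 0 1 q.1 q.2))

/-- The foliation of `ℂP²` in the chart `(s, u) = (x / y, 1 / y)`, where the line at infinity is
`u = 0`: it is generated by `u ^ (n - 1)` times `v`, that is by
`s' = P̃(s, 1, u) - s Q̃(s, 1, u)`, `u' = - u Q̃(s, 1, u)`. -/
def chartY (v : PlaneVF n) (q : ℂ × ℂ) : ℂ × ℂ :=
  (v.homogenized 0 q.1 1 q.2 - q.1 * v.homogenized 1 q.1 1 q.2,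
   - (q.2 * v.homogenized 1 q.1 1 q.2))

theorem homogenized_eq_fst (v : PlaneVF n) {x y z : ℂ} (hz : z ≠ 0) :
    v.homogenized 0 x y z = z ^ n * (v.field (x / z, y / z)).1 := by
  simp only [homogenized, field, Finset.mul_sum]
  refine Finset.sum_congr rfl fun d _ => ?_
  have hd : z ^ n = z ^ (n - (d.1.1 : ℕ) - (d.1.2 : ℕ)) * z ^ (d.1.1 : ℕ) * z ^ (d.1.2 : ℕ) := by
    rw [← pow_add, ← pow_add]
    congr 1
    have := d.2
    omega
  rw [hd, div_pow, div_pow]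
  field_simp

theorem homogenized_eq_snd (v : PlaneVF n) {x y z : ℂ} (hz : z ≠ 0) :
    v.homogenized 1 x y z = z ^ n * (v.field (x / z, y / z)).2 := by
  simp only [homogenized, field, Finset.mul_sum]
  refine Finset.sum_congr rfl fun d _ => ?_
  have hd : z ^ n = z ^ (n - (d.1.1 : ℕ) - (d.1.2 : ℕ)) * z ^ (d.1.1 : ℕ) * z ^ (d.1.2 : ℕ) := by
    rw [← pow_add, ← pow_add]
    congr 1
    have := d.2
    omega
  rw [hd, div_pow, div_pow]
  field_simp

/-- On the overlap of the charts, `x ^ n • chartX v = x • (w', u')`, where `(w', u')` is the image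
of `v` under the coordinate change `(w, u) = (y / x, 1 / x)`. -/
theorem chartX_eq (v : PlaneVF n) {x y : ℂ} (hx : x ≠ 0) :
    x ^ n • v.chartX (y / x, 1 / x) =
      x • ((x * (v.field (x, y)).2 - y * (v.field (x, y)).1) / x ^ 2,
        - (v.field (x, y)).1 / x ^ 2) := by
  have hx' : (1 / x : ℂ) ≠ 0 := one_div_ne_zero hx
  have e : ((1 : ℂ) / (1 / x), y / x / (1 / x)) = (x, y) := by
    ext <;> field_simp
  simp only [chartX, homogenized_eq_fst v hx', homogenized_eq_snd v hx', e]
  ext <;> simp <;> field_simp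

/-- The same for the chart `(s, u) = (x / y, 1 / y)`. -/
theorem chartY_eq (v : PlaneVF n) {x y : ℂ} (hy : y ≠ 0) :
    y ^ n • v.chartY (x / y, 1 / y) =
      y • ((y * (v.field (x, y)).1 - x * (v.field (x, y)).2) / y ^ 2,
        - (v.field (x, y)).2 / y ^ 2) := by
  have hy' : (1 / y : ℂ) ≠ 0 := one_div_ne_zero hy
  have e : (x / y / (1 / y), (1 : ℂ) / (1 / y)) = (x, y) := by
    ext <;> field_simp
  simp only [chartY, homogenized_eq_fst v hy', homogenized_eq_snd v hy', e]
  ext <;> simp <;> field_simp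

/-- Points of the line at infinity of `ℂP²` are slopes: `w : ℂ` stands for `[1 : w : 0]` and `∞`
for `[0 : 1 : 0]`. This is the value at such a point of the vector field that generates the
foliation near it. -/
def valueInf (v : PlaneVF n) (o : OnePoint ℂ) : ℂ × ℂ :=
  o.elim (v.chartY (0, 0)) (fun w => v.chartX (w, 0))

/-- The linearization at a point of the line at infinity of the vector field that generates the
foliation near it. -/
def linInf (v : PlaneVF n) (o : OnePoint ℂ) : (ℂ × ℂ) →ₗ[ℂ] (ℂ × ℂ) :=
  o.elim (fderiv ℂ v.chartY (0, 0) : (ℂ × ℂ) →ₗ[ℂ] (ℂ × ℂ))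
    (fun w => (fderiv ℂ v.chartX (w, 0) : (ℂ × ℂ) →ₗ[ℂ] (ℂ × ℂ)))

/-- The linearization of `v` at a point of `ℂ²`. -/
def linFin (v : PlaneVF n) (q : ℂ × ℂ) : (ℂ × ℂ) →ₗ[ℂ] (ℂ × ℂ) :=
  (fderiv ℂ v.field q : (ℂ × ℂ) →ₗ[ℂ] (ℂ × ℂ))

/-- The singular points of the foliation on the line at infinity. -/
def singInf (v : PlaneVF n) : Set (OnePoint ℂ) := {o | v.valueInf o = 0}

/-- The singular points of the foliation in `ℂ²`. -/
def singFin (v : PlaneVF n) : Set (ℂ × ℂ) := {q | v.field q = 0}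

/-- The Baum–Bott index `ν = λ / μ + μ / λ = (λ + μ) ^ 2 / (λ * μ) - 2` of a linear map with
eigenvalues `λ, μ ≠ 0`. -/
def bbIndex (L : (ℂ × ℂ) →ₗ[ℂ] (ℂ × ℂ)) : ℂ :=
  (LinearMap.trace ℂ (ℂ × ℂ) L) ^ 2 / LinearMap.det L - 2

theorem bbIndex_eq (L : (ℂ × ℂ) →ₗ[ℂ] (ℂ × ℂ)) (a b : ℂ) (ha : a ≠ 0) (hb : b ≠ 0)
    (h : L.charpoly = (Polynomial.X - Polynomial.C a) * (Polynomial.X - Polynomial.C b)) :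
    bbIndex L = a / b + b / a := by
  have hfr : Module.finrank ℂ (ℂ × ℂ) = 2 := by simp
  have hd : LinearMap.det L = a * b := by
    rw [LinearMap.det_eq_sign_charpoly_coeff, h, hfr]
    simp [Polynomial.coeff_zero_eq_eval_zero]
  have ht : LinearMap.trace ℂ (ℂ × ℂ) L = a + b := by
    have h1 : L.charpoly.roots = {a, b} := by
      rw [h, Polynomial.roots_mul
        (mul_ne_zero (Polynomial.X_sub_C_ne_zero a) (Polynomial.X_sub_C_ne_zero b))]
      simp
    rw [Module.End.trace_eq_sum_roots_charpoly_of_splits (IsAlgClosed.splits _), h1]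
    simp
  rw [bbIndex, hd, ht]
  field_simp
  ring

/-- The domain of the moduli map: the foliation has exactly `n + 1` singular points at infinity
and exactly `n ^ 2` singular points in `ℂ²`, and the eigenvalues at all of them are nonzero. -/
def IsNondegenerate (v : PlaneVF n) : Prop :=
  v.singInf.encard = ((n + 1 : ℕ) : ℕ∞) ∧ v.singFin.encard = ((n ^ 2 : ℕ) : ℕ∞) ∧
  (∀ o ∈ v.singInf, LinearMap.det (v.linInf o) ≠ 0) ∧
  (∀ q ∈ v.singFin, LinearMap.det (v.linFin q) ≠ 0)

/-- `O` and `Q` number, without repetition, all singular points of the foliation at infinity and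
in `ℂ²`, respectively. -/
def IsNumbering (v : PlaneVF n) (O : Fin (n + 1) → OnePoint ℂ) (Q : Fin (n ^ 2) → ℂ × ℂ) :
    Prop :=
  Function.Injective O ∧ Set.range O = v.singInf ∧ Function.Injective Q ∧ Set.range Q = v.singFin

/-- The tuple of the Baum–Bott indices at numbered points, in `ℂ ^ N`, `N = n ^ 2 + n + 1`. -/
def bbTuple (v : PlaneVF n) (O : Fin (n + 1) → OnePoint ℂ) (Q : Fin (n ^ 2) → ℂ × ℂ) :
    Fin (n + 1) ⊕ Fin (n ^ 2) → ℂ :=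
  Sum.elim (fun i => bbIndex (v.linInf (O i))) (fun j => bbIndex (v.linFin (Q j)))

/-- The values `M(v)`: all tuples of Baum–Bott indices of `v`, one for each numbering of the
singular points (no value outside the domain of the moduli map). -/
def bbTuples (v : PlaneVF n) : Set (Fin (n + 1) ⊕ Fin (n ^ 2) → ℂ) :=
  {t | v.IsNondegenerate ∧ ∃ O Q, v.IsNumbering O Q ∧ t = v.bbTuple O Q}

/-- Equivalence under affine maps and multiplication by nonzero constants: `v' = c • g_* v`. -/
def AffEquiv (v v' : PlaneVF n) : Prop :=
  ∃ (g : (ℂ × ℂ) ≃ᵃ[ℂ] (ℂ × ℂ)) (c : ℂˣ),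
    ∀ q, v'.field (g q) = (c : ℂ) • g.linear (v.field q)

abbrev affSetoid (n : ℕ) : Setoid (PlaneVF n) where
  r := AffEquiv
  iseqv :=
    { refl := fun v => ⟨AffineEquiv.refl ℂ _, 1, fun q => by simp⟩
      symm := by
        rintro v v' ⟨g, c, h⟩
        refine ⟨g.symm, c⁻¹, fun q => ?_⟩
        have := h (g.symm q)
        rw [AffineEquiv.apply_symm_apply] at this
        rw [this]
        simp
      trans := by
        rintro v v' v'' ⟨g, c, h⟩ ⟨g', c', h'⟩
        refine ⟨g.trans g', c' * c, fun q => ?_⟩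
        have e : (g.trans g') q = g' (g q) := rfl
        have e' : (g.trans g').linear (v.field q) = g'.linear (g.linear (v.field q)) := rfl
        rw [e, e', h', h]
        simp [mul_smul] }

/-- The quotient `𝒜ₙ / (Aff ℂ² × ℂ*)`. -/
abbrev ModuliSpace (n : ℕ) : Type := Quotient (affSetoid n)

/-- The moduli (Baum–Bott) map on `𝒜ₙ / (Aff ℂ² × ℂ*)`. It is multivalued because the singular
points carry no canonical numbering: the value at a class is the set of the Baum–Bott tuples of
its members. -/
def moduliMap (c : ModuliSpace n) : Set (Fin (n + 1) ⊕ Fin (n ^ 2) → ℂ) :=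
  {t | ∃ v : PlaneVF n, (Quotient.mk (affSetoid n) v : ModuliSpace n) = c ∧ t ∈ v.bbTuples}

/-- `f` is a regular function on the domain of the moduli map: near every point of the domain, in
the Zariski topology, it is a quotient of two polynomials in the coefficients of `v`. -/
def IsRegularFun (f : PlaneVF n → ℂ) : Prop :=
  ∀ v₀ : PlaneVF n, v₀.IsNondegenerate →
    ∃ a b : MvPolynomial (VFCoord n) ℂ, MvPolynomial.eval v₀ b ≠ 0 ∧
      ∀ v : PlaneVF n, v.IsNondegenerate → MvPolynomial.eval v b ≠ 0 →
        f v = MvPolynomial.eval v a / MvPolynomial.eval v b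

/-- A property holds for generic `v`: outside a proper algebraic subset of `𝒜ₙ`. -/
def ForGeneric (p : PlaneVF n → Prop) : Prop :=
  ∃ D : MvPolynomial (VFCoord n) ℂ, D ≠ 0 ∧ ∀ v : PlaneVF n, MvPolynomial.eval v D ≠ 0 → p v

/-- `O` and `Q` number the singular points for all fields near `v₀`, continuously at `v₀`. The
function `v ↦ v.bbTuple (O v) (Q v)` is then a single-valued branch of the moduli map at `v₀`. -/
def IsLocalNumbering (v₀ : PlaneVF n) (O : PlaneVF n → Fin (n + 1) → OnePoint ℂ)
    (Q : PlaneVF n → Fin (n ^ 2) → ℂ × ℂ) : Prop :=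
  (∀ᶠ v in 𝓝 v₀, v.IsNumbering (O v) (Q v)) ∧ ContinuousAt O v₀ ∧ ContinuousAt Q v₀

theorem field_add (v w : PlaneVF n) (q : ℂ × ℂ) :
    (v + w : PlaneVF n).field q = v.field q + w.field q := by
  ext <;> simp [field, add_mul, Finset.sum_add_distrib]

theorem field_smul (a : ℂ) (v : PlaneVF n) (q : ℂ × ℂ) :
    (a • v : PlaneVF n).field q = a • v.field q := by
  ext <;> simp [field, Finset.mul_sum, mul_assoc]

/-- The tangent space at `v` to the orbit of `Aff ℂ² × ℂ*`: it consists of the fields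
`DX · v - Dv · X + c v`, where `X` is an affine vector field (the velocity of the push-forward of
`v` by the flow of `X`) and `c` is a constant. The tangent space of the quotient at the class
of `v` is the quotient of `𝒜ₙ` by it. -/
def orbitTangent (v : PlaneVF n) : Submodule ℂ (PlaneVF n) where
  carrier := {w | ∃ (X : (ℂ × ℂ) →ᵃ[ℂ] (ℂ × ℂ)) (c : ℂ), ∀ q,
    w.field q = X.linear (v.field q) - fderiv ℂ v.field q (X q) + c • v.field q}
  zero_mem' := ⟨0, 0, fun q => by ext <;> simp [field]⟩
  add_mem' := by
    rintro w w' ⟨X, c, h⟩ ⟨X', c', h'⟩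
    refine ⟨X + X', c + c', fun q => ?_⟩
    rw [field_add, h, h', AffineMap.add_linear, LinearMap.add_apply, AffineMap.coe_add,
      Pi.add_apply, map_add, add_smul]
    abel
  smul_mem' := by
    rintro a w ⟨X, c, h⟩
    refine ⟨a • X, a * c, fun q => ?_⟩
    rw [field_smul, h, AffineMap.smul_linear, LinearMap.smul_apply, AffineMap.coe_smul,
      Pi.smul_apply, map_smul, mul_smul, smul_add, smul_sub]

/-- `L` is the derivative, at the class of `v`, of the branch of the moduli map given by `O` and
`Q`: the branch is differentiable at `v` on `𝒜ₙ`, and its derivative descends to the linear map `L`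
on the tangent space of `𝒜ₙ / (Aff ℂ² × ℂ*)`. -/
def IsModuliDerivative (v : PlaneVF n) (O : PlaneVF n → Fin (n + 1) → OnePoint ℂ)
    (Q : PlaneVF n → Fin (n ^ 2) → ℂ × ℂ)
    (L : (PlaneVF n ⧸ v.orbitTangent) →ₗ[ℂ] (Fin (n + 1) ⊕ Fin (n ^ 2) → ℂ)) : Prop :=
  ∃ M' : PlaneVF n →L[ℂ] (Fin (n + 1) ⊕ Fin (n ^ 2) → ℂ),
    HasFDerivAt (fun w : PlaneVF n => w.bbTuple (O w) (Q w)) M' v ∧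
    ∀ w : PlaneVF n, M' w = L (v.orbitTangent.mkQ w)

end PlaneVF

end

/-! ### Linear maps of the plane -/

/-! The singular points are roots of polynomials in one variable whose coefficients are rational in
`v`; symmetric functions of rational expressions at such roots are resultants, hence rational in
`v`. At infinity the polynomial is `infFun`, of degree `n + 1` once the coefficient of `y ^ n` in
`P` is nonzero. In the plane put `N = n ^ 2` and let `v₀ = (P, Q)` have only simple zeros, among
them `N` with distinct abscissae, and a component of exact degree `n`. Then the polynomials `A P + B
Q + w(x)` with `deg A, deg B ≤ N + n` and `deg w < N` fill all degrees up to `N + 2n`: only Koszul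
syzygies lie in the kernel, and the dimensions match (`bezoutMap_surjective`). Cramer's rule spreads
this from `v₀` to all `v` with a certain determinant `b` nonzero, and gives a monic `R(x)` of degree
`N` and a polynomial `y - Y(x)` in the ideal `(P, Q)` (`exists_eliminants`). A shear puts any
nondegenerate field in this position, and the indices do not change under the affine group. For the
points at infinity this invariance comes from viewing them as eigendirections of the leading
homogeneous part (`trace_det_linInf`, `linInf_affine`). This proves `isRegularFun_coeff_bbPoly`.

Generic nondegeneracy means that two discriminants are nonzero polynomials in `v`; this is seen on
`(y ^ n - 1, x ^ n - y)` for the plane and on `(y ^ n, x ^ n)` for infinity. By the identity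
principle `R` divides `P(x, Y(x))` and `Q(x, Y(x))` wherever `b ≠ 0`, so simple roots of `R` give
exactly `n ^ 2` simple zeros (`Eliminants.singFin_of_simple_roots`).

For the rank, a continuous branch of the moduli map takes finitely many values along an orbit, so it
is locally constant there and its derivative kills `orbitTangent`. That space has dimension 7 in the
12-dimensional space of quadratic fields, so the rank is at most 5. Conversely, at one explicit
quadratic field the derivative is injective on five directions (`directions_eq_zero`). The indices
of this field are distinct at infinity and distinct in the plane, so the injectivity is visible on
their symmetric functions. These are rational in `v`, so the injectivity persists where a certain
minor does not vanish (`forGeneric_injective`). -/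

theorem prod_linearMap_trace (L : (ℂ × ℂ) →ₗ[ℂ] (ℂ × ℂ)) :
    LinearMap.trace ℂ (ℂ × ℂ) L = (L (1, 0)).1 + (L (0, 1)).2 := by
  rw [LinearMap.trace_eq_matrix_trace ℂ (Module.Basis.finTwoProd ℂ)]
  simp [Matrix.trace, LinearMap.toMatrix_apply]

theorem prod_linearMap_det (L : (ℂ × ℂ) →ₗ[ℂ] (ℂ × ℂ)) :
    LinearMap.det L = (L (1, 0)).1 * (L (0, 1)).2 - (L (0, 1)).1 * (L (1, 0)).2 := by
  rw [← LinearMap.det_toMatrix (Module.Basis.finTwoProd ℂ), Matrix.det_fin_two]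
  simp [LinearMap.toMatrix_apply]

theorem fderiv_prod_apply_fst {f : ℂ × ℂ → ℂ × ℂ} {q : ℂ × ℂ} (hf : DifferentiableAt ℂ f q)
    {d : ℂ × ℂ} (h : HasDerivAt (fun t => f (t, q.2)) d q.1) : fderiv ℂ f q (1, 0) = d := by
  have h1 : HasDerivAt (fun t : ℂ => ((t, q.2) : ℂ × ℂ)) (1, 0) q.1 :=
    (hasDerivAt_id q.1).prodMk (hasDerivAt_const q.1 q.2)
  have h2 : HasFDerivAt f (fderiv ℂ f q) ((fun t : ℂ => ((t, q.2) : ℂ × ℂ)) q.1) :=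
    hf.hasFDerivAt
  exact (h2.comp_hasDerivAt q.1 h1).unique h

theorem fderiv_prod_apply_snd {f : ℂ × ℂ → ℂ × ℂ} {q : ℂ × ℂ} (hf : DifferentiableAt ℂ f q)
    {d : ℂ × ℂ} (h : HasDerivAt (fun t => f (q.1, t)) d q.2) : fderiv ℂ f q (0, 1) = d := by
  have h1 : HasDerivAt (fun t : ℂ => ((q.1, t) : ℂ × ℂ)) (0, 1) q.2 :=
    (hasDerivAt_const q.2 q.1).prodMk (hasDerivAt_id q.2)
  have h2 : HasFDerivAt f (fderiv ℂ f q) ((fun t : ℂ => ((q.1, t) : ℂ × ℂ)) q.2) :=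
    hf.hasFDerivAt
  exact (h2.comp_hasDerivAt q.2 h1).unique h

/-- The index is a function of trace² / det, which is homogeneous of degree zero. The factor `k`
absorbs both the constant of the group action and the choice of a vector representing a direction at
infinity. -/
theorem bbIndex_of_scaled {L L' : (ℂ × ℂ) →ₗ[ℂ] (ℂ × ℂ)} {k : ℂ} (hk : k ≠ 0)
    (ht : LinearMap.trace ℂ (ℂ × ℂ) L' = k * LinearMap.trace ℂ (ℂ × ℂ) L)
    (hd : LinearMap.det L' = k ^ 2 * LinearMap.det L) :
    PlaneVF.bbIndex L' = PlaneVF.bbIndex L := by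
  rw [PlaneVF.bbIndex, PlaneVF.bbIndex, ht, hd, mul_pow,
    mul_div_mul_left _ _ (pow_ne_zero 2 hk)]

namespace PlaneVF

variable {n : ℕ}

/-! ### Smoothness -/

theorem contDiff_homogenized (i : Fin 2) :
    ContDiff ℂ ⊤ (fun p : PlaneVF n × ℂ × ℂ × ℂ => p.1.homogenized i p.2.1 p.2.2.1 p.2.2.2) := by
  unfold homogenized
  fun_prop

theorem contDiff_field : ContDiff ℂ ⊤ (fun p : PlaneVF n × ℂ × ℂ => p.1.field p.2) := by
  unfold field
  fun_prop

theorem differentiable_field (v : PlaneVF n) : Differentiable ℂ v.field := by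
  unfold field
  fun_prop

theorem differentiable_chartX (v : PlaneVF n) : Differentiable ℂ v.chartX := by
  unfold chartX homogenized
  fun_prop

theorem differentiable_chartY (v : PlaneVF n) : Differentiable ℂ v.chartY := by
  unfold chartY homogenized
  fun_prop

/-- The homogeneous part of degree `n` of `v`. -/
def topField (v : PlaneVF n) (e : ℂ × ℂ) : ℂ × ℂ :=
  (v.homogenized 0 e.1 e.2 0, v.homogenized 1 e.1 e.2 0)

theorem differentiable_topField (v : PlaneVF n) : Differentiable ℂ v.topField := by
  unfold topField homogenized
  fun_prop

theorem homogenized_smul (v : PlaneVF n) (i : Fin 2) (c x y z : ℂ) :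
    v.homogenized i (c * x) (c * y) (c * z) = c ^ n * v.homogenized i x y z := by
  simp only [homogenized, Finset.mul_sum]
  refine Finset.sum_congr rfl fun d _ => ?_
  have hd : c ^ n = c ^ (n - (d.1.1 : ℕ) - (d.1.2 : ℕ)) * c ^ (d.1.1 : ℕ) * c ^ (d.1.2 : ℕ) := by
    rw [← pow_add, ← pow_add]
    congr 1
    have := d.2
    omega
  rw [hd, mul_pow, mul_pow, mul_pow]
  ring

theorem topField_smul (v : PlaneVF n) (c : ℂ) (e : ℂ × ℂ) :
    v.topField (c • e) = c ^ n • v.topField e := by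
  have h0 := v.homogenized_smul 0 c e.1 e.2 0
  have h1 := v.homogenized_smul 1 c e.1 e.2 0
  rw [mul_zero] at h0 h1
  ext <;> simp [topField, h0, h1]

/-- Euler's identity. -/
theorem fderiv_topField_self (v : PlaneVF n) (e : ℂ × ℂ) :
    fderiv ℂ v.topField e e = (n : ℂ) • v.topField e := by
  have h1 : HasDerivAt (fun t : ℂ => t • e) e 1 := by
    simpa using (hasDerivAt_id (1 : ℂ)).smul_const e
  have h2 : HasFDerivAt v.topField (fderiv ℂ v.topField e) ((fun t : ℂ => t • e) 1) := by
    simpa using (v.differentiable_topField e).hasFDerivAt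
  have h3 : HasDerivAt (fun t : ℂ => t ^ n • v.topField e) ((n : ℂ) • v.topField e) 1 := by
    simpa using (hasDerivAt_pow n (1 : ℂ)).smul_const (v.topField e)
  have h4 := h2.comp_hasDerivAt 1 h1
  have e1 : v.topField ∘ (fun t : ℂ => t • e) = fun t : ℂ => t ^ n • v.topField e := by
    funext t
    exact v.topField_smul t e
  rw [e1] at h4
  exact h4.unique h3

/-- The chain rule applied to homogeneity. The extra factor `c` on the left avoids the exponent `n -
1`, so that `n = 0` needs no separate treatment. -/
theorem smul_fderiv_topField_smul (v : PlaneVF n) (c : ℂ) (e : ℂ × ℂ) :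
    c • fderiv ℂ v.topField (c • e) = c ^ n • fderiv ℂ v.topField e := by
  have h1 : HasFDerivAt (fun x : ℂ × ℂ => c • x) (c • ContinuousLinearMap.id ℂ (ℂ × ℂ)) e :=
    (hasFDerivAt_id e).const_smul c
  have h2 : HasFDerivAt v.topField (fderiv ℂ v.topField (c • e)) (c • e) :=
    (v.differentiable_topField _).hasFDerivAt
  have h3 : HasFDerivAt (fun x => c ^ n • v.topField x) (c ^ n • fderiv ℂ v.topField e) e :=
    (v.differentiable_topField e).hasFDerivAt.const_smul (c ^ n)
  have h4 := h2.comp e h1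
  have e1 : v.topField ∘ (fun x : ℂ × ℂ => c • x) = fun x => c ^ n • v.topField x := by
    funext x
    exact v.topField_smul c x
  rw [e1] at h4
  rw [← h4.unique h3]
  ext <;> simp

/-! ### The singular points at infinity as directions -/

/-- A vector of the given slope. -/
def slopeRep (o : OnePoint ℂ) : ℂ × ℂ := o.elim (0, 1) (fun w => (1, w))

open Classical in
/-- The slope of a nonzero vector. -/
noncomputable def slopeOf (e : ℂ × ℂ) : OnePoint ℂ := if e.1 = 0 then OnePoint.infty else ((e.2 / e.1 : ℂ) : OnePoint ℂ)

theorem slopeRep_infty : slopeRep OnePoint.infty = (0, 1) := rfl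

theorem slopeRep_coe (w : ℂ) : slopeRep (w : OnePoint ℂ) = (1, w) := rfl

theorem slopeRep_ne_zero (o : OnePoint ℂ) : slopeRep o ≠ 0 := by
  induction o using OnePoint.rec with
  | infty => simp [slopeRep_infty]
  | coe w => simp [slopeRep_coe]

theorem slopeOf_slopeRep (o : OnePoint ℂ) : slopeOf (slopeRep o) = o := by
  induction o using OnePoint.rec with
  | infty => simp [slopeRep_infty, slopeOf]
  | coe w => simp [slopeRep_coe, slopeOf]

theorem slopeOf_smul {c : ℂ} (hc : c ≠ 0) (e : ℂ × ℂ) : slopeOf (c • e) = slopeOf e := by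
  by_cases h : e.1 = 0
  · simp [slopeOf, h]
  · simp [slopeOf, h, hc, mul_div_mul_left]

theorem exists_smul_slopeRep {e : ℂ × ℂ} (he : e ≠ 0) :
    ∃ c : ℂ, c ≠ 0 ∧ e = c • slopeRep (slopeOf e) := by
  by_cases h : e.1 = 0
  · refine ⟨e.2, fun h2 => he (Prod.ext h h2), ?_⟩
    simp only [slopeOf, h, if_true, slopeRep_infty]
    ext <;> simp [h]
  · refine ⟨e.1, h, ?_⟩
    simp only [slopeOf, h, if_false, slopeRep_coe]
    ext
    · simp
    · simp [mul_div_cancel₀ _ h]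

theorem valueInf_coe (v : PlaneVF n) (w : ℂ) :
    v.valueInf (w : OnePoint ℂ) = (v.homogenized 1 1 w 0 - w * v.homogenized 0 1 w 0, 0) := by
  show v.chartX (w, 0) = _
  simp [chartX]

theorem valueInf_infty (v : PlaneVF n) :
    v.valueInf OnePoint.infty = (v.homogenized 0 0 1 0, 0) := by
  show v.chartY (0, 0) = _
  simp [chartY]

/-- The field on the line at infinity is the leading homogeneous part projected to directions, so it
vanishes at the eigendirections. This description involves no chart and makes the action of linear
maps transparent. -/
theorem mem_singInf_iff (v : PlaneVF n) (o : OnePoint ℂ) :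
    o ∈ v.singInf ↔ ∃ m : ℂ, v.topField (slopeRep o) = m • slopeRep o := by
  induction o using OnePoint.rec with
  | infty =>
    simp only [singInf, Set.mem_ofPred_eq, valueInf_infty, slopeRep_infty, topField]
    constructor
    · intro h
      refine ⟨v.homogenized 1 0 1 0, ?_⟩
      have := congrArg Prod.fst h
      ext <;> simp_all
    · rintro ⟨m, h⟩
      have := congrArg Prod.fst h
      ext <;> simp_all
  | coe w =>
    simp only [singInf, Set.mem_ofPred_eq, valueInf_coe, slopeRep_coe, topField]
    constructor
    · intro h
      refine ⟨v.homogenized 0 1 w 0, ?_⟩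
      have := congrArg Prod.fst h
      simp only [Prod.fst_zero, sub_eq_zero] at this
      ext
      · simp
      · simp [this, mul_comm]
    · rintro ⟨m, h⟩
      have h1 := congrArg Prod.fst h
      have h2 := congrArg Prod.snd h
      simp only [Prod.smul_mk, smul_eq_mul, mul_one] at h1 h2
      ext
      · simp [h1, h2, mul_comm]
      · simp

/-- The restriction to the line at infinity, in the coordinate `w = y / x`, of the field that
generates the foliation. -/
def infFun (v : PlaneVF n) (w : ℂ) : ℂ := v.homogenized 1 1 w 0 - w * v.homogenized 0 1 w 0

theorem differentiable_infFun (v : PlaneVF n) : Differentiable ℂ v.infFun := by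
  unfold infFun homogenized
  fun_prop

theorem coe_mem_singInf_iff (v : PlaneVF n) (w : ℂ) :
    (w : OnePoint ℂ) ∈ v.singInf ↔ v.infFun w = 0 := by
  simp [singInf, valueInf_coe, infFun]

theorem infty_mem_singInf_iff (v : PlaneVF n) :
    OnePoint.infty ∈ v.singInf ↔ v.homogenized 0 0 1 0 = 0 := by
  simp [singInf, valueInf_infty]

/-- The line at infinity is invariant, so the linearization is triangular: only its diagonal entries
enter the trace and the determinant, and the remaining one is left uncomputed. -/
theorem linInf_coe_aux (v : PlaneVF n) (w : ℂ) :
    (v.linInf (w : OnePoint ℂ)) (1, 0) = (deriv v.infFun w, 0) ∧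
    ((v.linInf (w : OnePoint ℂ)) (0, 1)).2 = - v.homogenized 0 1 w 0 := by
  have hL : v.linInf (w : OnePoint ℂ) = (fderiv ℂ v.chartX (w, 0) : (ℂ × ℂ) →ₗ[ℂ] (ℂ × ℂ)) := rfl
  rw [hL]
  have hX := v.differentiable_chartX (w, 0)
  constructor
  · refine fderiv_prod_apply_fst hX ?_
    have e : (fun t : ℂ => v.chartX (t, ((w, 0) : ℂ × ℂ).2)) = fun t => (v.infFun t, 0) := by
      funext t
      simp [chartX, infFun]
    rw [e]
    exact (v.differentiable_infFun w).hasDerivAt.prodMk (hasDerivAt_const _ _)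
  · have h0 : DifferentiableAt ℂ (fun u : ℂ => v.homogenized 0 1 w u) 0 := by
      unfold homogenized
      fun_prop
    have h1 : HasDerivAt (fun u : ℂ => -(u * v.homogenized 0 1 w u)) (-v.homogenized 0 1 w 0) 0 := by
      exact ((hasDerivAt_id' (0 : ℂ)).fun_mul h0.hasDerivAt).fun_neg.congr_deriv (by simp)
    have h2 : DifferentiableAt ℂ
        (fun u : ℂ => v.homogenized 1 1 w u - w * v.homogenized 0 1 w u) 0 := by
      unfold homogenized
      fun_prop
    have h3 := fderiv_prod_apply_snd hX (h2.hasDerivAt.prodMk h1)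
    exact congrArg Prod.snd h3

theorem linInf_infty_aux (v : PlaneVF n) :
    (v.linInf OnePoint.infty) (1, 0) =
      (deriv (fun s : ℂ => v.homogenized 0 s 1 0 - s * v.homogenized 1 s 1 0) 0, 0) ∧
    ((v.linInf OnePoint.infty) (0, 1)).2 = - v.homogenized 1 0 1 0 := by
  have hL : v.linInf OnePoint.infty = (fderiv ℂ v.chartY (0, 0) : (ℂ × ℂ) →ₗ[ℂ] (ℂ × ℂ)) := rfl
  rw [hL]
  have hX := v.differentiable_chartY (0, 0)
  constructor
  · refine fderiv_prod_apply_fst hX ?_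
    have e : (fun t : ℂ => v.chartY (t, ((0, 0) : ℂ × ℂ).2)) =
        fun s => (v.homogenized 0 s 1 0 - s * v.homogenized 1 s 1 0, 0) := by
      funext t
      simp [chartY]
    rw [e]
    have : DifferentiableAt ℂ (fun s : ℂ => v.homogenized 0 s 1 0 - s * v.homogenized 1 s 1 0) 0 := by
      unfold homogenized
      fun_prop
    exact this.hasDerivAt.prodMk (hasDerivAt_const _ _)
  · have h0 : DifferentiableAt ℂ (fun u : ℂ => v.homogenized 1 0 1 u) 0 := by
      unfold homogenized
      fun_prop
    have h1 : HasDerivAt (fun u : ℂ => -(u * v.homogenized 1 0 1 u)) (-v.homogenized 1 0 1 0) 0 := by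
      exact ((hasDerivAt_id' (0 : ℂ)).fun_mul h0.hasDerivAt).fun_neg.congr_deriv (by simp)
    have h2 : DifferentiableAt ℂ
        (fun u : ℂ => v.homogenized 0 0 1 u - 0 * v.homogenized 1 0 1 u) 0 := by
      unfold homogenized
      fun_prop
    have h3 := fderiv_prod_apply_snd hX (h2.hasDerivAt.prodMk h1)
    exact congrArg Prod.snd h3

theorem trace_linInf_coe (v : PlaneVF n) (w : ℂ) :
    LinearMap.trace ℂ (ℂ × ℂ) (v.linInf (w : OnePoint ℂ)) =
      deriv v.infFun w - v.homogenized 0 1 w 0 := by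
  rw [prod_linearMap_trace, (v.linInf_coe_aux w).1, (v.linInf_coe_aux w).2, sub_eq_add_neg]

theorem det_linInf_coe (v : PlaneVF n) (w : ℂ) :
    LinearMap.det (v.linInf (w : OnePoint ℂ)) = - (v.homogenized 0 1 w 0 * deriv v.infFun w) := by
  rw [prod_linearMap_det, (v.linInf_coe_aux w).1, (v.linInf_coe_aux w).2]
  simp [mul_comm]

/-- Let `K` be the derivative of the leading part at the eigenvector. By Euler's identity one
eigenvalue of `K` is `n * m`, so the other is `tr K - n * m`. Passing to directions subtracts `m`
from the latter, which gives the eigenvalue along the line at infinity; the transversal eigenvalue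
is `-m`. This expresses the linearization in both charts by quantities that do not refer to a chart.
-/
theorem trace_det_linInf (v : PlaneVF n) (o : OnePoint ℂ) {m : ℂ}
    (h : v.topField (slopeRep o) = m • slopeRep o) :
    LinearMap.trace ℂ (ℂ × ℂ) (v.linInf o) =
      LinearMap.trace ℂ (ℂ × ℂ) (fderiv ℂ v.topField (slopeRep o) : (ℂ × ℂ) →ₗ[ℂ] (ℂ × ℂ))
        - (n + 2) * m ∧
    LinearMap.det (v.linInf o) = - (m * (LinearMap.trace ℂ (ℂ × ℂ)
      (fderiv ℂ v.topField (slopeRep o) : (ℂ × ℂ) →ₗ[ℂ] (ℂ × ℂ)) - (n + 1) * m)) := by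
  have hE := v.fderiv_topField_self (slopeRep o)
  rw [h] at hE
  set K := fderiv ℂ v.topField (slopeRep o) with hK
  have hd := v.differentiable_topField (slopeRep o)
  induction o using OnePoint.rec with
  | infty =>
    rw [slopeRep_infty] at h hE hK hd
    have hm : v.homogenized 1 0 1 0 = m := by simpa [topField] using congrArg Prod.snd h
    have e0 : DifferentiableAt ℂ (fun s : ℂ => v.homogenized 0 s 1 0) 0 := by
      unfold homogenized
      fun_prop
    have e1 : DifferentiableAt ℂ (fun s : ℂ => v.homogenized 1 s 1 0) 0 := by
      unfold homogenized
      fun_prop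
    have h1 := fderiv_prod_apply_fst hd (e0.hasDerivAt.prodMk e1.hasDerivAt)
    rw [← hK] at h1
    have h2 : deriv (fun s : ℂ => v.homogenized 0 s 1 0 - s * v.homogenized 1 s 1 0) 0 =
        deriv (fun s : ℂ => v.homogenized 0 s 1 0) 0 - m := by
      have := e0.hasDerivAt.sub ((hasDerivAt_id (0 : ℂ)).mul e1.hasDerivAt)
      simp only [id, one_mul, zero_mul, add_zero, hm] at this
      exact this.deriv
    have h3 := congrArg Prod.snd hE
    simp only [Prod.smul_mk, smul_eq_mul, mul_one, mul_zero] at h3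
    rw [prod_linearMap_trace, prod_linearMap_trace, prod_linearMap_det, v.linInf_infty_aux.1,
      v.linInf_infty_aux.2, h2, hm]
    simp only [ContinuousLinearMap.coe_coe, h1, h3]
    constructor <;> ring
  | coe w =>
    rw [slopeRep_coe] at h hE hK hd
    have hm : v.homogenized 0 1 w 0 = m := by simpa [topField] using congrArg Prod.fst h
    have e0 : DifferentiableAt ℂ (fun s : ℂ => v.homogenized 0 1 s 0) w := by
      unfold homogenized
      fun_prop
    have e1 : DifferentiableAt ℂ (fun s : ℂ => v.homogenized 1 1 s 0) w := by
      unfold homogenized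
      fun_prop
    have h1 := fderiv_prod_apply_snd hd (e0.hasDerivAt.prodMk e1.hasDerivAt)
    rw [← hK] at h1
    have h2 : deriv v.infFun w = deriv (fun s : ℂ => v.homogenized 1 1 s 0) w -
        (m + w * deriv (fun s : ℂ => v.homogenized 0 1 s 0) w) := by
      have := e1.hasDerivAt.sub ((hasDerivAt_id w).mul e0.hasDerivAt)
      simp only [id, one_mul, hm] at this
      exact this.deriv
    have h4 : ((1, w) : ℂ × ℂ) = (1, 0) + w • (0, 1) := by ext <;> simp
    have hE' : K (1, 0) + w • K (0, 1) = (n : ℂ) • m • ((1, w) : ℂ × ℂ) := by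
      rw [← map_smul, ← map_add, ← h4, hE]
    rw [h1] at hE'
    have h3 := congrArg Prod.fst hE'
    simp only [Prod.smul_mk, smul_eq_mul, mul_one, Prod.fst_add] at h3
    rw [trace_linInf_coe, det_linInf_coe, prod_linearMap_trace, h2, hm]
    simp only [ContinuousLinearMap.coe_coe, h1]
    have h5 := eq_sub_of_add_eq h3
    rw [h5]
    constructor <;> ring

/-! ### Invariance under affine maps -/

/-- The homogenizations of the two fields satisfy the transformation law for `z ≠ 0`, and the
identity extends to `z = 0` by continuity. The translation enters multiplied by `z`, so it
disappears in the limit. -/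
theorem topField_affine {v v' : PlaneVF n} (g : (ℂ × ℂ) ≃ᵃ[ℂ] (ℂ × ℂ)) (c : ℂ)
    (h : ∀ q, v'.field (g q) = c • g.linear (v.field q)) (e : ℂ × ℂ) :
    v'.topField (g.linear e) = c • g.linear (v.topField e) := by
  set b := g 0 with hb
  have hg : ∀ q, g q = g.linear q + b := by
    intro q
    have := g.map_vadd 0 q
    simpa using this
  -- `F z = c A (homogenization of v at (e, z))`, `F' z` the one of `v'` at `(A e + z b, z)`
  let A := g.linear
  let F : ℂ → ℂ × ℂ := fun z => c • A (v.homogenized 0 e.1 e.2 z, v.homogenized 1 e.1 e.2 z)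
  let F' : ℂ → ℂ × ℂ := fun z =>
    (v'.homogenized 0 (A e + z • b).1 (A e + z • b).2 z,
      v'.homogenized 1 (A e + z • b).1 (A e + z • b).2 z)
  have hA : Continuous A := (A : (ℂ × ℂ) →ₗ[ℂ] (ℂ × ℂ)).continuous_of_finiteDimensional
  have hF : Continuous F := by
    have : Continuous fun z : ℂ =>
        ((v.homogenized 0 e.1 e.2 z, v.homogenized 1 e.1 e.2 z) : ℂ × ℂ) := by
      unfold homogenized
      fun_prop
    exact (hA.comp this).const_smul c
  have hF' : Continuous F' := by
    simp only [F']
    unfold homogenized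
    fun_prop
  have hz : ∀ z ∈ ({0}ᶜ : Set ℂ), F' z = F z := by
    intro z hz
    have hz : z ≠ 0 := hz
    simp only [F, F']
    rw [homogenized_eq_fst _ hz, homogenized_eq_snd _ hz, homogenized_eq_fst _ hz,
      homogenized_eq_snd _ hz]
    have e1 : (((A e + z • b).1 / z, (A e + z • b).2 / z) : ℂ × ℂ) = g (e.1 / z, e.2 / z) := by
      rw [hg]
      have : ((e.1 / z, e.2 / z) : ℂ × ℂ) = z⁻¹ • e := by
        ext <;> simp [div_eq_inv_mul]
      rw [this, map_smul]
      ext <;> simp [A] <;> field_simp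
    rw [e1]
    have e2 : ∀ (u : ℂ × ℂ), ((z ^ n * u.1, z ^ n * u.2) : ℂ × ℂ) = z ^ n • u := by
      intro u
      rfl
    rw [e2, e2, h, map_smul, smul_comm]
  have hd : Dense ({0}ᶜ : Set ℂ) := dense_compl_singleton 0
  have h0 : F' 0 = F 0 := congrFun (hF'.ext_on hd hF hz) 0
  simpa [F, F', topField, A] using h0

theorem fderiv_topField_affine {v v' : PlaneVF n} (g : (ℂ × ℂ) ≃ᵃ[ℂ] (ℂ × ℂ)) (c : ℂ)
    (h : ∀ q, v'.field (g q) = c • g.linear (v.field q)) (e : ℂ × ℂ) :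
    LinearMap.trace ℂ (ℂ × ℂ)
        (fderiv ℂ v'.topField (g.linear e) : (ℂ × ℂ) →ₗ[ℂ] (ℂ × ℂ)) =
      c * LinearMap.trace ℂ (ℂ × ℂ) (fderiv ℂ v.topField e : (ℂ × ℂ) →ₗ[ℂ] (ℂ × ℂ)) := by
  let A := (g.linear : (ℂ × ℂ) ≃ₗ[ℂ] (ℂ × ℂ)).toContinuousLinearEquiv
  have h1 : HasFDerivAt v'.topField (fderiv ℂ v'.topField (A e)) (A e) :=
    (v'.differentiable_topField _).hasFDerivAt
  have h2 := h1.comp e A.hasFDerivAt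
  have h3 : HasFDerivAt (fun x => c • A (v.topField x))
      (c • (A : (ℂ × ℂ) →L[ℂ] (ℂ × ℂ)).comp (fderiv ℂ v.topField e)) e :=
    (A.hasFDerivAt.comp e (v.differentiable_topField e).hasFDerivAt).const_smul c
  have e1 : v'.topField ∘ A = fun x => c • A (v.topField x) := by
    funext x
    exact topField_affine g c h x
  rw [e1] at h2
  have h4 := h2.unique h3
  have h5 : (fderiv ℂ v'.topField (g.linear e) : (ℂ × ℂ) →ₗ[ℂ] (ℂ × ℂ)) =
      c • g.linear.conj (fderiv ℂ v.topField e : (ℂ × ℂ) →ₗ[ℂ] (ℂ × ℂ)) := by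
    refine LinearMap.ext fun x => ?_
    have := DFunLike.congr_fun h4 (A.symm x)
    simp only [ContinuousLinearMap.comp_apply, ContinuousLinearEquiv.coe_coe,
      ContinuousLinearEquiv.apply_symm_apply, smul_apply] at this
    exact this
  rw [h5, map_smul, LinearMap.trace_conj', smul_eq_mul]

theorem linFin_affine {v v' : PlaneVF n} (g : (ℂ × ℂ) ≃ᵃ[ℂ] (ℂ × ℂ)) (c : ℂ)
    (h : ∀ q, v'.field (g q) = c • g.linear (v.field q)) (q : ℂ × ℂ) :
    v'.linFin (g q) = c • g.linear.conj (v.linFin q) := by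
  let A := (g.linear : (ℂ × ℂ) ≃ₗ[ℂ] (ℂ × ℂ)).toContinuousLinearEquiv
  have hg : ∀ q, g q = A q + g 0 := by
    intro q
    have := g.map_vadd 0 q
    simp only [vadd_eq_add, add_zero] at this
    exact this
  have h0 : HasFDerivAt g (A : (ℂ × ℂ) →L[ℂ] (ℂ × ℂ)) q := by
    have : (g : ℂ × ℂ → ℂ × ℂ) = fun q => A q + g 0 := funext hg
    rw [this]
    exact A.hasFDerivAt.add_const _
  have h1 : HasFDerivAt v'.field (fderiv ℂ v'.field (g q)) (g q) :=
    (v'.differentiable_field _).hasFDerivAt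
  have h2 := h1.comp q h0
  have h3 : HasFDerivAt (fun x => c • A (v.field x))
      (c • (A : (ℂ × ℂ) →L[ℂ] (ℂ × ℂ)).comp (fderiv ℂ v.field q)) q :=
    (A.hasFDerivAt.comp q (v.differentiable_field q).hasFDerivAt).const_smul c
  have e1 : v'.field ∘ g = fun x => c • A (v.field x) := by
    funext x
    exact h x
  rw [e1] at h2
  have h4 := h2.unique h3
  refine LinearMap.ext fun x => ?_
  have := DFunLike.congr_fun h4 (A.symm x)
  simp only [ContinuousLinearMap.comp_apply, ContinuousLinearEquiv.coe_coe,
    ContinuousLinearEquiv.apply_symm_apply, smul_apply] at this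
  exact this

/-- The action of a linear automorphism on slopes. -/
noncomputable def slopeEquiv (A : (ℂ × ℂ) ≃ₗ[ℂ] (ℂ × ℂ)) : OnePoint ℂ ≃ OnePoint ℂ where
  toFun o := slopeOf (A (slopeRep o))
  invFun o := slopeOf (A.symm (slopeRep o))
  left_inv o := by
    have h : A (slopeRep o) ≠ 0 := by simpa using slopeRep_ne_zero o
    obtain ⟨c, hc, e⟩ := exists_smul_slopeRep h
    have : slopeRep (slopeOf (A (slopeRep o))) = c⁻¹ • A (slopeRep o) := by
      rw [eq_inv_smul_iff₀ hc, ← e]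
    simp only [this, map_smul, LinearEquiv.symm_apply_apply, slopeOf_smul (inv_ne_zero hc),
      slopeOf_slopeRep]
  right_inv o := by
    have h : A.symm (slopeRep o) ≠ 0 := by simpa using slopeRep_ne_zero o
    obtain ⟨c, hc, e⟩ := exists_smul_slopeRep h
    have : slopeRep (slopeOf (A.symm (slopeRep o))) = c⁻¹ • A.symm (slopeRep o) := by
      rw [eq_inv_smul_iff₀ hc, ← e]
    simp only [this, map_smul, LinearEquiv.apply_symm_apply, slopeOf_smul (inv_ne_zero hc),
      slopeOf_slopeRep]

theorem linInf_affine {v v' : PlaneVF n} (g : (ℂ × ℂ) ≃ᵃ[ℂ] (ℂ × ℂ)) {c : ℂ} (hc : c ≠ 0)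
    (h : ∀ q, v'.field (g q) = c • g.linear (v.field q)) {o : OnePoint ℂ} (ho : o ∈ v.singInf) :
    slopeEquiv g.linear o ∈ v'.singInf ∧ ∃ k : ℂ, k ≠ 0 ∧
      LinearMap.trace ℂ (ℂ × ℂ) (v'.linInf (slopeEquiv g.linear o)) =
        k * LinearMap.trace ℂ (ℂ × ℂ) (v.linInf o) ∧
      LinearMap.det (v'.linInf (slopeEquiv g.linear o)) = k ^ 2 * LinearMap.det (v.linInf o) := by
  obtain ⟨m, hm⟩ := (v.mem_singInf_iff o).1 ho
  set e := slopeRep o with he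
  have hAe : g.linear e ≠ 0 := by simpa using slopeRep_ne_zero o
  obtain ⟨d, hd, hde⟩ := exists_smul_slopeRep hAe
  have ho' : slopeOf (g.linear e) = slopeEquiv g.linear o := rfl
  rw [ho'] at hde
  set o' := slopeEquiv g.linear o
  set e' := slopeRep o' with he'
  have hdn : d ^ n ≠ 0 := pow_ne_zero n hd
  have h1 : v'.topField (g.linear e) = (c * m) • g.linear e := by
    rw [topField_affine g c h, hm, map_smul, smul_smul]
  -- `g.linear` sends `e` to `d • e'`. Homogeneity of degree `n` divides the eigenvalue by `d ^ n`,
  -- and the vector on the right contributes a factor `d`.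
  set k := c * d / d ^ n with hk
  have hk0 : k ≠ 0 := div_ne_zero (mul_ne_zero hc hd) hdn
  have h2 : v'.topField e' = (k * m) • e' := by
    rw [hde, topField_smul, smul_smul] at h1
    have : (d ^ n) • v'.topField e' = (d ^ n) • ((k * m) • e') := by
      rw [h1, smul_smul, hk]
      congr 1
      field_simp
    exact smul_right_injective _ hdn this
  have h3 : LinearMap.trace ℂ (ℂ × ℂ) (fderiv ℂ v'.topField e' : (ℂ × ℂ) →ₗ[ℂ] (ℂ × ℂ)) =
      k * LinearMap.trace ℂ (ℂ × ℂ) (fderiv ℂ v.topField e : (ℂ × ℂ) →ₗ[ℂ] (ℂ × ℂ)) := by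
    have h4 := fderiv_topField_affine g c h e
    rw [hde] at h4
    have h5 := congrArg (fun L : (ℂ × ℂ) →L[ℂ] (ℂ × ℂ) =>
      LinearMap.trace ℂ (ℂ × ℂ) (L : (ℂ × ℂ) →ₗ[ℂ] (ℂ × ℂ))) (v'.smul_fderiv_topField_smul d e')
    simp only [ContinuousLinearMap.toLinearMap_smul, map_smul, smul_eq_mul] at h5
    rw [h4] at h5
    rw [hk, div_mul_eq_mul_div, eq_div_iff hdn, mul_comm _ (d ^ n), ← h5]
    ring
  obtain ⟨t1, d1⟩ := v.trace_det_linInf o hm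
  obtain ⟨t2, d2⟩ := v'.trace_det_linInf o' h2
  refine ⟨(v'.mem_singInf_iff o').2 ⟨_, h2⟩, k, hk0, ?_, ?_⟩
  · rw [t2, t1, h3]
    ring
  · rw [d2, d1, h3]
    ring

theorem AffEquiv.symm {v v' : PlaneVF n} (h : AffEquiv v v') : AffEquiv v' v :=
  (affSetoid n).symm h

theorem bbTuples_subset_of_affEquiv {v v' : PlaneVF n} (h : AffEquiv v v') :
    v.bbTuples ⊆ v'.bbTuples := by
  obtain ⟨g, c, h⟩ := h
  have h' : ∀ q, v.field (g.symm q) = (c⁻¹ : ℂ) • g.symm.linear (v'.field q) := by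
    intro q
    have := h (g.symm q)
    rw [AffineEquiv.apply_symm_apply] at this
    rw [this]
    simp
  have hc : (c : ℂ) ≠ 0 := c.ne_zero
  set φ := slopeEquiv g.linear with hφ
  have hφ' : ∀ o ∈ v'.singInf, φ.symm o ∈ v.singInf := fun o ho =>
    (linInf_affine g.symm (inv_ne_zero hc) h' ho).1
  have hI : φ '' v.singInf = v'.singInf := by
    ext o
    constructor
    · rintro ⟨o, ho, rfl⟩
      exact (linInf_affine g hc h ho).1
    · intro ho
      exact ⟨φ.symm o, hφ' o ho, φ.apply_symm_apply o⟩
  have hF : g '' v.singFin = v'.singFin := by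
    ext q
    constructor
    · rintro ⟨q, hq, rfl⟩
      have hq : v.field q = 0 := hq
      show v'.field (g q) = 0
      rw [h, hq]
      simp
    · intro hq
      have hq : v'.field q = 0 := hq
      refine ⟨g.symm q, ?_, g.apply_symm_apply q⟩
      show v.field (g.symm q) = 0
      rw [h', hq]
      simp
  have hdF : ∀ q, LinearMap.det (v'.linFin (g q)) = (c : ℂ) ^ 2 * LinearMap.det (v.linFin q) := by
    intro q
    rw [linFin_affine g c h, LinearMap.det_smul]
    have : LinearMap.det (g.linear.conj (v.linFin q)) = LinearMap.det (v.linFin q) :=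
      LinearMap.det_conj _ _
    rw [this]
    simp
  have htF : ∀ q, LinearMap.trace ℂ (ℂ × ℂ) (v'.linFin (g q)) =
      (c : ℂ) * LinearMap.trace ℂ (ℂ × ℂ) (v.linFin q) := by
    intro q
    rw [linFin_affine g c h, map_smul, LinearMap.trace_conj', smul_eq_mul]
  rintro t ⟨⟨n1, n2, n3, n4⟩, O, Q, ⟨hO, hOr, hQ, hQr⟩, rfl⟩
  refine ⟨⟨?_, ?_, ?_, ?_⟩, fun i => φ (O i), fun j => g (Q j), ⟨?_, ?_, ?_, ?_⟩, ?_⟩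
  · rw [← hI, φ.injective.encard_image, n1]
  · rw [← hF, g.injective.encard_image, n2]
  · rw [← hI]
    rintro _ ⟨o, ho, rfl⟩
    obtain ⟨-, k, hk, -, hd⟩ := linInf_affine g hc h ho
    rw [hφ, hd]
    exact mul_ne_zero (pow_ne_zero 2 hk) (n3 o ho)
  · rw [← hF]
    rintro _ ⟨q, hq, rfl⟩
    rw [hdF]
    exact mul_ne_zero (pow_ne_zero 2 hc) (n4 q hq)
  · exact φ.injective.comp hO
  · rw [← hI, ← hOr, ← Set.range_comp]
    rfl
  · exact g.injective.comp hQ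
  · rw [← hF, ← hQr, ← Set.range_comp]
    rfl
  · funext s
    rcases s with i | j
    · have ho : O i ∈ v.singInf := hOr ▸ Set.mem_range_self i
      obtain ⟨-, k, hk, ht, hd⟩ := linInf_affine g hc h ho
      exact (bbIndex_of_scaled hk ht hd).symm
    · exact (bbIndex_of_scaled hc (htF (Q j)) (hdF (Q j))).symm

theorem bbTuples_eq_of_affEquiv {v v' : PlaneVF n} (h : AffEquiv v v') :
    v.bbTuples = v'.bbTuples :=
  (bbTuples_subset_of_affEquiv h).antisymm (bbTuples_subset_of_affEquiv h.symm)

theorem moduliMap_mk (v : PlaneVF n) :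
    moduliMap (Quotient.mk (affSetoid n) v) = v.bbTuples := by
  ext t
  constructor
  · rintro ⟨v', hv', ht⟩
    rwa [bbTuples_eq_of_affEquiv (Quotient.exact hv')] at ht
  · intro ht
    exact ⟨v, rfl, ht⟩

end PlaneVF

/-! ### Polynomials in two variables of bounded degree -/

/-- The exponent vector of a monomial. -/
noncomputable def planeExpFinsupp {m : ℕ} (d : PlaneExp m) : Fin 2 →₀ ℕ :=
  Finsupp.equivFunOnFinite.symm ![(d.1.1 : ℕ), (d.1.2 : ℕ)]

theorem planeExpFinsupp_zero {m : ℕ} (d : PlaneExp m) : planeExpFinsupp d 0 = (d.1.1 : ℕ) := rfl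

theorem planeExpFinsupp_one {m : ℕ} (d : PlaneExp m) : planeExpFinsupp d 1 = (d.1.2 : ℕ) := rfl

theorem planeExpFinsupp_injective {m : ℕ} :
    Function.Injective (planeExpFinsupp : PlaneExp m → Fin 2 →₀ ℕ) := by
  intro d d' h
  have h0 := DFunLike.congr_fun h 0
  have h1 := DFunLike.congr_fun h 1
  rw [planeExpFinsupp_zero, planeExpFinsupp_zero] at h0
  rw [planeExpFinsupp_one, planeExpFinsupp_one] at h1
  exact Subtype.ext (Prod.ext (Fin.ext h0) (Fin.ext h1))

theorem degree_planeExpFinsupp {m : ℕ} (d : PlaneExp m) :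
    (planeExpFinsupp d).degree = (d.1.1 : ℕ) + (d.1.2 : ℕ) := by
  rw [Finsupp.degree_eq_sum, Fin.sum_univ_two, planeExpFinsupp_zero, planeExpFinsupp_one]

/-- The polynomial with given coefficients. -/
noncomputable def planePoly (m : ℕ) : (PlaneExp m → ℂ) →ₗ[ℂ] MvPolynomial (Fin 2) ℂ where
  toFun a := ∑ d, MvPolynomial.monomial (planeExpFinsupp d) (a d)
  map_add' a b := by simp [Finset.sum_add_distrib]
  map_smul' c a := by simp [Finset.smul_sum, MvPolynomial.smul_monomial]

theorem planePoly_apply {m : ℕ} (a : PlaneExp m → ℂ) :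
    planePoly m a = ∑ d, MvPolynomial.monomial (planeExpFinsupp d) (a d) := rfl

theorem coeff_planePoly {m : ℕ} (a : PlaneExp m → ℂ) (d : PlaneExp m) :
    (planePoly m a).coeff (planeExpFinsupp d) = a d := by
  rw [planePoly_apply, MvPolynomial.coeff_sum, Finset.sum_eq_single d]
  · simp
  · intro b _ hb
    rw [MvPolynomial.coeff_monomial, if_neg]
    exact fun h => hb (planeExpFinsupp_injective h)
  · simp

theorem planePoly_injective (m : ℕ) : Function.Injective (planePoly m) := by
  intro a b h
  funext d
  rw [← coeff_planePoly a, h, coeff_planePoly]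

theorem totalDegree_planePoly_le {m : ℕ} (a : PlaneExp m → ℂ) :
    (planePoly m a).totalDegree ≤ m := by
  rw [planePoly_apply]
  refine MvPolynomial.totalDegree_finsetSum_le fun d _ => ?_
  refine (MvPolynomial.totalDegree_monomial_le _ _).trans ?_
  have := d.2
  have h := degree_planeExpFinsupp d
  rw [Finsupp.degree_eq_sum] at h
  rw [Finsupp.sum_fintype _ _ (fun _ => rfl)]
  simp only [id]
  omega

/-- The coefficients of degree at most `m` of a polynomial. -/
noncomputable def planeCoeffs (m : ℕ) : MvPolynomial (Fin 2) ℂ →ₗ[ℂ] (PlaneExp m → ℂ) where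
  toFun p d := p.coeff (planeExpFinsupp d)
  map_add' p q := by
    funext d
    simp
  map_smul' c p := by
    funext d
    simp

theorem planeCoeffs_planePoly {m : ℕ} (a : PlaneExp m → ℂ) : planeCoeffs m (planePoly m a) = a :=
  funext fun d => coeff_planePoly a d

theorem planePoly_planeCoeffs {m : ℕ} {p : MvPolynomial (Fin 2) ℂ} (hp : p.totalDegree ≤ m) :
    planePoly m (planeCoeffs m p) = p := by
  ext s
  by_cases hs : s 0 + s 1 ≤ m
  · let d : PlaneExp m := ⟨(⟨s 0, by omega⟩, ⟨s 1, by omega⟩), hs⟩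
    have hd : planeExpFinsupp d = s := by
      ext i
      fin_cases i
      · rfl
      · rfl
    rw [← hd, coeff_planePoly]
    rfl
  · have h1 : p.coeff s = 0 := by
      refine MvPolynomial.coeff_eq_zero_of_totalDegree_lt ?_
      refine lt_of_le_of_lt hp ?_
      have : s.degree = s 0 + s 1 := by rw [Finsupp.degree_eq_sum, Fin.sum_univ_two]
      rw [Finsupp.degree_apply] at this
      omega
    rw [h1, planePoly_apply, MvPolynomial.coeff_sum]
    refine Finset.sum_eq_zero fun d _ => ?_
    rw [MvPolynomial.coeff_monomial, if_neg]
    rintro rfl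
    exact hs d.2

theorem eval_planePoly {m : ℕ} (a : PlaneExp m → ℂ) (q : ℂ × ℂ) :
    MvPolynomial.eval ![q.1, q.2] (planePoly m a) =
      ∑ d : PlaneExp m, a d * q.1 ^ (d.1.1 : ℕ) * q.2 ^ (d.1.2 : ℕ) := by
  rw [planePoly_apply, map_sum]
  refine Finset.sum_congr rfl fun d _ => ?_
  rw [MvPolynomial.eval_monomial, Finsupp.prod_fintype _ _ (fun _ => pow_zero _), Fin.prod_univ_two,
    planeExpFinsupp_zero, planeExpFinsupp_one, mul_assoc]
  rfl

theorem planePoly_funext {p q : MvPolynomial (Fin 2) ℂ}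
    (h : ∀ z : ℂ × ℂ, MvPolynomial.eval ![z.1, z.2] p = MvPolynomial.eval ![z.1, z.2] q) :
    p = q := by
  refine MvPolynomial.funext fun x => ?_
  have : x = ![x 0, x 1] := by
    funext i
    fin_cases i <;> rfl
  rw [this]
  exact h (x 0, x 1)

/-- `f` is given by a polynomial of degree at most `m`. -/
def IsPlanePoly (m : ℕ) (f : ℂ × ℂ → ℂ) : Prop :=
  ∃ p : MvPolynomial (Fin 2) ℂ, p.totalDegree ≤ m ∧ ∀ q, f q = MvPolynomial.eval ![q.1, q.2] p

namespace IsPlanePoly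

variable {m k : ℕ} {f g : ℂ × ℂ → ℂ}

theorem add (hf : IsPlanePoly m f) (hg : IsPlanePoly m g) : IsPlanePoly m (fun q => f q + g q) := by
  obtain ⟨p, hp, hfp⟩ := hf
  obtain ⟨r, hr, hgr⟩ := hg
  exact ⟨p + r, (MvPolynomial.totalDegree_add p r).trans (max_le hp hr), fun q => by
    simp only [hfp, hgr, map_add]⟩

theorem mul (hf : IsPlanePoly m f) (hg : IsPlanePoly k g) :
    IsPlanePoly (m + k) (fun q => f q * g q) := by
  obtain ⟨p, hp, hfp⟩ := hf
  obtain ⟨r, hr, hgr⟩ := hg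
  exact ⟨p * r, (MvPolynomial.totalDegree_mul p r).trans (add_le_add hp hr), fun q => by
    simp only [hfp, hgr, map_mul]⟩

theorem mono (hmk : m ≤ k) (hf : IsPlanePoly m f) : IsPlanePoly k f := by
  obtain ⟨p, hp, hfp⟩ := hf
  exact ⟨p, hp.trans hmk, hfp⟩

theorem const (c : ℂ) : IsPlanePoly m (fun _ => c) :=
  ⟨MvPolynomial.C c, by simp, fun q => by simp⟩

theorem fst : IsPlanePoly 1 (fun q => q.1) :=
  ⟨MvPolynomial.X 0, by simp, fun q => by simp⟩

theorem snd : IsPlanePoly 1 (fun q => q.2) :=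
  ⟨MvPolynomial.X 1, by simp, fun q => by simp⟩

theorem const_mul (c : ℂ) (hf : IsPlanePoly m f) : IsPlanePoly m (fun q => c * f q) := by
  have := (const (m := 0) c).mul hf
  rwa [zero_add] at this

theorem pow (hf : IsPlanePoly 1 f) (i : ℕ) : IsPlanePoly i (fun q => f q ^ i) := by
  induction i with
  | zero => simpa using const (m := 0) 1
  | succ i ih =>
    simp only [pow_succ]
    exact ih.mul hf

theorem sum {ι : Type*} (s : Finset ι) {F : ι → ℂ × ℂ → ℂ} (h : ∀ i ∈ s, IsPlanePoly m (F i)) :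
    IsPlanePoly m (fun q => ∑ i ∈ s, F i q) := by
  classical
  induction s using Finset.induction_on with
  | empty => simpa using const 0
  | insert i s hi ih =>
    simp only [Finset.sum_insert hi]
    exact (h i (Finset.mem_insert_self i s)).add
      (ih fun j hj => h j (Finset.mem_insert_of_mem hj))

theorem linear (L : (ℂ × ℂ) →ₗ[ℂ] ℂ) : IsPlanePoly 1 (fun q => L q) := by
  have h : (fun q => L q) = fun q : ℂ × ℂ => L (1, 0) * q.1 + L (0, 1) * q.2 := by
    funext q
    have : q = q.1 • ((1, 0) : ℂ × ℂ) + q.2 • ((0, 1) : ℂ × ℂ) := by ext <;> simp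
    conv_lhs => rw [this, map_add, map_smul, map_smul, smul_eq_mul, smul_eq_mul]
    ring
  rw [h]
  exact (fst.const_mul _).add (snd.const_mul _)

theorem affine (g : (ℂ × ℂ) →ᵃ[ℂ] (ℂ × ℂ)) :
    IsPlanePoly 1 (fun q => (g q).1) ∧ IsPlanePoly 1 (fun q => (g q).2) := by
  have hg : ∀ q, g q = g.linear q + g 0 := by
    intro q
    have := g.map_vadd 0 q
    simpa using this
  constructor
  · have : (fun q => (g q).1) = fun q => (LinearMap.fst ℂ ℂ ℂ ∘ₗ g.linear) q + (g 0).1 := by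
      funext q
      rw [hg]
      rfl
    rw [this]
    exact (linear _).add (const _)
  · have : (fun q => (g q).2) = fun q => (LinearMap.snd ℂ ℂ ℂ ∘ₗ g.linear) q + (g 0).2 := by
      funext q
      rw [hg]
      rfl
    rw [this]
    exact (linear _).add (const _)

end IsPlanePoly

/-! ### Vector fields as pairs of polynomials; polynomiality of affine operations on them. -/

namespace PlaneVF

variable {n : ℕ}

/-- The components of a vector field as polynomials. -/
noncomputable def poly (v : PlaneVF n) (i : Fin 2) : MvPolynomial (Fin 2) ℂ :=
  planePoly n fun d => v (i, d)

theorem eval_poly_zero (v : PlaneVF n) (q : ℂ × ℂ) :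
    MvPolynomial.eval ![q.1, q.2] (v.poly 0) = (v.field q).1 := eval_planePoly _ q

theorem eval_poly_one (v : PlaneVF n) (q : ℂ × ℂ) :
    MvPolynomial.eval ![q.1, q.2] (v.poly 1) = (v.field q).2 := eval_planePoly _ q

theorem field_injective {v v' : PlaneVF n} (h : ∀ q, v.field q = v'.field q) : v = v' := by
  have h0 : v.poly 0 = v'.poly 0 := planePoly_funext fun q => by
    rw [eval_poly_zero, eval_poly_zero, h]
  have h1 : v.poly 1 = v'.poly 1 := planePoly_funext fun q => by
    rw [eval_poly_one, eval_poly_one, h]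
  funext ⟨i, d⟩
  fin_cases i
  · exact congrFun (planePoly_injective n h0) d
  · exact congrFun (planePoly_injective n h1) d

theorem exists_field_eq {f g : ℂ × ℂ → ℂ} (hf : IsPlanePoly n f) (hg : IsPlanePoly n g) :
    ∃ v : PlaneVF n, ∀ q, v.field q = (f q, g q) := by
  obtain ⟨p, hp, hfp⟩ := hf
  obtain ⟨r, hr, hgr⟩ := hg
  refine ⟨fun c => if c.1 = 0 then planeCoeffs n p c.2 else planeCoeffs n r c.2, fun q => ?_⟩
  rw [hfp, hgr, ← planePoly_planeCoeffs hp, ← planePoly_planeCoeffs hr, eval_planePoly,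
    eval_planePoly]
  simp [field, planeCoeffs_planePoly]

theorem isPlanePoly_field (v : PlaneVF n) :
    IsPlanePoly n (fun q => (v.field q).1) ∧ IsPlanePoly n (fun q => (v.field q).2) :=
  ⟨⟨v.poly 0, totalDegree_planePoly_le _, fun q => (v.eval_poly_zero q).symm⟩,
    ⟨v.poly 1, totalDegree_planePoly_le _, fun q => (v.eval_poly_one q).symm⟩⟩

theorem isPlanePoly_field_affine (v : PlaneVF n) (g : (ℂ × ℂ) →ᵃ[ℂ] (ℂ × ℂ)) :
    IsPlanePoly n (fun q => (v.field (g q)).1) ∧ IsPlanePoly n (fun q => (v.field (g q)).2) := by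
  obtain ⟨h1, h2⟩ := IsPlanePoly.affine g
  have key : ∀ i : Fin 2, IsPlanePoly n (fun q => ∑ d : PlaneExp n,
      v (i, d) * (g q).1 ^ (d.1.1 : ℕ) * (g q).2 ^ (d.1.2 : ℕ)) := by
    intro i
    refine IsPlanePoly.sum _ fun d _ => ?_
    exact (((h1.pow _).const_mul _).mul (h2.pow _)).mono d.2
  exact ⟨key 0, key 1⟩

/-- The velocity field of the push-forward of `v` along an affine vector field is polynomial of
the same degree. -/
theorem exists_orbitTangent_field (v : PlaneVF n) (X : (ℂ × ℂ) →ᵃ[ℂ] (ℂ × ℂ)) (c : ℂ) :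
    ∃ w : PlaneVF n, ∀ q,
      w.field q = X.linear (v.field q) - fderiv ℂ v.field q (X q) + c • v.field q := by
  obtain ⟨h1, h2⟩ := IsPlanePoly.affine X
  let D : Fin 2 → ℂ × ℂ → ℂ := fun i q => ∑ d : PlaneExp n,
    (v (i, d) * ((d.1.1 : ℕ) * q.1 ^ ((d.1.1 : ℕ) - 1) * (X q).1) * q.2 ^ (d.1.2 : ℕ) +
      v (i, d) * q.1 ^ (d.1.1 : ℕ) * ((d.1.2 : ℕ) * q.2 ^ ((d.1.2 : ℕ) - 1) * (X q).2))
  have hD : ∀ q, fderiv ℂ v.field q (X q) = (D 0 q, D 1 q) := by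
    intro q
    have hl : HasDerivAt (fun t : ℂ => q + t • X q) (X q) 0 := by
      simpa using ((hasDerivAt_id (0 : ℂ)).smul_const (X q)).const_add q
    have hf : HasFDerivAt v.field (fderiv ℂ v.field q) ((fun t : ℂ => q + t • X q) 0) := by
      simpa using (v.differentiable_field q).hasFDerivAt
    have h3 := hf.comp_hasDerivAt 0 hl
    refine h3.unique ?_
    have hx : HasDerivAt (fun t : ℂ => q.1 + t * (X q).1) (X q).1 0 := by
      simpa using ((hasDerivAt_id (0 : ℂ)).mul_const (X q).1).const_add q.1
    have hy : HasDerivAt (fun t : ℂ => q.2 + t * (X q).2) (X q).2 0 := by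
      simpa using ((hasDerivAt_id (0 : ℂ)).mul_const (X q).2).const_add q.2
    have key : ∀ i : Fin 2, HasDerivAt (fun t : ℂ => ∑ d : PlaneExp n,
        v (i, d) * (q.1 + t * (X q).1) ^ (d.1.1 : ℕ) * (q.2 + t * (X q).2) ^ (d.1.2 : ℕ))
        (D i q) 0 := by
      intro i
      refine HasDerivAt.fun_sum fun d _ => ?_
      refine (((hx.fun_pow _).const_mul _).mul (hy.fun_pow _)).congr_deriv ?_
      simp
    exact (key 0).prodMk (key 1)
  have hP : ∀ i, IsPlanePoly n (D i) := by
    intro i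
    refine IsPlanePoly.sum _ fun d _ => ?_
    have hd := d.2
    refine IsPlanePoly.add ?_ ?_
    -- For exponent `0` the truncated exponent `0 - 1` is `0` and the degree count would fail, but
    -- the coefficient `0` kills the term. Otherwise differentiation lowers the degree by one and
    -- the affine factor restores it.
    · rcases Nat.eq_zero_or_pos (d.1.1 : ℕ) with h | h
      · simpa [h] using IsPlanePoly.const 0
      · refine ((((((IsPlanePoly.fst.pow _).const_mul _).mul h1).const_mul _)).mul
          (IsPlanePoly.snd.pow _)).mono ?_
        omega
    · rcases Nat.eq_zero_or_pos (d.1.2 : ℕ) with h | h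
      · simpa [h] using IsPlanePoly.const 0
      · refine (((IsPlanePoly.fst.pow _).const_mul _).mul
          (((IsPlanePoly.snd.pow _).const_mul _).mul h2)).mono ?_
        omega
  obtain ⟨hv1, hv2⟩ := v.isPlanePoly_field
  have hL : ∀ L : (ℂ × ℂ) →ₗ[ℂ] ℂ, IsPlanePoly n (fun q => L (v.field q)) := by
    intro L
    have h : (fun q => L (v.field q)) = fun q : ℂ × ℂ =>
        L (1, 0) * (v.field q).1 + L (0, 1) * (v.field q).2 := by
      funext q
      have : v.field q = (v.field q).1 • ((1, 0) : ℂ × ℂ) + (v.field q).2 • ((0, 1) : ℂ × ℂ) := by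
        ext <;> simp
      conv_lhs => rw [this, map_add, map_smul, map_smul, smul_eq_mul, smul_eq_mul]
      ring
    rw [h]
    exact (hv1.const_mul _).add (hv2.const_mul _)
  obtain ⟨w, hw⟩ := exists_field_eq
    (((hL (LinearMap.fst ℂ ℂ ℂ ∘ₗ X.linear)).add ((hP 0).const_mul (-1))).add (hv1.const_mul c))
    (((hL (LinearMap.snd ℂ ℂ ℂ ∘ₗ X.linear)).add ((hP 1).const_mul (-1))).add (hv2.const_mul c))
  refine ⟨w, fun q => ?_⟩
  rw [hw, hD]
  ext <;> simp [sub_eq_add_neg]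

/-- Push-forward of vector fields under an affine automorphism. -/
theorem exists_pushforward (g : (ℂ × ℂ) ≃ᵃ[ℂ] (ℂ × ℂ)) :
    ∃ G : PlaneVF n →ₗ[ℂ] PlaneVF n, ∀ v q, (G v).field (g q) = g.linear (v.field q) := by
  have h : ∀ v : PlaneVF n, ∃ w : PlaneVF n, ∀ q, w.field q = g.linear (v.field (g.symm q)) := by
    intro v
    obtain ⟨h1, h2⟩ := v.isPlanePoly_field_affine (g.symm : (ℂ × ℂ) →ᵃ[ℂ] (ℂ × ℂ))
    have hL : ∀ L : (ℂ × ℂ) →ₗ[ℂ] ℂ, IsPlanePoly n (fun q => L (v.field (g.symm q))) := by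
      intro L
      have h : (fun q => L (v.field (g.symm q))) = fun q : ℂ × ℂ =>
          L (1, 0) * (v.field (g.symm q)).1 + L (0, 1) * (v.field (g.symm q)).2 := by
        funext q
        generalize v.field (g.symm q) = z
        have : z = z.1 • ((1, 0) : ℂ × ℂ) + z.2 • ((0, 1) : ℂ × ℂ) := by
          ext <;> simp
        conv_lhs => rw [this, map_add, map_smul, map_smul, smul_eq_mul, smul_eq_mul]
        ring
      rw [h]
      exact (h1.const_mul _).add (h2.const_mul _)
    exact exists_field_eq
      (hL (LinearMap.fst ℂ ℂ ℂ ∘ₗ (g.linear : (ℂ × ℂ) →ₗ[ℂ] (ℂ × ℂ))))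
      (hL (LinearMap.snd ℂ ℂ ℂ ∘ₗ (g.linear : (ℂ × ℂ) →ₗ[ℂ] (ℂ × ℂ))))
  choose G hG using h
  refine ⟨⟨⟨G, fun v w => ?_⟩, fun c v => ?_⟩, fun v q => ?_⟩
  · refine field_injective fun q => ?_
    rw [hG, field_add, field_add, hG, hG, map_add]
  · refine field_injective fun q => ?_
    rw [hG, field_smul, RingHom.id_apply, field_smul, hG, map_smul]
  · show (G v).field (g q) = _
    rw [hG, AffineEquiv.symm_apply_apply]

/-- Evaluation functionals span the dual space, so a curve of vector fields is differentiable if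
its values at all points are. -/
theorem hasDerivAt_of_field {γ : ℂ → PlaneVF n} {w : PlaneVF n} {t : ℂ}
    (h : ∀ q, HasDerivAt (fun s => (γ s).field q) (w.field q) t) : HasDerivAt γ w t := by
  let ev : Fin 2 × (ℂ × ℂ) → Module.Dual ℂ (PlaneVF n) := fun p =>
    { toFun := fun v => if p.1 = 0 then (v.field p.2).1 else (v.field p.2).2
      map_add' := fun v w => by
        rw [field_add]
        split_ifs <;> simp
      map_smul' := fun c v => by
        rw [field_smul]
        split_ifs <;> simp }
  let W : Submodule ℂ (Module.Dual ℂ (PlaneVF n)) := Submodule.span ℂ (Set.range ev)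
  have hW : W = ⊤ := by
    have h1 : W.dualCoannihilator = ⊥ := by
      rw [Submodule.eq_bot_iff]
      intro v hv
      rw [Submodule.mem_dualCoannihilator] at hv
      refine field_injective fun q => ?_
      have h0 := hv (ev (0, q)) (Submodule.subset_span ⟨_, rfl⟩)
      have h1 := hv (ev (1, q)) (Submodule.subset_span ⟨_, rfl⟩)
      have hz : (0 : PlaneVF n).field q = 0 := by ext <;> simp [field]
      rw [hz]
      ext
      · simpa [ev] using h0
      · simpa [ev] using h1
    -- In finite dimension a space of functionals without common zeros is the whole dual.
    have h2 := Subspace.dualCoannihilator_dualAnnihilator_eq (W := W)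
    rw [← h2, h1, Submodule.dualAnnihilator_bot]
  have key : ∀ φ ∈ W, HasDerivAt (fun s => φ (γ s)) (φ w) t := by
    intro φ hφ
    induction hφ using Submodule.span_induction with
    | mem φ hφ =>
      obtain ⟨⟨i, q⟩, rfl⟩ := hφ
      have h1 := (h q)
      by_cases hi : i = 0
      · have h2 := (hasFDerivAt_fst (𝕜 := ℂ) (p := (γ t).field q)).comp_hasDerivAt t h1
        simp only [ev, hi, LinearMap.coe_mk, AddHom.coe_mk, if_true]
        exact h2
      · have h2 := (hasFDerivAt_snd (𝕜 := ℂ) (p := (γ t).field q)).comp_hasDerivAt t h1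
        simp only [ev, hi, LinearMap.coe_mk, AddHom.coe_mk, if_false]
        exact h2
    | zero => simpa using hasDerivAt_const t (0 : ℂ)
    | add φ ψ _ _ h1 h2 => exact h1.add h2
    | smul c φ _ h1 => exact h1.const_mul c
  rw [hasDerivAt_pi]
  intro c
  exact key (LinearMap.proj c) (hW ▸ Submodule.mem_top)

/-! ### Polynomials in the coefficients -/

theorem exists_eval_comp_linear (G : PlaneVF n →ₗ[ℂ] PlaneVF n)
    (p : MvPolynomial (VFCoord n) ℂ) :
    ∃ p' : MvPolynomial (VFCoord n) ℂ, ∀ v, MvPolynomial.eval v p' = MvPolynomial.eval (G v) p := by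
  refine ⟨MvPolynomial.bind₁ (fun c => ∑ c', MvPolynomial.C (G (Pi.single c' 1) c) *
    MvPolynomial.X c') p, fun v => ?_⟩
  rw [MvPolynomial.eval, MvPolynomial.eval₂Hom_bind₁]
  have : (fun i => (MvPolynomial.eval₂Hom (RingHom.id ℂ) v)
      (∑ c', MvPolynomial.C (G (Pi.single c' 1) i) * MvPolynomial.X c')) = G v := by
    funext i
    have hv : v = ∑ c', v c' • (Pi.single c' 1 : PlaneVF n) := by
      funext c
      simp [Finset.sum_apply, Pi.single_apply]
    conv_rhs => rw [hv, map_sum]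
    simp [mul_comm]
  rw [this]
  rfl

/-- In the sup norm a ball is a product of discs, and each disc is an infinite set of scalars. -/
theorem eq_zero_of_eventually_eval_eq_zero {v₀ : PlaneVF n} {p : MvPolynomial (VFCoord n) ℂ}
    (h : ∀ᶠ v in 𝓝 v₀, MvPolynomial.eval v p = 0) : p = 0 := by
  obtain ⟨r, hr, hb⟩ := Metric.eventually_nhds_iff_ball.1 h
  refine MvPolynomial.funext_set (fun c => Metric.ball (v₀ c) r)
    (fun c => infinite_of_mem_nhds (v₀ c) (Metric.ball_mem_nhds _ hr)) fun v hv => ?_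
  rw [map_zero]
  refine hb v ?_
  rw [ball_pi _ hr]
  exact hv

theorem ForGeneric.and {p q : PlaneVF n → Prop} (hp : ForGeneric p) (hq : ForGeneric q) :
    ForGeneric fun v => p v ∧ q v := by
  obtain ⟨D, hD, h⟩ := hp
  obtain ⟨E, hE, h'⟩ := hq
  refine ⟨D * E, mul_ne_zero hD hE, fun v hv => ?_⟩
  rw [map_mul] at hv
  exact ⟨h v (left_ne_zero_of_mul hv), h' v (right_ne_zero_of_mul hv)⟩

theorem ForGeneric.mono {p q : PlaneVF n → Prop} (hp : ForGeneric p) (h : ∀ v, p v → q v) :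
    ForGeneric q := by
  obtain ⟨D, hD, hv⟩ := hp
  exact ⟨D, hD, fun v h' => h v (hv v h')⟩

end PlaneVF

/-! ### Elimination in the plane: syzygies, Bezout and Noether by a dimension count. -/

theorem linearMap_pi_apply {ι : Type*} [Fintype ι] [DecidableEq ι] (l : (ι → ℂ) →ₗ[ℂ] ℂ)
    (x : ι → ℂ) : l x = ∑ j, l (Pi.single j 1) * x j := by
  conv_lhs => rw [← Finset.univ_sum_single x, map_sum]
  refine Finset.sum_congr rfl fun j _ => ?_
  rw [mul_comm, ← smul_eq_mul, ← map_smul, ← Pi.single_smul, smul_eq_mul, mul_one]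

theorem card_planeExp (m : ℕ) : 2 * Fintype.card (PlaneExp m) = (m + 1) * (m + 2) := by
  let e : PlaneExp m ≃ (Σ i : Fin (m + 1), Fin (m + 1 - i)) :=
    { toFun := fun d => ⟨d.1.1, ⟨d.1.2, by have := d.2; omega⟩⟩
      invFun := fun s => ⟨(s.1, ⟨s.2, by omega⟩), by
        have := s.2.2
        simp only
        omega⟩
      left_inv := fun d => rfl
      right_inv := fun s => rfl }
  rw [Fintype.card_congr e, Fintype.card_sigma]
  simp only [Fintype.card_fin]
  rw [Fin.sum_univ_eq_sum_range (fun i => m + 1 - i) (m + 1)]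
  have h : ∑ i ∈ Finset.range (m + 1), (m + 1 - i) = ∑ i ∈ Finset.range (m + 2), i := by
    rw [← Finset.sum_range_reflect (fun i => i) (m + 2), Finset.sum_range_succ _ (m + 1)]
    simp
  rw [h, mul_comm, Finset.sum_range_id_mul_two]
  simp [mul_comm]

theorem differentiable_eval_plane (p : MvPolynomial (Fin 2) ℂ) :
    Differentiable ℂ (fun z : ℂ × ℂ => MvPolynomial.eval ![z.1, z.2] p) := by
  induction p using MvPolynomial.induction_on with
  | C a => simp
  | add p q hp hq =>
    simp only [map_add]
    exact hp.add hq
  | mul_X p i hp =>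
    simp only [map_mul, MvPolynomial.eval_X]
    refine hp.mul ?_
    fin_cases i
    · exact differentiable_fst
    · exact differentiable_snd

/-- A weak Nullstellensatz for one polynomial. -/
theorem exists_eval_plane_eq_zero {d : MvPolynomial (Fin 2) ℂ} (hd : ¬ IsUnit d) :
    ∃ z : ℂ × ℂ, MvPolynomial.eval ![z.1, z.2] d = 0 := by
  by_contra! h
  apply hd
  have h0 : MvPolynomial.zeroLocus ℂ (Ideal.span {d}) = ∅ := by
    rw [MvPolynomial.zeroLocus_span]
    ext x
    simp only [Set.mem_singleton_iff, forall_eq, Set.mem_ofPred_eq, Set.mem_empty_iff_false,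
      iff_false]
    have : x = ![x 0, x 1] := by
      funext i
      fin_cases i <;> rfl
    rw [this]
    exact h (x 0, x 1)
  have h1 := MvPolynomial.vanishingIdeal_zeroLocus_eq_radical (k := ℂ) (K := ℂ) (Ideal.span {d})
  rw [h0, MvPolynomial.vanishingIdeal_empty] at h1
  exact Ideal.span_singleton_eq_top.1 (Ideal.radical_eq_top.1 h1.symm)

namespace PlaneVF

variable {n : ℕ}

/-- If all zeros of a vector field are nondegenerate, its components have no common factor. -/
theorem isRelPrime_poly {v : PlaneVF n}
    (hJ : ∀ q, v.field q = 0 → LinearMap.det (v.linFin q) ≠ 0) :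
    IsRelPrime (v.poly 0) (v.poly 1) := by
  rintro d ⟨a, ha⟩ ⟨b, hb⟩
  by_contra hd
  obtain ⟨z, hz⟩ := exists_eval_plane_eq_zero hd
  have hf : v.field = fun q => MvPolynomial.eval ![q.1, q.2] d •
      (MvPolynomial.eval ![q.1, q.2] a, MvPolynomial.eval ![q.1, q.2] b) := by
    funext q
    ext
    · rw [← eval_poly_zero, ha, map_mul]
      rfl
    · rw [← eval_poly_one, hb, map_mul]
      rfl
  refine hJ z ?_ ?_
  · rw [hf]
    simp only [hz, zero_smul]
  -- At a zero of `d` the derivative of `d • (a, b)` is the map `u ↦ (∂ᵤ d) • (a, b)` of rank at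
  -- most one, so its determinant vanishes.
  · have h1 := (differentiable_eval_plane d z).hasFDerivAt.fun_smul
      ((differentiable_eval_plane a z).hasFDerivAt.prodMk
        (differentiable_eval_plane b z).hasFDerivAt)
    rw [← hf] at h1
    rw [prod_linearMap_det, linFin, h1.fderiv]
    simp [hz]
    ring

/-- The syzygies of the components of a vector field. -/
theorem exists_eq_mul_of_syzygy {v : PlaneVF n} (hn : 1 ≤ n)
    (hJ : ∀ q, v.field q = 0 → LinearMap.det (v.linFin q) ≠ 0)
    (hdeg : (v.poly 0).totalDegree = n ∨ (v.poly 1).totalDegree = n) {m : ℕ}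
    {A B : MvPolynomial (Fin 2) ℂ} (hA : A.totalDegree ≤ m + n) (hB : B.totalDegree ≤ m + n)
    (h : A * v.poly 0 + B * v.poly 1 = 0) :
    ∃ C : MvPolynomial (Fin 2) ℂ, C.totalDegree ≤ m ∧ A = C * v.poly 1 ∧ B = -(C * v.poly 0) := by
  have hrel := isRelPrime_poly hJ
  have hunit : ∀ p : MvPolynomial (Fin 2) ℂ, IsUnit p → p.totalDegree = 0 := by
    intro p hp
    exact MvPolynomial.isUnit_iff_totalDegree_of_isReduced.1 hp |>.2
  -- If one component were zero, relative primality would make the other a unit, hence a constant,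
  -- and no component would have degree `n ≥ 1`.
  have h0 : v.poly 0 ≠ 0 := by
    intro h0
    rw [h0] at hrel hdeg
    have := hunit _ (isRelPrime_zero_left.1 hrel)
    rcases hdeg with h | h
    · simp at h
      omega
    · omega
  have h1 : v.poly 1 ≠ 0 := by
    intro h1
    rw [h1] at hrel hdeg
    have := hunit _ (isRelPrime_zero_right.1 hrel)
    rcases hdeg with h | h
    · omega
    · simp at h
      omega
  have hdvd : v.poly 1 ∣ A := by
    refine IsRelPrime.dvd_of_dvd_mul_right hrel.symm (z := v.poly 0) ?_
    exact ⟨-B, by linear_combination h⟩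
  obtain ⟨C, hC⟩ := hdvd
  have hBC : B = -(C * v.poly 0) := by
    refine mul_right_cancel₀ h1 ?_
    rw [hC] at h
    linear_combination h
  refine ⟨C, ?_, by rw [hC, mul_comm], hBC⟩
  -- Degrees add in a domain, so the component of exact degree `n` turns the bound `m + n` on `A` or
  -- `B` into the bound `m` on `C`.
  rcases eq_or_ne C 0 with hC0 | hC0
  · simp [hC0]
  rcases hdeg with hd | hd
  · have := MvPolynomial.totalDegree_mul_of_isDomain hC0 h0
    rw [hBC, MvPolynomial.totalDegree_neg] at hB
    omega
  · have := MvPolynomial.totalDegree_mul_of_isDomain h1 hC0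
    rw [hC] at hA
    omega

/-- The map `(A, B, w) ↦ A P + B Q + ∑ wᵢ x ^ i` for a vector field `(P, Q)`, where `A`, `B`
have bounded degree. -/
noncomputable def bezoutMap (N : ℕ) (v : PlaneVF n) :
    (((PlaneExp (N + n) → ℂ) × (PlaneExp (N + n) → ℂ)) × (Fin N → ℂ)) →ₗ[ℂ]
      MvPolynomial (Fin 2) ℂ where
  toFun u := planePoly (N + n) u.1.1 * v.poly 0 + planePoly (N + n) u.1.2 * v.poly 1 +
    ∑ i : Fin N, MvPolynomial.C (u.2 i) * MvPolynomial.X 0 ^ (i : ℕ)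
  map_add' u w := by
    simp only [Prod.fst_add, Prod.snd_add, map_add, Pi.add_apply, add_mul, Finset.sum_add_distrib]
    ring
  map_smul' c u := by
    simp only [Prod.smul_fst, Prod.smul_snd, map_smul, Pi.smul_apply, smul_eq_mul, map_mul,
      RingHom.id_apply, smul_add, MvPolynomial.smul_eq_C_mul, Finset.mul_sum, mul_assoc]

theorem bezoutMap_apply (N : ℕ) (v : PlaneVF n)
    (u : ((PlaneExp (N + n) → ℂ) × (PlaneExp (N + n) → ℂ)) × (Fin N → ℂ)) :
    bezoutMap N v u = planePoly (N + n) u.1.1 * v.poly 0 + planePoly (N + n) u.1.2 * v.poly 1 +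
      ∑ i : Fin N, MvPolynomial.C (u.2 i) * MvPolynomial.X 0 ^ (i : ℕ) := rfl

theorem totalDegree_bezoutMap_le (N : ℕ) (v : PlaneVF n)
    (u : ((PlaneExp (N + n) → ℂ) × (PlaneExp (N + n) → ℂ)) × (Fin N → ℂ)) :
    (bezoutMap N v u).totalDegree ≤ N + n + n := by
  have hA : ∀ (a : PlaneExp (N + n) → ℂ) (i : Fin 2),
      (planePoly (N + n) a * v.poly i).totalDegree ≤ N + n + n := fun a i =>
    (MvPolynomial.totalDegree_mul _ _).trans
      (add_le_add (totalDegree_planePoly_le a) (totalDegree_planePoly_le _))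
  rw [bezoutMap_apply]
  refine (MvPolynomial.totalDegree_add _ _).trans (max_le
    ((MvPolynomial.totalDegree_add _ _).trans (max_le (hA _ 0) (hA _ 1))) ?_)
  refine MvPolynomial.totalDegree_finsetSum_le fun i _ => ?_
  refine (MvPolynomial.totalDegree_mul _ _).trans ?_
  rw [MvPolynomial.totalDegree_C, MvPolynomial.totalDegree_X_pow]
  omega

/-- Max Noether's theorem in the situation of a transversal intersection with distinct abscissae,
in the form: the map `bezoutMap` is onto the polynomials of bounded degree. -/
theorem bezoutMap_surjective {v : PlaneVF n} (hn : 1 ≤ n) {N : ℕ} (hN : N = n ^ 2) {q : Fin N → ℂ × ℂ}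
    (hq : ∀ k, v.field (q k) = 0) (hinj : Function.Injective fun k => (q k).1)
    (hJ : ∀ q, v.field q = 0 → LinearMap.det (v.linFin q) ≠ 0)
    (hdeg : (v.poly 0).totalDegree = n ∨ (v.poly 1).totalDegree = n) :
    Function.Surjective ((planeCoeffs (N + n + n)).comp (bezoutMap N v)) := by
  set Ψ := (planeCoeffs (N + n + n)).comp (bezoutMap N v) with hΨ
  -- The Koszul syzygies `C ↦ (C Q, -C P, 0)`.
  let κ : (PlaneExp N → ℂ) →ₗ[ℂ] (((PlaneExp (N + n) → ℂ) × (PlaneExp (N + n) → ℂ)) × (Fin N → ℂ)) :=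
    (((planeCoeffs (N + n)).comp ((LinearMap.mulRight ℂ (v.poly 1)).comp (planePoly N))).prod
      ((planeCoeffs (N + n)).comp ((LinearMap.mulRight ℂ (-v.poly 0)).comp (planePoly N)))).prod 0
  have hker : LinearMap.ker Ψ ≤ LinearMap.range κ := by
    intro u hu
    have h0 : bezoutMap N v u = 0 := by
      have h := LinearMap.mem_ker.1 hu
      rw [hΨ, LinearMap.comp_apply] at h
      rw [← planePoly_planeCoeffs (totalDegree_bezoutMap_le N v u), h, map_zero]
    -- At a zero of `v` the terms with `P` and `Q` drop out, so `w` vanishes at `N` distinct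
    -- abscissae while its degree is less than `N`.
    have hw : u.2 = 0 := by
      let w : Polynomial ℂ := ∑ i : Fin N, Polynomial.C (u.2 i) * Polynomial.X ^ (i : ℕ)
      have hwdeg : w.degree < (N : ℕ) := by
        refine lt_of_le_of_lt (Polynomial.degree_sum_le _ _) ?_
        rw [Finset.sup_lt_iff (WithBot.bot_lt_coe _)]
        intro i _
        refine lt_of_le_of_lt (Polynomial.degree_C_mul_X_pow_le _ _) ?_
        exact_mod_cast i.2
      have hwz : w = 0 := by
        refine Polynomial.eq_zero_of_degree_lt_of_eval_index_eq_zero Finset.univ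
          (v := fun k => (q k).1) hinj.injOn ?_ fun k _ => ?_
        · simpa using hwdeg
        · have := congrArg (MvPolynomial.eval ![(q k).1, (q k).2]) h0
          rw [bezoutMap_apply, map_add, map_add, map_mul, map_mul, eval_poly_zero, eval_poly_one,
            hq k] at this
          simpa [w, Polynomial.eval_finsetSum] using this
      funext i
      have hc := congrArg (fun p : Polynomial ℂ => p.coeff i) hwz
      simp only [w, Polynomial.finsetSum_coeff, Polynomial.coeff_C_mul, Polynomial.coeff_X_pow,
        Polynomial.coeff_zero] at hc
      rw [Finset.sum_eq_single i] at hc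
      · simpa using hc
      · intro j _ hj
        rw [if_neg (fun h => hj (Fin.ext h.symm)), mul_zero]
      · simp
    rw [bezoutMap_apply, hw] at h0
    simp only [Pi.zero_apply, map_zero, zero_mul, Finset.sum_const_zero, add_zero] at h0
    obtain ⟨C, hC, hA, hB⟩ := exists_eq_mul_of_syzygy hn hJ hdeg
      (totalDegree_planePoly_le u.1.1) (totalDegree_planePoly_le u.1.2) h0
    refine ⟨planeCoeffs N C, ?_⟩
    show ((planeCoeffs (N + n) (planePoly N (planeCoeffs N C) * v.poly 1),
        planeCoeffs (N + n) (planePoly N (planeCoeffs N C) * -v.poly 0)), 0) = u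
    rw [mul_neg, planePoly_planeCoeffs hC, ← hA, ← hB, planeCoeffs_planePoly, planeCoeffs_planePoly, ← hw]
  have h1 := LinearMap.finrank_range_add_finrank_ker Ψ
  have h2 : Module.finrank ℂ (LinearMap.ker Ψ) ≤ Fintype.card (PlaneExp N) := by
    refine (Submodule.finrank_mono hker).trans ?_
    refine (LinearMap.finrank_range_le κ).trans ?_
    simp
  have h3 := card_planeExp N
  have h4 := card_planeExp (N + n)
  have h5 := card_planeExp (N + n + n)
  simp only [Module.finrank_prod, Module.finrank_fintype_fun_eq_card, Fintype.card_fin] at h1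
  rw [← LinearMap.range_eq_top]
  refine Submodule.eq_top_of_finrank_eq (le_antisymm (Submodule.finrank_le _) ?_)
  rw [Module.finrank_fintype_fun_eq_card]
  -- With `δ m = (m + 1) (m + 2) / 2`, the second difference `δ (N + 2n) - 2 δ (N + n) + δ N` is `n
  -- ^ 2`. As `N = n ^ 2`, the source minus the largest possible kernel has exactly the dimension of
  -- the target.
  nlinarith

theorem exists_eval_eq_linear (l : PlaneVF n →ₗ[ℂ] ℂ) :
    ∃ p : MvPolynomial (VFCoord n) ℂ, ∀ v, MvPolynomial.eval v p = l v := by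
  refine ⟨∑ c, MvPolynomial.C (l (Pi.single c 1)) * MvPolynomial.X c, fun v => ?_⟩
  rw [linearMap_pi_apply l v]
  simp

/-- Near a field whose zeros are nondegenerate and have distinct abscissae, the ideal of the zeros
contains a polynomial of degree `n ^ 2` in `x` and a polynomial that expresses `y` through `x`; their
coefficients are rational functions of the coefficients of the field with denominator `b`. -/
theorem exists_eliminants {v₀ : PlaneVF n} (hn : 1 ≤ n) {N : ℕ} (hN : N = n ^ 2) {q : Fin N → ℂ × ℂ}
    (hq : ∀ k, v₀.field (q k) = 0) (hinj : Function.Injective fun k => (q k).1)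
    (hJ : ∀ q, v₀.field q = 0 → LinearMap.det (v₀.linFin q) ≠ 0)
    (hdeg : (v₀.poly 0).totalDegree = n ∨ (v₀.poly 1).totalDegree = n) :
    ∃ (b : MvPolynomial (VFCoord n) ℂ) (a c : Fin N → MvPolynomial (VFCoord n) ℂ),
      MvPolynomial.eval v₀ b ≠ 0 ∧ ∀ v : PlaneVF n, ∃ A B A' B' : MvPolynomial (Fin 2) ℂ,
        MvPolynomial.C (MvPolynomial.eval v b) * MvPolynomial.X 0 ^ N =
          A * v.poly 0 + B * v.poly 1 +
            ∑ i, MvPolynomial.C (MvPolynomial.eval v (a i)) * MvPolynomial.X 0 ^ (i : ℕ) ∧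
        MvPolynomial.C (MvPolynomial.eval v b) * MvPolynomial.X 1 =
          A' * v.poly 0 + B' * v.poly 1 +
            ∑ i, MvPolynomial.C (MvPolynomial.eval v (c i)) * MvPolynomial.X 0 ^ (i : ℕ) := by
  classical
  have hsurj := bezoutMap_surjective hn hN hq hinj hJ hdeg
  obtain ⟨ρ, hρ⟩ := LinearMap.exists_rightInverse_of_surjective _ (LinearMap.range_eq_top.2 hsurj)
  let β := PlaneExp (N + n + n)
  -- The right inverse `ρ` belongs to `v₀` and is kept fixed as `v` varies. Thus `T v` is a square
  -- matrix whose entries are polynomials in the coefficients of `v`, and `T v₀` is the identity;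
  -- its determinant is the common denominator.
  let T : PlaneVF n → (β → ℂ) →ₗ[ℂ] (β → ℂ) := fun v =>
    ((planeCoeffs (N + n + n)).comp (bezoutMap N v)).comp ρ
  have hT : ∀ i j, ∃ p : MvPolynomial (VFCoord n) ℂ, ∀ v,
      MvPolynomial.eval v p = LinearMap.toMatrix' (T v) i j := by
    intro i j
    set u := ρ (Pi.single j 1) with hu
    let l : PlaneVF n →ₗ[ℂ] ℂ :=
      { toFun := fun v => planeCoeffs (N + n + n)
          (planePoly (N + n) u.1.1 * v.poly 0 + planePoly (N + n) u.1.2 * v.poly 1) i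
        map_add' := fun v w => by
          have : ∀ s, (v + w).poly s = v.poly s + w.poly s := fun s =>
            map_add (planePoly n) (fun d => v (s, d)) (fun d => w (s, d))
          simp only [this, mul_add, map_add, Pi.add_apply]
          ring
        map_smul' := fun c v => by
          have : ∀ s, (c • v).poly s = c • v.poly s := fun s =>
            map_smul (planePoly n) c (fun d => v (s, d))
          simp only [this, mul_smul_comm, ← smul_add, map_smul, Pi.smul_apply, RingHom.id_apply] }
    obtain ⟨p, hp⟩ := exists_eval_eq_linear l
    refine ⟨p + MvPolynomial.C (planeCoeffs (N + n + n)
      (∑ i : Fin N, MvPolynomial.C (u.2 i) * MvPolynomial.X 0 ^ (i : ℕ)) i), fun v => ?_⟩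
    have h1 : ∀ v, LinearMap.toMatrix' (T v) i j = planeCoeffs (N + n + n) (bezoutMap N v u) i := by
      intro v
      rw [LinearMap.toMatrix'_apply, hu]
      have : (fun j' => if j' = j then (1 : ℂ) else 0) = Pi.single j 1 := by
        funext j'
        simp [Pi.single_apply]
      rfl
    rw [h1, map_add, hp, MvPolynomial.eval_C, bezoutMap_apply, map_add (planeCoeffs (N + n + n))]
    rfl
  choose 𝓜' h𝓜' using hT
  let 𝓜 : Matrix β β (MvPolynomial (VFCoord n) ℂ) := Matrix.of 𝓜'
  have h𝓜 : ∀ v, (MvPolynomial.eval v).mapMatrix 𝓜 = LinearMap.toMatrix' (T v) := by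
    intro v
    ext i j
    exact h𝓜' i j v
  have hdet : ∀ v, MvPolynomial.eval v 𝓜.det = (LinearMap.toMatrix' (T v)).det := by
    intro v
    rw [RingHom.map_det, h𝓜]
  -- solve `T v u = det (T v) • τ` by Cramer's rule
  have key : ∀ f : MvPolynomial (Fin 2) ℂ, f.totalDegree ≤ N + n + n →
      ∃ a : Fin N → MvPolynomial (VFCoord n) ℂ, ∀ v : PlaneVF n, ∃ A B : MvPolynomial (Fin 2) ℂ,
        MvPolynomial.C (MvPolynomial.eval v 𝓜.det) * f =
          A * v.poly 0 + B * v.poly 1 +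
            ∑ i, MvPolynomial.C (MvPolynomial.eval v (a i)) * MvPolynomial.X 0 ^ (i : ℕ) := by
    intro f hf
    set τ := planeCoeffs (N + n + n) f with hτ
    refine ⟨fun i => ∑ j, MvPolynomial.C ((ρ (Pi.single j 1)).2 i) *
      (𝓜.adjugate.mulVec fun k => MvPolynomial.C (τ k)) j, fun v => ?_⟩
    set x : β → ℂ := (LinearMap.toMatrix' (T v)).adjugate.mulVec τ with hx
    have hxe : ∀ j, MvPolynomial.eval v
        ((𝓜.adjugate.mulVec fun k => MvPolynomial.C (τ k)) j) = x j := by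
      intro j
      rw [hx, ← h𝓜, ← RingHom.map_adjugate]
      simp [Matrix.mulVec, dotProduct]
    have h1 : T v x = (MvPolynomial.eval v 𝓜.det) • τ := by
      have : T v x = (LinearMap.toMatrix' (T v)).mulVec x := by
        rw [LinearMap.toMatrix'_mulVec]
      rw [this, hx, Matrix.mulVec_mulVec, Matrix.mul_adjugate, Matrix.smul_mulVec,
        Matrix.one_mulVec, hdet]
    have h2 : bezoutMap N v (ρ x) = MvPolynomial.C (MvPolynomial.eval v 𝓜.det) * f := by
      rw [← planePoly_planeCoeffs (totalDegree_bezoutMap_le N v (ρ x))]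
      have : planeCoeffs (N + n + n) (bezoutMap N v (ρ x)) = T v x := rfl
      rw [this, h1, map_smul, hτ, planePoly_planeCoeffs hf, MvPolynomial.smul_eq_C_mul]
    have h3 : ∀ i, MvPolynomial.eval v (∑ j, MvPolynomial.C ((ρ (Pi.single j 1)).2 i) *
        (𝓜.adjugate.mulVec fun k => MvPolynomial.C (τ k)) j) = (ρ x).2 i := by
      intro i
      have hl := linearMap_pi_apply ((LinearMap.proj i).comp ((LinearMap.snd ℂ _ _).comp ρ)) x
      rw [map_sum]
      refine Eq.trans (Finset.sum_congr rfl fun j _ => ?_) hl.symm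
      rw [map_mul, MvPolynomial.eval_C, hxe]
      rfl
    refine ⟨planePoly (N + n) (ρ x).1.1, planePoly (N + n) (ρ x).1.2, ?_⟩
    simp only [h3]
    rw [← h2, bezoutMap_apply]
  have hN1 : 1 ≤ N := hN ▸ Nat.one_le_pow _ _ hn
  obtain ⟨a, ha⟩ := key (MvPolynomial.X 0 ^ N) (by
    rw [MvPolynomial.totalDegree_X_pow]
    omega)
  obtain ⟨c, hc⟩ := key (MvPolynomial.X 1) (by
    rw [MvPolynomial.totalDegree_X]
    omega)
  refine ⟨𝓜.det, a, c, ?_, fun v => ?_⟩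
  · rw [hdet]
    have : T v₀ = LinearMap.id := hρ
    rw [this, LinearMap.toMatrix'_id, Matrix.det_one]
    exact one_ne_zero
  · obtain ⟨A, B, h⟩ := ha v
    obtain ⟨A', B', h'⟩ := hc v
    exact ⟨A, B, A', B', h, h'⟩

end PlaneVF

/-! ### Symmetric functions of roots through resultants. -/

open Polynomial in
-- The product formula needs roots, which exist only after applying `φ`. Since `R` is monic, its
-- degree survives `φ` and the power of the leading coefficient in the formula is `1`; a drop in the
-- degree of `H` is therefore harmless.
theorem resultant_map_eq_prod {A K : Type*} [CommRing A] [CommRing K] [IsDomain K] (φ : A →+* K)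
    {R : Polynomial A} (hR : R.Monic) (H : Polynomial A) {ι : Type*} [Fintype ι] {y : ι → K}
    (hy : R.map φ = ∏ i, (X - C (y i))) :
    φ (resultant R H) = ∏ i, (H.map φ).eval (y i) := by
  have hs : (R.map φ).Splits := by
    rw [hy]
    exact Splits.prod fun i _ => Splits.X_sub_C (y i)
  have h1 := resultant_eq_prod_eval (R.map φ) (H.map φ) H.natDegree natDegree_map_le hs
  rw [hR.natDegree_map, resultant_map_map, hR.map φ |>.leadingCoeff, one_pow, one_mul] at h1
  have h2 : (∏ i, (X - C (y i))) = ((Finset.univ.val.map y).map fun a => X - C a).prod := by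
    rw [Multiset.map_map]
    rfl
  rw [h1, hy, h2, roots_multiset_prod_X_sub_C, Multiset.map_map]
  rfl

/-! ### Rational functions with a given denominator -/

/-- The functions `a / b ^ k` on the set where the polynomial `b` does not vanish. -/
def RatFun {σ : Type*} (b : MvPolynomial σ ℂ) :
    Subalgebra ℂ ({v : σ → ℂ // MvPolynomial.eval v b ≠ 0} → ℂ) where
  carrier := {f | ∃ (a : MvPolynomial σ ℂ) (k : ℕ), ∀ v,
    f v = MvPolynomial.eval v.1 a / MvPolynomial.eval v.1 b ^ k}
  mul_mem' := by
    rintro f g ⟨a, k, hf⟩ ⟨a', k', hg⟩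
    refine ⟨a * a', k + k', fun v => ?_⟩
    rw [Pi.mul_apply, hf, hg, map_mul, pow_add, div_mul_div_comm]
  add_mem' := by
    rintro f g ⟨a, k, hf⟩ ⟨a', k', hg⟩
    refine ⟨a * b ^ k' + b ^ k * a', k + k', fun v => ?_⟩
    have := v.2
    rw [Pi.add_apply, hf, hg, map_add, map_mul, map_mul, map_pow, map_pow, pow_add,
      div_add_div _ _ (pow_ne_zero _ this) (pow_ne_zero _ this)]
  algebraMap_mem' c := ⟨MvPolynomial.C c, 0, fun v => by simp⟩

namespace RatFun

noncomputable instance {σ : Type*} (b : MvPolynomial σ ℂ) : CommRing (RatFun b) :=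
  Subalgebra.toCommRing _

variable {σ : Type*} {b : MvPolynomial σ ℂ}

/-- Evaluation at a point. -/
noncomputable def ev (v : {v : σ → ℂ // MvPolynomial.eval v b ≠ 0}) : RatFun b →+* ℂ :=
  (Pi.evalRingHom _ v).comp (RatFun b).val.toRingHom

/-- A polynomial divided by the denominator. -/
noncomputable def mk (b a : MvPolynomial σ ℂ) (k : ℕ) : RatFun b :=
  ⟨fun v => MvPolynomial.eval v.1 a / MvPolynomial.eval v.1 b ^ k, a, k, fun _ => rfl⟩

theorem ev_mk (v : {v : σ → ℂ // MvPolynomial.eval v b ≠ 0}) (a : MvPolynomial σ ℂ) (k : ℕ) :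
    ev v (mk b a k) = MvPolynomial.eval v.1 a / MvPolynomial.eval v.1 b ^ k := rfl

theorem exists_num (f : RatFun b) : ∃ (a : MvPolynomial σ ℂ) (k : ℕ), ∀ v,
    ev v f = MvPolynomial.eval v.1 a / MvPolynomial.eval v.1 b ^ k := f.2

theorem ext_ev {f g : RatFun b} (h : ∀ v, ev v f = ev v g) : f = g :=
  Subtype.ext (funext h)

open Polynomial in
/-- Symmetric functions of the values of a rational function at the roots of a monic polynomial
are rational functions of the coefficients. -/
theorem exists_coeff_prod {R F G : Polynomial (RatFun b)} (hR : R.Monic)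
    {v₀ : σ → ℂ} (hb₀ : MvPolynomial.eval v₀ b ≠ 0) {ι : Type*} [Fintype ι]
    {x₀ : ι → ℂ} (hx₀ : R.map (ev ⟨v₀, hb₀⟩) = ∏ i, (X - C (x₀ i)))
    (hG₀ : ∀ i, (G.map (ev ⟨v₀, hb₀⟩)).eval (x₀ i) ≠ 0) (k : ℕ) :
    ∃ a' b' : MvPolynomial σ ℂ, MvPolynomial.eval v₀ b' ≠ 0 ∧ ∀ v : σ → ℂ,
      MvPolynomial.eval v b' ≠ 0 → ∃ hb : MvPolynomial.eval v b ≠ 0, ∀ x : ι → ℂ,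
        R.map (ev ⟨v, hb⟩) = ∏ i, (X - C (x i)) →
        (∀ i, (G.map (ev ⟨v, hb⟩)).eval (x i) ≠ 0) →
        (∏ i, (X - C ((F.map (ev ⟨v, hb⟩)).eval (x i) / (G.map (ev ⟨v, hb⟩)).eval (x i)))).coeff k =
          MvPolynomial.eval v a' / MvPolynomial.eval v b' := by
  -- `χ = ∏ (G(xᵢ) T - F(xᵢ))`
  set H : Polynomial (Polynomial (RatFun b)) := C X * G.map C - F.map C with hH
  set χ := resultant (R.map C) H with hχ
  have hχv : ∀ (v : σ → ℂ) (hb : MvPolynomial.eval v b ≠ 0) (x : ι → ℂ),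
      R.map (ev ⟨v, hb⟩) = ∏ i, (X - C (x i)) →
      χ.map (ev ⟨v, hb⟩) = ∏ i, (C ((G.map (ev ⟨v, hb⟩)).eval (x i)) * X -
        C ((F.map (ev ⟨v, hb⟩)).eval (x i))) := by
    intro v hb x hx
    have hcomp : (mapRingHom (ev ⟨v, hb⟩)).comp C = C.comp (ev ⟨v, hb⟩) := by
      ext f
      simp
    have hy : (R.map C).map (mapRingHom (ev ⟨v, hb⟩)) = ∏ i, (X - C (C (x i))) := by
      rw [Polynomial.map_map, hcomp, ← Polynomial.map_map, hx, Polynomial.map_prod]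
      simp
    have h1 := resultant_map_eq_prod (mapRingHom (ev ⟨v, hb⟩)) (hR.map C) H hy
    rw [← hχ, coe_mapRingHom] at h1
    rw [h1]
    refine Finset.prod_congr rfl fun i _ => ?_
    simp only [hH, Polynomial.map_sub, Polynomial.map_mul, Polynomial.map_map, hcomp,
      Polynomial.map_C, eval_sub, eval_mul, eval_C]
    rw [← Polynomial.map_map, ← Polynomial.map_map]
    have hCe : ∀ p : Polynomial ℂ, (p.map C).eval (C (x i)) = C (p.eval (x i)) := fun p => by
      rw [eval_map, eval₂_at_apply]
    rw [hCe, hCe, coe_mapRingHom, Polynomial.map_X, mul_comm]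
  -- `γ` specializes to `∏ G(xᵢ)`, the leading coefficient of `χ`; dividing by it produces the monic
  -- polynomial with the roots `F(xᵢ) / G(xᵢ)`.
  set γ := resultant R G with hγ
  obtain ⟨ak, kk, hak⟩ := exists_num (χ.coeff k)
  obtain ⟨ag, kg, hag⟩ := exists_num γ
  have hγv : ∀ (v : σ → ℂ) (hb : MvPolynomial.eval v b ≠ 0) (x : ι → ℂ),
      R.map (ev ⟨v, hb⟩) = ∏ i, (X - C (x i)) →
      ev ⟨v, hb⟩ γ = ∏ i, (G.map (ev ⟨v, hb⟩)).eval (x i) := fun v hb x hx =>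
    resultant_map_eq_prod (ev ⟨v, hb⟩) hR G hx
  -- This is the quotient of `ak / b ^ kk` by `ag / b ^ kg`. The additional factor `b` above and
  -- below forces `b ≠ 0` where the new denominator is nonzero, even when `kk = 0`.
  refine ⟨ak * b ^ (kg + 1), b ^ (kk + 1) * ag, ?_, fun v hv => ?_⟩
  · rw [map_mul, map_pow]
    refine mul_ne_zero (pow_ne_zero _ hb₀) fun h => ?_
    have h1 := hγv v₀ hb₀ x₀ hx₀
    rw [hag, h, zero_div] at h1
    exact Finset.prod_ne_zero_iff.2 (fun i _ => hG₀ i) h1.symm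
  · rw [map_mul, map_pow] at hv
    have hb : MvPolynomial.eval v b ≠ 0 := fun h => by simp [h] at hv
    have hag0 : MvPolynomial.eval v ag ≠ 0 := right_ne_zero_of_mul hv
    refine ⟨hb, fun x hx hG => ?_⟩
    have h1 := hχv v hb x hx
    have h2 := hγv v hb x hx
    set Gx : ι → ℂ := fun i => (G.map (ev ⟨v, hb⟩)).eval (x i)
    set Fx : ι → ℂ := fun i => (F.map (ev ⟨v, hb⟩)).eval (x i)
    have h3 : χ.map (ev ⟨v, hb⟩) = C (∏ i, Gx i) * ∏ i, (X - C (Fx i / Gx i)) := by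
      rw [h1, map_prod, ← Finset.prod_mul_distrib]
      refine Finset.prod_congr rfl fun i _ => ?_
      rw [mul_sub, ← C_mul, mul_div_cancel₀ _ (hG i)]
    have h4 := congrArg (fun p : Polynomial ℂ => p.coeff k) h3
    simp only [coeff_C_mul, coeff_map] at h4
    rw [← h2, hak, hag] at h4
    rw [map_mul, map_mul, map_pow, map_pow]
    simp only at h4
    have hbk := pow_ne_zero kk hb
    have hbg := pow_ne_zero kg hb
    rw [div_mul_eq_mul_div, div_eq_div_iff hbk hbg] at h4
    rw [eq_div_iff (mul_ne_zero (pow_ne_zero _ hb) hag0)]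
    linear_combination (-MvPolynomial.eval v b) * h4

end RatFun

/-! ### Vector fields with coefficients in a ring -/

section PlaneSums

variable {n : ℕ} {A B : Type*} [CommRing A] [CommRing B]

/-- Values of the components of a vector field with coefficients in a ring. -/
def planeSum (u : VFCoord n → A) (i : Fin 2) (x y : A) : A :=
  ∑ d : PlaneExp n, u (i, d) * x ^ (d.1.1 : ℕ) * y ^ (d.1.2 : ℕ)

/-- Derivatives in the first variable of the components of a vector field. -/
def planeSumDx (u : VFCoord n → A) (i : Fin 2) (x y : A) : A :=
  ∑ d : PlaneExp n, u (i, d) * ((d.1.1 : ℕ) * x ^ ((d.1.1 : ℕ) - 1)) * y ^ (d.1.2 : ℕ)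

/-- Derivatives in the second variable of the components of a vector field. -/
def planeSumDy (u : VFCoord n → A) (i : Fin 2) (x y : A) : A :=
  ∑ d : PlaneExp n, u (i, d) * x ^ (d.1.1 : ℕ) * ((d.1.2 : ℕ) * y ^ ((d.1.2 : ℕ) - 1))

/-- Homogeneous parts of degree `n`, at the point `(1, w)`, of the components of a vector field. -/
def planeSumTop (u : VFCoord n → A) (i : Fin 2) (w : A) : A :=
  ∑ d : PlaneExp n, u (i, d) * w ^ (d.1.2 : ℕ) * 0 ^ (n - (d.1.1 : ℕ) - (d.1.2 : ℕ))

theorem map_planeSum (φ : A →+* B) (u : VFCoord n → A) (i : Fin 2) (x y : A) :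
    φ (planeSum u i x y) = planeSum (fun c => φ (u c)) i (φ x) (φ y) := by
  simp [planeSum]

theorem map_planeSumDx (φ : A →+* B) (u : VFCoord n → A) (i : Fin 2) (x y : A) :
    φ (planeSumDx u i x y) = planeSumDx (fun c => φ (u c)) i (φ x) (φ y) := by
  simp [planeSumDx]

theorem map_planeSumDy (φ : A →+* B) (u : VFCoord n → A) (i : Fin 2) (x y : A) :
    φ (planeSumDy u i x y) = planeSumDy (fun c => φ (u c)) i (φ x) (φ y) := by
  simp [planeSumDy]

theorem map_planeSumTop (φ : A →+* B) (u : VFCoord n → A) (i : Fin 2) (w : A) :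
    φ (planeSumTop u i w) = planeSumTop (fun c => φ (u c)) i (φ w) := by
  simp [planeSumTop]

end PlaneSums

namespace PlaneVF

variable {n : ℕ}

theorem field_eq_planeSum (v : PlaneVF n) (q : ℂ × ℂ) :
    v.field q = (planeSum v 0 q.1 q.2, planeSum v 1 q.1 q.2) := rfl

theorem homogenized_eq_planeSumTop (v : PlaneVF n) (i : Fin 2) (w : ℂ) :
    v.homogenized i 1 w 0 = planeSumTop v i w := by
  simp [homogenized, planeSumTop]

theorem linFin_apply (v : PlaneVF n) (q : ℂ × ℂ) :
    v.linFin q (1, 0) = (planeSumDx v 0 q.1 q.2, planeSumDx v 1 q.1 q.2) ∧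
    v.linFin q (0, 1) = (planeSumDy v 0 q.1 q.2, planeSumDy v 1 q.1 q.2) := by
  constructor
  · refine fderiv_prod_apply_fst (v.differentiable_field q) ?_
    have key : ∀ i : Fin 2, HasDerivAt (fun t : ℂ => ∑ d : PlaneExp n,
        v (i, d) * t ^ (d.1.1 : ℕ) * q.2 ^ (d.1.2 : ℕ)) (planeSumDx v i q.1 q.2) q.1 := by
      intro i
      refine HasDerivAt.fun_sum fun d _ => ?_
      exact ((hasDerivAt_pow _ _).const_mul _).mul_const _
    exact (key 0).prodMk (key 1)
  · refine fderiv_prod_apply_snd (v.differentiable_field q) ?_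
    have key : ∀ i : Fin 2, HasDerivAt (fun t : ℂ => ∑ d : PlaneExp n,
        v (i, d) * q.1 ^ (d.1.1 : ℕ) * t ^ (d.1.2 : ℕ)) (planeSumDy v i q.1 q.2) q.2 := by
      intro i
      refine HasDerivAt.fun_sum fun d _ => ?_
      exact (hasDerivAt_pow _ _).const_mul _
    exact (key 0).prodMk (key 1)

theorem trace_linFin (v : PlaneVF n) (q : ℂ × ℂ) :
    LinearMap.trace ℂ (ℂ × ℂ) (v.linFin q) =
      planeSumDx v 0 q.1 q.2 + planeSumDy v 1 q.1 q.2 := by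
  rw [prod_linearMap_trace, (v.linFin_apply q).1, (v.linFin_apply q).2]

theorem det_linFin (v : PlaneVF n) (q : ℂ × ℂ) :
    LinearMap.det (v.linFin q) =
      planeSumDx v 0 q.1 q.2 * planeSumDy v 1 q.1 q.2 -
        planeSumDy v 0 q.1 q.2 * planeSumDx v 1 q.1 q.2 := by
  rw [prod_linearMap_det, (v.linFin_apply q).1, (v.linFin_apply q).2]

end PlaneVF

/-! ### Zeros in the plane and their linearizations as functions of the abscissa. -/

namespace PlaneVF

variable {n : ℕ}

/-- The coefficients of the universal vector field, as constant polynomials over the rational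
functions with denominator `b`. -/
noncomputable def univCoeff (b : MvPolynomial (VFCoord n) ℂ) : VFCoord n → Polynomial (RatFun b) :=
  fun c => Polynomial.C (RatFun.mk b (MvPolynomial.X c) 0)

theorem map_univCoeff (b : MvPolynomial (VFCoord n) ℂ)
    (v : {v : PlaneVF n // MvPolynomial.eval v b ≠ 0}) (c : VFCoord n) :
    (univCoeff b c).map (RatFun.ev v) = Polynomial.C (v.1 c) := by
  rw [univCoeff, Polynomial.map_C, RatFun.ev_mk]
  simp

open Polynomial in
theorem monic_eq_prod_of_roots {K : Type*} [Field K] {N : ℕ} {R : Polynomial K} (hR : R.Monic)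
    (hN : R.natDegree = N) {x : Fin N → K} (hx : Function.Injective x) (h : ∀ i, R.eval (x i) = 0) :
    R = ∏ i, (X - C (x i)) := by
  have hdvd : (∏ i, (X - C (x i))) ∣ R := by
    refine Finset.prod_dvd_of_coprime ?_ fun i _ => dvd_iff_isRoot.2 (h i)
    exact fun i _ j _ hij => isCoprime_X_sub_C_of_isUnit_sub
      (sub_ne_zero.2 fun h => hij (hx h)).isUnit
  have hm : (∏ i, (X - C (x i))).Monic := monic_prod_of_monic _ _ fun i _ => monic_X_sub_C (x i)
  refine eq_of_monic_of_dvd_of_natDegree_le hm hR hdvd ?_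
  rw [hN, natDegree_prod_of_monic _ _ fun i _ => monic_X_sub_C (x i)]
  simp

/-- Data that express the zeros of the vector fields near a given one through the roots of a
polynomial in one variable. -/
structure Eliminants (n N : ℕ) where
  /-- the common denominator -/
  b : MvPolynomial (VFCoord n) ℂ
  /-- numerators of the coefficients of the polynomial whose roots are the abscissae -/
  a : Fin N → MvPolynomial (VFCoord n) ℂ
  /-- numerators of the coefficients of the polynomial that gives the ordinate -/
  c : Fin N → MvPolynomial (VFCoord n) ℂ
  ideal : ∀ v : PlaneVF n, ∃ A B A' B' : MvPolynomial (Fin 2) ℂ,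
    MvPolynomial.C (MvPolynomial.eval v b) * MvPolynomial.X 0 ^ N =
      A * v.poly 0 + B * v.poly 1 +
        ∑ i, MvPolynomial.C (MvPolynomial.eval v (a i)) * MvPolynomial.X 0 ^ (i : ℕ) ∧
    MvPolynomial.C (MvPolynomial.eval v b) * MvPolynomial.X 1 =
      A' * v.poly 0 + B' * v.poly 1 +
        ∑ i, MvPolynomial.C (MvPolynomial.eval v (c i)) * MvPolynomial.X 0 ^ (i : ℕ)

namespace Eliminants

variable {N : ℕ} (E : Eliminants n N)

open Polynomial

/-- The polynomial of the abscissae. -/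
noncomputable def R : Polynomial (RatFun E.b) :=
  X ^ N - ∑ i : Fin N, C (RatFun.mk E.b (E.a i) 1) * X ^ (i : ℕ)

/-- The polynomial of the ordinate. -/
noncomputable def Y : Polynomial (RatFun E.b) :=
  ∑ i : Fin N, C (RatFun.mk E.b (E.c i) 1) * X ^ (i : ℕ)

theorem degree_lt {A : Type*} [CommRing A] (a : Fin N → A) :
    (∑ i : Fin N, C (a i) * X ^ (i : ℕ)).degree < (N : WithBot ℕ) := by
  refine lt_of_le_of_lt (degree_sum_le _ _) ?_
  rw [Finset.sup_lt_iff (WithBot.bot_lt_coe _)]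
  intro i _
  refine lt_of_le_of_lt (degree_C_mul_X_pow_le _ _) ?_
  exact_mod_cast i.2

theorem monic_R : E.R.Monic := monic_X_pow_sub (degree_lt _)

variable (v : {v : PlaneVF n // MvPolynomial.eval v E.b ≠ 0})

theorem map_R : E.R.map (RatFun.ev v) =
    X ^ N - ∑ i : Fin N, C (MvPolynomial.eval v.1 (E.a i) / MvPolynomial.eval v.1 E.b) *
      X ^ (i : ℕ) := by
  simp [R, Polynomial.map_sum, RatFun.ev_mk]

theorem map_Y : E.Y.map (RatFun.ev v) =
    ∑ i : Fin N, C (MvPolynomial.eval v.1 (E.c i) / MvPolynomial.eval v.1 E.b) * X ^ (i : ℕ) := by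
  simp [Y, Polynomial.map_sum, RatFun.ev_mk]

theorem natDegree_map_R : (E.R.map (RatFun.ev v)).natDegree = N := by
  rw [map_R]
  refine natDegree_eq_of_degree_eq_some ?_
  rw [degree_sub_eq_left_of_degree_lt] <;> rw [degree_X_pow]
  exact degree_lt _

/-- Membership in the ideal `(P, Q)`, divided by the denominator and stated pointwise. It locates
the zeros, and its derivative at a zero later proves that the zero is simple. -/
theorem exists_identity : ∃ A B A' B' : MvPolynomial (Fin 2) ℂ, ∀ q : ℂ × ℂ,
    (E.R.map (RatFun.ev v)).eval q.1 =
      MvPolynomial.eval ![q.1, q.2] A * (v.1.field q).1 +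
        MvPolynomial.eval ![q.1, q.2] B * (v.1.field q).2 ∧
    q.2 - (E.Y.map (RatFun.ev v)).eval q.1 =
      MvPolynomial.eval ![q.1, q.2] A' * (v.1.field q).1 +
        MvPolynomial.eval ![q.1, q.2] B' * (v.1.field q).2 := by
  obtain ⟨A, B, A', B', h1, h2⟩ := E.ideal v.1
  have hb := v.2
  obtain ⟨β, hβ⟩ : ∃ β, β = MvPolynomial.eval v.1 E.b := ⟨_, rfl⟩
  rw [← hβ] at hb h1 h2
  have hs : ∀ (a : Fin N → MvPolynomial (VFCoord n) ℂ) (q : ℂ × ℂ),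
      ∑ i, MvPolynomial.eval v.1 (a i) / β * q.1 ^ (i : ℕ) =
        β⁻¹ * ∑ i, MvPolynomial.eval v.1 (a i) * q.1 ^ (i : ℕ) := by
    intro a q
    rw [Finset.mul_sum]
    refine Finset.sum_congr rfl fun i _ => ?_
    rw [div_eq_inv_mul, mul_assoc]
  refine ⟨MvPolynomial.C β⁻¹ * A, MvPolynomial.C β⁻¹ * B, MvPolynomial.C β⁻¹ * A',
    MvPolynomial.C β⁻¹ * B', fun q => ⟨?_, ?_⟩⟩
  · have := congrArg (MvPolynomial.eval ![q.1, q.2]) h1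
    simp only [map_add, map_mul, map_sum, map_pow, MvPolynomial.eval_C, MvPolynomial.eval_X,
      eval_poly_zero, eval_poly_one, Matrix.cons_val_zero] at this
    rw [map_R, ← hβ]
    simp only [eval_sub, eval_pow, eval_X, eval_finsetSum, eval_mul, eval_C, map_mul,
      MvPolynomial.eval_C, hs]
    field_simp
    linear_combination this
  · have := congrArg (MvPolynomial.eval ![q.1, q.2]) h2
    simp only [map_add, map_mul, map_sum, map_pow, MvPolynomial.eval_C, MvPolynomial.eval_X,
      eval_poly_zero, eval_poly_one, Matrix.cons_val_zero, Matrix.cons_val_one] at this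
    rw [map_Y, ← hβ]
    simp only [eval_pow, eval_X, eval_finsetSum, eval_mul, eval_C, map_mul,
      MvPolynomial.eval_C, hs]
    field_simp
    linear_combination this

theorem eval_R_eq_zero {q : ℂ × ℂ} (hq : v.1.field q = 0) :
    (E.R.map (RatFun.ev v)).eval q.1 = 0 := by
  obtain ⟨A, B, A', B', h⟩ := E.exists_identity v
  rw [(h q).1, hq]
  simp

theorem eval_Y_eq {q : ℂ × ℂ} (hq : v.1.field q = 0) :
    (E.Y.map (RatFun.ev v)).eval q.1 = q.2 := by
  obtain ⟨A, B, A', B', h⟩ := E.exists_identity v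
  have := (h q).2
  rw [hq] at this
  simp only [Prod.fst_zero, Prod.snd_zero, mul_zero, add_zero] at this
  exact (sub_eq_zero.1 this).symm

/-- The ordinate of a zero is `Y` at its abscissa, so distinct zeros have distinct abscissae for
every `v` off the hypersurface `b = 0`, not just for the initial field. -/
theorem injective_fst_of_zeros {ι : Type*} {q : ι → ℂ × ℂ} (hq : ∀ i, v.1.field (q i) = 0)
    (hinj : Function.Injective q) : Function.Injective fun i => (q i).1 := by
  intro i j h
  have h : (q i).1 = (q j).1 := h
  refine hinj (Prod.ext h ?_)
  rw [← E.eval_Y_eq v (hq i), ← E.eval_Y_eq v (hq j), h]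

theorem map_R_eq_prod {q : Fin N → ℂ × ℂ} (hq : ∀ i, v.1.field (q i) = 0)
    (hinj : Function.Injective q) :
    E.R.map (RatFun.ev v) = ∏ i, (X - C (q i).1) :=
  monic_eq_prod_of_roots (E.monic_R.map _) (E.natDegree_map_R v)
    (E.injective_fst_of_zeros v hq hinj) fun i => E.eval_R_eq_zero v (hq i)

/-- The trace of the linearization as a polynomial in the abscissa. -/
noncomputable def trPoly : Polynomial (RatFun E.b) :=
  planeSumDx (univCoeff E.b) 0 X E.Y + planeSumDy (univCoeff E.b) 1 X E.Y

/-- The determinant of the linearization as a polynomial in the abscissa. -/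
noncomputable def detPoly : Polynomial (RatFun E.b) :=
  planeSumDx (univCoeff E.b) 0 X E.Y * planeSumDy (univCoeff E.b) 1 X E.Y -
    planeSumDy (univCoeff E.b) 0 X E.Y * planeSumDx (univCoeff E.b) 1 X E.Y

/-- Evaluation of a polynomial with rational coefficients. -/
noncomputable def evalAt (x : ℂ) : Polynomial (RatFun E.b) →+* ℂ :=
  (evalRingHom x).comp (mapRingHom (RatFun.ev v))

theorem evalAt_univCoeff (x : ℂ) : (fun c => E.evalAt v x (univCoeff E.b c)) = v.1 := by
  funext c
  simp [evalAt, map_univCoeff]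

theorem eval_trPoly (x : ℂ) : (E.trPoly.map (RatFun.ev v)).eval x =
    LinearMap.trace ℂ (ℂ × ℂ) (v.1.linFin (x, (E.Y.map (RatFun.ev v)).eval x)) := by
  have h : (E.trPoly.map (RatFun.ev v)).eval x = E.evalAt v x E.trPoly := rfl
  rw [h, trace_linFin, trPoly, map_add, map_planeSumDx, map_planeSumDy, evalAt_univCoeff]
  simp [evalAt]

theorem eval_detPoly (x : ℂ) : (E.detPoly.map (RatFun.ev v)).eval x =
    LinearMap.det (v.1.linFin (x, (E.Y.map (RatFun.ev v)).eval x)) := by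
  have h : (E.detPoly.map (RatFun.ev v)).eval x = E.evalAt v x E.detPoly := rfl
  rw [h, det_linFin, detPoly, map_sub, map_mul, map_mul, map_planeSumDx, map_planeSumDy,
    map_planeSumDx, map_planeSumDy, evalAt_univCoeff]
  simp [evalAt]

end Eliminants

theorem exists_eliminants' {v₀ : PlaneVF n} (hn : 1 ≤ n) {N : ℕ} (hN : N = n ^ 2)
    {q : Fin N → ℂ × ℂ} (hq : ∀ k, v₀.field (q k) = 0)
    (hinj : Function.Injective fun k => (q k).1)
    (hJ : ∀ q, v₀.field q = 0 → LinearMap.det (v₀.linFin q) ≠ 0)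
    (hdeg : (v₀.poly 0).totalDegree = n ∨ (v₀.poly 1).totalDegree = n) :
    ∃ E : Eliminants n N, MvPolynomial.eval v₀ E.b ≠ 0 := by
  obtain ⟨b, a, c, hb, h⟩ := exists_eliminants hn hN hq hinj hJ hdeg
  exact ⟨⟨b, a, c, h⟩, hb⟩

open Polynomial in
/-- Symmetric functions of the Baum-Bott indices at the zeros are rational functions of the
coefficients, near a field whose zeros have distinct abscissae. -/
theorem exists_coeff_prod_bbIndex_linFin {v₀ : PlaneVF n} (hn : 1 ≤ n) {N : ℕ} (hN : N = n ^ 2)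
    {q₀ : Fin N → ℂ × ℂ} (hq₀ : ∀ k, v₀.field (q₀ k) = 0)
    (hinj : Function.Injective fun k => (q₀ k).1)
    (hJ : ∀ q, v₀.field q = 0 → LinearMap.det (v₀.linFin q) ≠ 0)
    (hdeg : (v₀.poly 0).totalDegree = n ∨ (v₀.poly 1).totalDegree = n) (k : ℕ) :
    ∃ a b : MvPolynomial (VFCoord n) ℂ, MvPolynomial.eval v₀ b ≠ 0 ∧ ∀ v : PlaneVF n,
      MvPolynomial.eval v b ≠ 0 → ∀ q : Fin N → ℂ × ℂ, Function.Injective q →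
        (∀ i, v.field (q i) = 0) → (∀ i, LinearMap.det (v.linFin (q i)) ≠ 0) →
        (∏ i, (X - C (bbIndex (v.linFin (q i))))).coeff k =
          MvPolynomial.eval v a / MvPolynomial.eval v b := by
  obtain ⟨E, hb₀⟩ := exists_eliminants' hn hN hq₀ hinj hJ hdeg
  have hq₀inj : Function.Injective q₀ := fun i j h => hinj (congrArg Prod.fst h)
  have hbb : ∀ (v : PlaneVF n) (hb : MvPolynomial.eval v E.b ≠ 0) (q : ℂ × ℂ), v.field q = 0 →
      (E.trPoly.map (RatFun.ev ⟨v, hb⟩)).eval q.1 = LinearMap.trace ℂ (ℂ × ℂ) (v.linFin q) ∧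
      (E.detPoly.map (RatFun.ev ⟨v, hb⟩)).eval q.1 = LinearMap.det (v.linFin q) := by
    intro v hb q hq
    rw [E.eval_trPoly ⟨v, hb⟩, E.eval_detPoly ⟨v, hb⟩, E.eval_Y_eq ⟨v, hb⟩ hq]
    exact ⟨rfl, rfl⟩
  -- The index is `(tr ^ 2 - 2 det) / det`, a single fraction evaluated at the abscissa.
  obtain ⟨a', b', hb', h⟩ := RatFun.exists_coeff_prod (F := E.trPoly ^ 2 - 2 * E.detPoly)
    (G := E.detPoly) E.monic_R hb₀ (E.map_R_eq_prod ⟨v₀, hb₀⟩ hq₀ hq₀inj)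
    (fun i => by
      rw [(hbb v₀ hb₀ _ (hq₀ i)).2]
      exact hJ _ (hq₀ i)) k
  refine ⟨a', b', hb', fun v hv q hqinj hq hdet => ?_⟩
  obtain ⟨hb, h⟩ := h v hv
  rw [← h (fun i => (q i).1) (E.map_R_eq_prod ⟨v, hb⟩ hq hqinj) (fun i => by
    rw [(hbb v hb _ (hq i)).2]
    exact hdet i)]
  congr 2
  funext i
  rw [bbIndex]
  have h1 := hbb v hb _ (hq i)
  simp only [Polynomial.map_sub, Polynomial.map_pow, Polynomial.map_mul, eval_sub, eval_pow,
    eval_mul, h1.1, h1.2]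
  have h2 := hdet i
  congr 2
  simp only [Polynomial.map_ofNat, eval_ofNat]
  field_simp

end PlaneVF

/-! ### Singular points at infinity as roots of a polynomial of degree `n + 1`. -/

namespace PlaneVF

variable {n : ℕ}

/-- The exponent of `y ^ n`. -/
def topExp (n : ℕ) : PlaneExp n := ⟨(0, Fin.last n), by simp⟩

theorem eq_topExp {d : PlaneExp n} (h : (d.1.2 : ℕ) = n) : d = topExp n := by
  have hd := d.2
  refine Subtype.ext (Prod.ext (Fin.ext ?_) (Fin.ext h))
  show (d.1.1 : ℕ) = 0
  omega

theorem homogenized_zero_one_zero (v : PlaneVF n) (i : Fin 2) :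
    v.homogenized i 0 1 0 = v (i, topExp n) := by
  rw [homogenized, Finset.sum_eq_single (topExp n)]
  · simp [topExp]
  · intro d _ hd
    rcases Nat.eq_zero_or_pos (d.1.1 : ℕ) with h | h
    · have h2 : (d.1.2 : ℕ) ≠ n := fun h2 => hd (eq_topExp h2)
      have := d.2
      have h3 : n - (d.1.1 : ℕ) - (d.1.2 : ℕ) ≠ 0 := by omega
      simp [h3]
    · simp [h.ne']
  · simp

theorem infty_notMem_singInf_iff (v : PlaneVF n) :
    OnePoint.infty ∉ v.singInf ↔ v (0, topExp n) ≠ 0 := by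
  rw [infty_mem_singInf_iff, homogenized_zero_one_zero]

theorem totalDegree_poly_of_ne_zero {v : PlaneVF n} {i : Fin 2} (h : v (i, topExp n) ≠ 0) :
    (v.poly i).totalDegree = n := by
  refine le_antisymm (totalDegree_planePoly_le _) ?_
  have h1 : planeExpFinsupp (topExp n) ∈ (v.poly i).support := by
    rw [MvPolynomial.mem_support_iff, poly, coeff_planePoly]
    exact h
  have h2 := MvPolynomial.le_totalDegree h1
  rw [Finsupp.sum_fintype _ _ (fun _ => rfl), Fin.sum_univ_two, planeExpFinsupp_zero,
    planeExpFinsupp_one] at h2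
  simpa [topExp] using h2

section Infinity

open Polynomial

variable {A : Type*} [CommRing A]

theorem natDegree_planeSumTop_le (a : VFCoord n → A) (i : Fin 2) :
    (planeSumTop (fun c => C (a c)) i X).natDegree ≤ n := by
  refine natDegree_sum_le_of_forall_le _ _ fun d _ => ?_
  have hd := d.2
  have : (0 : Polynomial A) ^ (n - (d.1.1 : ℕ) - (d.1.2 : ℕ)) =
      C (0 ^ (n - (d.1.1 : ℕ) - (d.1.2 : ℕ))) := by simp
  rw [this, mul_right_comm, ← C_mul]
  refine (natDegree_C_mul_X_pow_le _ _).trans ?_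
  omega

theorem coeff_planeSumTop (a : VFCoord n → A) (i : Fin 2) :
    (planeSumTop (fun c => C (a c)) i X).coeff n = a (i, topExp n) := by
  have : ∀ d : PlaneExp n, (0 : Polynomial A) ^ (n - (d.1.1 : ℕ) - (d.1.2 : ℕ)) =
      C (0 ^ (n - (d.1.1 : ℕ) - (d.1.2 : ℕ))) := by simp
  simp only [planeSumTop, this, finsetSum_coeff, coeff_mul_C, coeff_C_mul_X_pow]
  rw [Finset.sum_eq_single (topExp n)]
  · simp [topExp]
  · intro d _ hd
    rw [if_neg (fun h => hd (eq_topExp h.symm)), zero_mul]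
  · simp

/-- The polynomial of the singular points at infinity of the universal vector field. -/
noncomputable def univInf (b : MvPolynomial (VFCoord n) ℂ) : Polynomial (RatFun b) :=
  planeSumTop (univCoeff b) 1 X - X * planeSumTop (univCoeff b) 0 X

theorem natDegree_univInf_le (b : MvPolynomial (VFCoord n) ℂ) :
    (univInf b).natDegree ≤ n + 1 := by
  refine (natDegree_sub_le _ _).trans (max_le ?_ ?_)
  · exact (natDegree_planeSumTop_le _ 1).trans (Nat.le_succ n)
  · refine natDegree_mul_le.trans ?_
    have h1 := natDegree_X_le (R := RatFun b)
    have h2 := natDegree_planeSumTop_le (fun c => RatFun.mk b (MvPolynomial.X c) 0) 0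
    have h3 : (planeSumTop (univCoeff b) 0 X).natDegree ≤ n := h2
    omega

theorem coeff_univInf (b : MvPolynomial (VFCoord n) ℂ) :
    (univInf b).coeff (n + 1) = -RatFun.mk b (MvPolynomial.X (0, topExp n)) 0 := by
  have h1 : (planeSumTop (univCoeff b) 1 X).coeff (n + 1) = 0 :=
    coeff_eq_zero_of_natDegree_lt (lt_of_le_of_lt (natDegree_planeSumTop_le _ 1) (Nat.lt_succ_self n))
  have h2 : (planeSumTop (univCoeff b) 0 X).coeff n = RatFun.mk b (MvPolynomial.X (0, topExp n)) 0 :=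
    coeff_planeSumTop _ 0
  rw [univInf, coeff_sub, h1, coeff_X_mul, h2, zero_sub]

/-- The denominator: the coefficient of `y ^ n`. -/
noncomputable def infDenom (n : ℕ) : MvPolynomial (VFCoord n) ℂ := MvPolynomial.X (0, topExp n)

theorem eval_infDenom (v : PlaneVF n) :
    MvPolynomial.eval v (infDenom n) = v (0, topExp n) := MvPolynomial.eval_X _

/-- The monic polynomial of the singular points at infinity. -/
noncomputable def infMonic (n : ℕ) : Polynomial (RatFun (infDenom n)) :=
  C (RatFun.mk (infDenom n) (-1) 1) * univInf (infDenom n)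

/-- The top coefficient comes from the product of `w` with the leading part of `P` alone and equals
minus the coefficient of `y ^ n`; this explains the factor `-1 / b` and the choice of denominator.
-/
theorem monic_infMonic : (infMonic n).Monic := by
  refine monic_of_natDegree_le_of_coeff_eq_one (n + 1) ?_ ?_
  · exact (natDegree_C_mul_le _ _).trans (natDegree_univInf_le _)
  · rw [infMonic, coeff_C_mul, coeff_univInf]
    refine RatFun.ext_ev fun v => ?_
    have hv := v.2
    rw [eval_infDenom] at hv
    simp only [map_mul, map_neg, RatFun.ev_mk, map_one, eval_infDenom, MvPolynomial.eval_X]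
    field_simp

variable (v : {v : PlaneVF n // MvPolynomial.eval v (infDenom n) ≠ 0})

theorem eval_univTop (b : MvPolynomial (VFCoord n) ℂ)
    (v : {v : PlaneVF n // MvPolynomial.eval v b ≠ 0}) (i : Fin 2) (w : ℂ) :
    ((planeSumTop (univCoeff b) i X).map (RatFun.ev v)).eval w = v.1.homogenized i 1 w 0 := by
  have h : ((planeSumTop (univCoeff b) i X).map (RatFun.ev v)).eval w =
    ((evalRingHom w).comp (mapRingHom (RatFun.ev v))) (planeSumTop (univCoeff b) i X) := rfl
  rw [h, map_planeSumTop, homogenized_eq_planeSumTop]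
  simp [map_univCoeff]

theorem eval_univInf (b : MvPolynomial (VFCoord n) ℂ)
    (v : {v : PlaneVF n // MvPolynomial.eval v b ≠ 0}) (w : ℂ) :
    ((univInf b).map (RatFun.ev v)).eval w = v.1.infFun w := by
  rw [univInf, Polynomial.map_sub, Polynomial.map_mul, eval_sub, eval_mul, eval_univTop,
    eval_univTop, map_X, eval_X, infFun]

theorem eval_derivative_univInf (b : MvPolynomial (VFCoord n) ℂ)
    (v : {v : PlaneVF n // MvPolynomial.eval v b ≠ 0}) (w : ℂ) :
    ((derivative (univInf b)).map (RatFun.ev v)).eval w = deriv v.1.infFun w := by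
  have h : v.1.infFun = fun w => ((univInf b).map (RatFun.ev v)).eval w :=
    funext fun w => (eval_univInf b v w).symm
  rw [h, Polynomial.deriv, derivative_map]

theorem eval_infMonic (w : ℂ) :
    ((infMonic n).map (RatFun.ev v)).eval w = -(v.1 (0, topExp n))⁻¹ * v.1.infFun w := by
  rw [infMonic, Polynomial.map_mul, eval_mul, eval_univInf, map_C, eval_C, RatFun.ev_mk,
    eval_infDenom]
  simp [div_eq_inv_mul]

theorem natDegree_map_infMonic : ((infMonic n).map (RatFun.ev v)).natDegree = n + 1 := by
  have hnt : Nontrivial (RatFun (infDenom n)) := (RatFun.ev v).domain_nontrivial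
  have h1 : (infMonic n).natDegree = n + 1 := by
    refine le_antisymm ((natDegree_C_mul_le _ _).trans (natDegree_univInf_le _)) ?_
    refine le_natDegree_of_ne_zero ?_
    rw [infMonic, coeff_C_mul, coeff_univInf]
    intro h
    have h2 := congrArg (RatFun.ev v) h
    have hv := v.2
    rw [eval_infDenom] at hv
    simp only [map_mul, map_neg, RatFun.ev_mk, map_one, eval_infDenom, MvPolynomial.eval_X,
      map_zero] at h2
    field_simp at h2
    simp at h2
  rw [monic_infMonic.natDegree_map, h1]

theorem map_infMonic_eq_prod {w : Fin (n + 1) → ℂ} (hw : ∀ i, v.1.infFun (w i) = 0)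
    (hinj : Function.Injective w) :
    (infMonic n).map (RatFun.ev v) = ∏ i, (X - C (w i)) :=
  monic_eq_prod_of_roots (monic_infMonic.map _) (natDegree_map_infMonic v) hinj fun i => by
    rw [eval_infMonic, hw, mul_zero]

theorem bbIndex_linInf_coe (v : PlaneVF n) (w : ℂ) :
    bbIndex (v.linInf (w : OnePoint ℂ)) =
      (deriv v.infFun w - v.homogenized 0 1 w 0) ^ 2 /
        -(v.homogenized 0 1 w 0 * deriv v.infFun w) - 2 := by
  rw [bbIndex, trace_linInf_coe, det_linInf_coe]

/-- Symmetric functions of the Baum-Bott indices at infinity are rational functions of the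
coefficients. -/
theorem exists_coeff_prod_bbIndex_linInf {v₀ : PlaneVF n} (h₀ : v₀ (0, topExp n) ≠ 0)
    {w₀ : Fin (n + 1) → ℂ} (hw₀ : ∀ i, v₀.infFun (w₀ i) = 0) (hinj : Function.Injective w₀)
    (hdet : ∀ i, LinearMap.det (v₀.linInf (w₀ i : OnePoint ℂ)) ≠ 0) (k : ℕ) :
    ∃ a b : MvPolynomial (VFCoord n) ℂ, MvPolynomial.eval v₀ b ≠ 0 ∧ ∀ v : PlaneVF n,
      MvPolynomial.eval v b ≠ 0 → v (0, topExp n) ≠ 0 ∧ ∀ w : Fin (n + 1) → ℂ,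
        Function.Injective w → (∀ i, v.infFun (w i) = 0) →
        (∀ i, LinearMap.det (v.linInf (w i : OnePoint ℂ)) ≠ 0) →
        (∏ i, (X - C (bbIndex (v.linInf (w i : OnePoint ℂ))))).coeff k =
          MvPolynomial.eval v a / MvPolynomial.eval v b := by
  have hb₀ : MvPolynomial.eval v₀ (infDenom n) ≠ 0 := by rwa [eval_infDenom]
  set b := infDenom n
  set P := planeSumTop (univCoeff b) 0 X
  set D := derivative (univInf b)
  have hG : ∀ (v : PlaneVF n) (hb : MvPolynomial.eval v b ≠ 0) (w : ℂ),
      ((-(P * D)).map (RatFun.ev ⟨v, hb⟩)).eval w = LinearMap.det (v.linInf (w : OnePoint ℂ)) := by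
    intro v hb w
    rw [Polynomial.map_neg, Polynomial.map_mul, eval_neg, eval_mul, eval_univTop,
      eval_derivative_univInf, det_linInf_coe]
  have hF : ∀ (v : PlaneVF n) (hb : MvPolynomial.eval v b ≠ 0) (w : ℂ),
      ((D - P).map (RatFun.ev ⟨v, hb⟩)).eval w =
        LinearMap.trace ℂ (ℂ × ℂ) (v.linInf (w : OnePoint ℂ)) := by
    intro v hb w
    rw [Polynomial.map_sub, eval_sub, eval_univTop, eval_derivative_univInf, trace_linInf_coe]
  obtain ⟨a', b', hb', h⟩ := RatFun.exists_coeff_prod (F := (D - P) ^ 2 - 2 * (-(P * D)))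
    (G := -(P * D)) monic_infMonic hb₀ (map_infMonic_eq_prod ⟨v₀, hb₀⟩ hw₀ hinj)
    (fun i => by
      rw [hG]
      exact hdet i) k
  refine ⟨a', b', hb', fun v hv => ?_⟩
  obtain ⟨hb, h⟩ := h v hv
  refine ⟨by rwa [eval_infDenom] at hb, fun w hwinj hw hdet => ?_⟩
  rw [← h w (map_infMonic_eq_prod ⟨v, hb⟩ hw hwinj) (fun i => by
    rw [hG]
    exact hdet i)]
  congr 2
  funext i
  have h2 := hdet i
  rw [hG, Polynomial.map_sub, Polynomial.map_pow, eval_sub, eval_pow, hF, Polynomial.map_mul,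
    eval_mul, hG, bbIndex]
  congr 2
  simp only [Polynomial.map_ofNat, eval_ofNat]
  field_simp

end Infinity

/-! ### Regularity of the symmetric functions of the indices -/

open Polynomial in
/-- The polynomial whose roots are the Baum-Bott indices at infinity. -/
noncomputable def bbPolyInf (v : PlaneVF n) : Polynomial ℂ :=
  ∏ᶠ o ∈ v.singInf, (X - C (bbIndex (v.linInf o)))

open Polynomial in
/-- The polynomial whose roots are the Baum-Bott indices in the plane. -/
noncomputable def bbPolyFin (v : PlaneVF n) : Polynomial ℂ :=
  ∏ᶠ q ∈ v.singFin, (X - C (bbIndex (v.linFin q)))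

open Polynomial in
theorem bbPoly_eq_of_isNumbering {v : PlaneVF n} {O : Fin (n + 1) → OnePoint ℂ}
    {Q : Fin (n ^ 2) → ℂ × ℂ} (h : v.IsNumbering O Q) :
    v.bbPolyInf = ∏ i, (X - C (bbIndex (v.linInf (O i)))) ∧
    v.bbPolyFin = ∏ j, (X - C (bbIndex (v.linFin (Q j)))) := by
  obtain ⟨hO, hOr, hQ, hQr⟩ := h
  constructor
  · rw [bbPolyInf, ← hOr, finprod_mem_range hO, finprod_eq_prod_of_fintype]
  · rw [bbPolyFin, ← hQr, finprod_mem_range hQ, finprod_eq_prod_of_fintype]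

open Polynomial in
theorem bbPoly_eq_of_mem_bbTuples {v : PlaneVF n} {t : Fin (n + 1) ⊕ Fin (n ^ 2) → ℂ}
    (ht : t ∈ v.bbTuples) :
    v.bbPolyInf = ∏ i, (X - C (t (Sum.inl i))) ∧ v.bbPolyFin = ∏ j, (X - C (t (Sum.inr j))) := by
  obtain ⟨-, O, Q, h, rfl⟩ := ht
  exact bbPoly_eq_of_isNumbering h

theorem IsNondegenerate.exists_isNumbering {v : PlaneVF n} (hv : v.IsNondegenerate) :
    ∃ O Q, v.IsNumbering O Q := by
  have key : ∀ {α : Type} (s : Set α) (m : ℕ), s.encard = (m : ℕ∞) →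
      ∃ f : Fin m → α, Function.Injective f ∧ Set.range f = s := by
    intro α s m hs
    have hfin : s.Finite := Set.finite_of_encard_eq_coe hs
    have : Finite s := hfin
    have hc : Nat.card s = m := by
      have h1 : s.ncard = m := by
        rw [Set.ncard, hs]
        rfl
      rwa [← Nat.card_coe_set_eq] at h1
    let e := (Finite.equivFinOfCardEq hc).symm
    refine ⟨fun i => (e i : α), Subtype.val_injective.comp e.injective, ?_⟩
    have : (fun i => (e i : α)) = Subtype.val ∘ e := rfl
    rw [this, Set.range_comp, e.range_eq_univ, Set.image_univ, Subtype.range_val]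
  obtain ⟨O, hO, hOr⟩ := key v.singInf (n + 1) hv.1
  obtain ⟨Q, hQ, hQr⟩ := key v.singFin (n ^ 2) hv.2.1
  exact ⟨O, Q, hO, hOr, hQ, hQr⟩

theorem IsNondegenerate.bbTuples_nonempty {v : PlaneVF n} (hv : v.IsNondegenerate) :
    v.bbTuples.Nonempty := by
  obtain ⟨O, Q, h⟩ := hv.exists_isNumbering
  exact ⟨_, hv, O, Q, h, rfl⟩

theorem IsNondegenerate.of_affEquiv {v v' : PlaneVF n} (hv : v.IsNondegenerate)
    (h : AffEquiv v v') : v'.IsNondegenerate := by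
  obtain ⟨t, ht⟩ := hv.bbTuples_nonempty
  exact (bbTuples_subset_of_affEquiv h ht).1

theorem bbPoly_eq_of_affEquiv {v v' : PlaneVF n} (hv : v.IsNondegenerate) (h : AffEquiv v v') :
    v.bbPolyInf = v'.bbPolyInf ∧ v.bbPolyFin = v'.bbPolyFin := by
  obtain ⟨t, ht⟩ := hv.bbTuples_nonempty
  obtain ⟨h1, h2⟩ := bbPoly_eq_of_mem_bbTuples ht
  obtain ⟨h3, h4⟩ := bbPoly_eq_of_mem_bbTuples (bbTuples_subset_of_affEquiv h ht)
  exact ⟨h1.trans h3.symm, h2.trans h4.symm⟩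

theorem exists_coe_of_isNumbering {v : PlaneVF n} {O : Fin (n + 1) → OnePoint ℂ}
    {Q : Fin (n ^ 2) → ℂ × ℂ} (h : v.IsNumbering O Q) (hv : v (0, topExp n) ≠ 0) :
    ∃ w : Fin (n + 1) → ℂ, Function.Injective w ∧ (∀ i, O i = (w i : OnePoint ℂ)) ∧
      ∀ i, v.infFun (w i) = 0 := by
  have hO : ∀ i, ∃ w : ℂ, O i = (w : OnePoint ℂ) := by
    intro i
    have h1 : O i ∈ v.singInf := h.2.1 ▸ Set.mem_range_self i
    have h2 : O i ≠ OnePoint.infty := fun h2 =>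
      (v.infty_notMem_singInf_iff.2 hv) (h2 ▸ h1)
    obtain ⟨w, hw⟩ := OnePoint.ne_infty_iff_exists.1 h2
    exact ⟨w, hw.symm⟩
  choose w hw using hO
  refine ⟨w, fun i j hij => h.1 ?_, hw, fun i => ?_⟩
  · rw [hw, hw, hij]
  · rw [← coe_mem_singInf_iff, ← hw]
    exact h.2.1 ▸ Set.mem_range_self i

/-- A shear puts a nondegenerate field into general position with respect to the coordinates. -/
theorem exists_shear {v₀ : PlaneVF n} (hv₀ : v₀.IsNondegenerate) :
    ∃ G : PlaneVF n →ₗ[ℂ] PlaneVF n, (∀ v, AffEquiv v (G v)) ∧ (G v₀) (0, topExp n) ≠ 0 ∧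
      ∃ O Q, (G v₀).IsNumbering O Q ∧ Function.Injective fun j => (Q j).1 := by
  obtain ⟨O, Q, hO, hOr, hQ, hQr⟩ := hv₀.exists_isNumbering
  -- The shear `(x, y) ↦ (x + s y, y)` turns the direction `(-s, 1)` vertical. Excluding these `s`
  -- keeps the vertical direction nonsingular for the new field.
  have hfin1 : {s : ℂ | slopeOf (-s, 1) ∈ v₀.singInf}.Finite := by
    refine Set.Finite.preimage ?_ (hOr ▸ Set.finite_range O)
    intro s _ s' _ h
    by_cases hs : s = 0 <;> by_cases hs' : s' = 0 <;> simp_all [slopeOf]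
  -- The parameters for which two zeros acquire equal abscissae: at most one for each pair of
  -- distinct points.
  have hfin2 : {s : ℂ | ∃ i j, i ≠ j ∧ (Q i).1 + s * (Q i).2 = (Q j).1 + s * (Q j).2}.Finite := by
    have : {s : ℂ | ∃ i j, i ≠ j ∧ (Q i).1 + s * (Q i).2 = (Q j).1 + s * (Q j).2} ⊆
        Set.range fun p : Fin (n ^ 2) × Fin (n ^ 2) =>
          -((Q p.1).1 - (Q p.2).1) / ((Q p.1).2 - (Q p.2).2) := by
      rintro s ⟨i, j, hij, h⟩
      refine ⟨(i, j), ?_⟩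
      have hne : (Q i).2 - (Q j).2 ≠ 0 := by
        intro h2
        have h2 := sub_eq_zero.1 h2
        rw [h2] at h
        exact hij (hQ (Prod.ext (add_right_cancel h) h2))
      simp only
      rw [div_eq_iff hne]
      linear_combination -h
    exact (Set.finite_range _).subset this
  obtain ⟨s, hs⟩ := (hfin1.union hfin2).infinite_compl.nonempty
  simp only [Set.mem_compl_iff, Set.mem_union, not_or, Set.mem_ofPred_eq] at hs
  obtain ⟨hs1, hs2⟩ := hs
  let A : (ℂ × ℂ) ≃ₗ[ℂ] (ℂ × ℂ) :=
    { toFun := fun p => (p.1 + s * p.2, p.2)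
      map_add' := fun p q => by
        ext
        · simp
          ring
        · simp
      map_smul' := fun c p => by
        ext
        · simp
          ring
        · simp
      invFun := fun p => (p.1 - s * p.2, p.2)
      left_inv := fun p => by simp
      right_inv := fun p => by simp }
  obtain ⟨G, hG⟩ := exists_pushforward (n := n) A.toAffineEquiv
  have hG' : ∀ v q, (G v).field (A q) = A (v.field q) := hG
  have hequiv : ∀ v, AffEquiv v (G v) := fun v => ⟨A.toAffineEquiv, 1, fun q => by
    rw [hG]
    simp⟩
  refine ⟨G, hequiv, ?_, ?_⟩
  · rw [← infty_notMem_singInf_iff]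
    intro h
    have h' : ∀ q, v₀.field (A.toAffineEquiv.symm q) =
        (1 : ℂ) • A.toAffineEquiv.symm.linear ((G v₀).field q) := by
      intro q
      have := hG v₀ (A.toAffineEquiv.symm q)
      rw [AffineEquiv.apply_symm_apply] at this
      rw [this, one_smul]
      simp
    have h1 := (linInf_affine A.toAffineEquiv.symm one_ne_zero h' h).1
    apply hs1
    have h2 : slopeEquiv A.toAffineEquiv.symm.linear OnePoint.infty = slopeOf (-s, 1) := by
      show slopeOf (A.symm (0, 1)) = _
      have : A.symm (0, 1) = (-s, 1) := by
        rw [LinearEquiv.symm_apply_eq]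
        ext <;> simp [A]
      rw [this]
    rwa [h2] at h1
  · obtain ⟨O', -, hO', hOr', -, -⟩ := (hv₀.of_affEquiv (hequiv v₀)).exists_isNumbering
    refine ⟨O', fun j => A (Q j), ⟨hO', hOr', A.injective.comp hQ, ?_⟩, ?_⟩
    · ext q
      simp only [Set.mem_range]
      constructor
      · rintro ⟨j, rfl⟩
        have : v₀.field (Q j) = 0 := by
          have : Q j ∈ v₀.singFin := hQr ▸ Set.mem_range_self j
          exact this
        show (G v₀).field (A (Q j)) = 0
        rw [hG', this, map_zero]
      · intro hq
        have hq : (G v₀).field q = 0 := hq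
        have h1 := hG' v₀ (A.symm q)
        rw [LinearEquiv.apply_symm_apply, hq] at h1
        have h2 : A.symm q ∈ v₀.singFin := (LinearEquiv.map_eq_zero_iff A).1 h1.symm
        rw [← hQr] at h2
        obtain ⟨j, hj⟩ := h2
        exact ⟨j, by rw [hj, LinearEquiv.apply_symm_apply]⟩
    · intro i j hij
      by_contra hne
      exact hs2 ⟨i, j, hne, hij⟩

/-- The symmetric functions are rational near a field in general position. -/
theorem exists_coeff_bbPoly {v₀ : PlaneVF n} (hn : 1 ≤ n) (hv₀ : v₀.IsNondegenerate)
    (htop : v₀ (0, topExp n) ≠ 0) {O : Fin (n + 1) → OnePoint ℂ} {Q : Fin (n ^ 2) → ℂ × ℂ}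
    (hOQ : v₀.IsNumbering O Q) (hinj : Function.Injective fun j => (Q j).1) (k : ℕ) :
    (∃ a b : MvPolynomial (VFCoord n) ℂ, MvPolynomial.eval v₀ b ≠ 0 ∧ ∀ v : PlaneVF n,
      v.IsNondegenerate → MvPolynomial.eval v b ≠ 0 →
        v.bbPolyInf.coeff k = MvPolynomial.eval v a / MvPolynomial.eval v b) ∧
    (∃ a b : MvPolynomial (VFCoord n) ℂ, MvPolynomial.eval v₀ b ≠ 0 ∧ ∀ v : PlaneVF n,
      v.IsNondegenerate → MvPolynomial.eval v b ≠ 0 →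
        v.bbPolyFin.coeff k = MvPolynomial.eval v a / MvPolynomial.eval v b) := by
  have hmem : ∀ {v : PlaneVF n} {O : Fin (n + 1) → OnePoint ℂ} {Q : Fin (n ^ 2) → ℂ × ℂ},
      v.IsNumbering O Q → (∀ i, O i ∈ v.singInf) ∧ ∀ j, Q j ∈ v.singFin := fun h =>
    ⟨fun i => h.2.1 ▸ Set.mem_range_self i, fun j => h.2.2.2 ▸ Set.mem_range_self j⟩
  constructor
  · obtain ⟨w, hw, hOw, hw0⟩ := exists_coe_of_isNumbering hOQ htop
    obtain ⟨a, b, hb, h⟩ := exists_coeff_prod_bbIndex_linInf htop hw0 hw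
      (fun i => hOw i ▸ hv₀.2.2.1 _ ((hmem hOQ).1 i)) k
    refine ⟨a, b, hb, fun v hv hbv => ?_⟩
    obtain ⟨O', Q', hOQ'⟩ := hv.exists_isNumbering
    obtain ⟨htop', h⟩ := h v hbv
    obtain ⟨w', hw', hOw', hw0'⟩ := exists_coe_of_isNumbering hOQ' htop'
    rw [(bbPoly_eq_of_isNumbering hOQ').1, ← h w' hw' hw0'
      (fun i => hOw' i ▸ hv.2.2.1 _ ((hmem hOQ').1 i))]
    simp only [hOw']
  · obtain ⟨a, b, hb, h⟩ := exists_coeff_prod_bbIndex_linFin hn rfl (hmem hOQ).2 hinj hv₀.2.2.2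
      (Or.inl (totalDegree_poly_of_ne_zero htop)) k
    refine ⟨a, b, hb, fun v hv hbv => ?_⟩
    obtain ⟨O', Q', hOQ'⟩ := hv.exists_isNumbering
    rw [(bbPoly_eq_of_isNumbering hOQ').2, ← h v hbv Q' hOQ'.2.2.1 (hmem hOQ').2
      (fun j => hv.2.2.2 _ ((hmem hOQ').2 j))]

/-- Both polynomials are constant on orbits, so a rational expression valid near the sheared field
`G v₀` pulls back along the linear map `G` to one valid near `v₀`. One shear, chosen for `v₀`,
serves all `v` in the neighbourhood. -/
theorem isRegularFun_coeff_bbPoly (hn : 1 ≤ n) (k : ℕ) :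
    IsRegularFun (fun v : PlaneVF n => v.bbPolyInf.coeff k) ∧
    IsRegularFun (fun v : PlaneVF n => v.bbPolyFin.coeff k) := by
  constructor <;> intro v₀ hv₀ <;> obtain ⟨G, hG, htop, O, Q, hOQ, hinj⟩ := exists_shear hv₀
  · obtain ⟨⟨a, b, hb, h⟩, -⟩ :=
      exists_coeff_bbPoly hn (hv₀.of_affEquiv (hG v₀)) htop hOQ hinj k
    obtain ⟨a', ha'⟩ := exists_eval_comp_linear G a
    obtain ⟨b', hb'⟩ := exists_eval_comp_linear G b
    refine ⟨a', b', by rwa [hb'], fun v hv hbv => ?_⟩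
    rw [hb'] at hbv
    rw [ha', hb', ← h _ (hv.of_affEquiv (hG v)) hbv, ← (bbPoly_eq_of_affEquiv hv (hG v)).1]
  · obtain ⟨-, ⟨a, b, hb, h⟩⟩ :=
      exists_coeff_bbPoly hn (hv₀.of_affEquiv (hG v₀)) htop hOQ hinj k
    obtain ⟨a', ha'⟩ := exists_eval_comp_linear G a
    obtain ⟨b', hb'⟩ := exists_eval_comp_linear G b
    refine ⟨a', b', by rwa [hb'], fun v hv hbv => ?_⟩
    rw [hb'] at hbv
    rw [ha', hb', ← h _ (hv.of_affEquiv (hG v)) hbv, ← (bbPoly_eq_of_affEquiv hv (hG v)).2]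

end PlaneVF

/-! ### Persistence of zeros and generic nondegeneracy. -/

/-- A form of the implicit function theorem. -/
theorem exists_implicit_root {E G : Type*} [NormedAddCommGroup E] [NormedSpace ℂ E]
    [CompleteSpace E] [NormedAddCommGroup G] [NormedSpace ℂ G] [FiniteDimensional ℂ G]
    {F : E × G → G} (hF : ContDiff ℂ ⊤ F) {v₀ : E} {q₀ : G} (h₀ : F (v₀, q₀) = 0)
    (hd : LinearMap.det (fderiv ℂ (fun q => F (v₀, q)) q₀ : G →ₗ[ℂ] G) ≠ 0) :
    ∃ ψ : E → G, DifferentiableAt ℂ ψ v₀ ∧ ψ v₀ = q₀ ∧ (∀ᶠ v in 𝓝 v₀, F (v, ψ v) = 0) ∧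
      ∀ᶠ p in 𝓝 (v₀, q₀), F p = 0 → p.2 = ψ p.1 := by
  have : CompleteSpace G := FiniteDimensional.complete ℂ G
  have hs : HasStrictFDerivAt F (fderiv ℂ F (v₀, q₀)) (v₀, q₀) :=
    hF.contDiffAt.hasStrictFDerivAt (by simp)
  have hpart : fderiv ℂ (fun q => F (v₀, q)) q₀ =
      fderiv ℂ F (v₀, q₀) ∘L ContinuousLinearMap.inr ℂ E G := by
    have h1 : HasFDerivAt (fun q : G => (v₀, q)) (ContinuousLinearMap.inr ℂ E G) q₀ :=
      hasFDerivAt_prodMk_right v₀ q₀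
    have h2 := hs.hasFDerivAt.comp q₀ h1
    exact h2.fderiv
  have hinv : (fderiv ℂ F (v₀, q₀) ∘L ContinuousLinearMap.inr ℂ E G).IsInvertible := by
    rw [← hpart]
    refine ⟨(LinearEquiv.ofIsUnitDet (f := (fderiv ℂ (fun q => F (v₀, q)) q₀ : G →ₗ[ℂ] G))
      (v := Module.finBasis ℂ G) (v' := Module.finBasis ℂ G) ?_).toContinuousLinearEquiv, ?_⟩
    · rw [LinearMap.det_toMatrix]
      exact hd.isUnit
    · ext x
      rfl
  refine ⟨hs.implicitFunctionOfProdDomain hinv,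
    (hs.hasStrictFDerivAt_implicitFunctionOfProdDomain hinv).hasFDerivAt.differentiableAt,
    ?_, ?_, ?_⟩
  · exact (hs.eventually_apply_eq_iff_implicitFunctionOfProdDomain hinv).self_of_nhds.1 rfl
  · filter_upwards [hs.eventually_apply_implicitFunctionOfProdDomain hinv] with v hv
    rw [hv, h₀]
  · filter_upwards [hs.eventually_apply_eq_iff_implicitFunctionOfProdDomain hinv] with p hp h
    exact (hp.1 (h.trans h₀.symm)).symm

theorem exists_eq_prod_X_sub_C {N : ℕ} {R : Polynomial ℂ} (hR : R.Monic) (hN : R.natDegree = N) :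
    ∃ x : Fin N → ℂ, R = ∏ i, (Polynomial.X - Polynomial.C (x i)) := by
  have hs := IsAlgClosed.splits R
  have hc : R.roots.toList.length = N := by
    rw [Multiset.length_toList, ← hN, hs.natDegree_eq_card_roots]
  subst hc
  refine ⟨fun i => R.roots.toList.get i, ?_⟩
  have h1 := hs.eq_prod_roots_of_monic hR
  conv_lhs => rw [h1, ← Multiset.coe_toList R.roots, Multiset.map_coe, Multiset.prod_coe]
  rw [← List.prod_ofFn]
  congr 1
  refine List.ext_get (by simp) fun i h1 h2 => by simp

theorem injective_of_eval_derivative_ne_zero {N : ℕ} {x : Fin N → ℂ}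
    (h : ∀ k, (Polynomial.derivative (∏ i, (Polynomial.X - Polynomial.C (x i)))).eval (x k) ≠ 0) :
    Function.Injective x := by
  intro i j hij
  by_contra hne
  apply h i
  rw [← Finset.mul_prod_erase Finset.univ _ (Finset.mem_univ i),
    ← Finset.mul_prod_erase (Finset.univ.erase i) _
      (Finset.mem_erase.2 ⟨Ne.symm hne, Finset.mem_univ j⟩), hij]
  simp

theorem eval_derivative_prod_ne_zero {N : ℕ} {x : Fin N → ℂ} (hx : Function.Injective x)
    (k : Fin N) :
    (Polynomial.derivative (∏ i, (Polynomial.X - Polynomial.C (x i)))).eval (x k) ≠ 0 := by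
  rw [← Finset.mul_prod_erase Finset.univ _ (Finset.mem_univ k)]
  simp only [Polynomial.derivative_mul, Polynomial.derivative_sub, Polynomial.derivative_X,
    Polynomial.derivative_C, sub_zero, one_mul, Polynomial.eval_add, Polynomial.eval_mul,
    Polynomial.eval_sub, Polynomial.eval_X, Polynomial.eval_C, sub_self, zero_mul, add_zero,
    Polynomial.eval_prod]
  rw [Finset.prod_ne_zero_iff]
  intro j hj
  exact sub_ne_zero.2 fun h => (Finset.mem_erase.1 hj).1 (hx h).symm

/-- The identity principle: the numerator vanishes on a nonempty open set and so is the zero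
polynomial. It carries facts proved by analysis near one field to all fields with `b ≠ 0`. -/
theorem RatFun.eq_zero_of_eventually {n : ℕ} {b : MvPolynomial (VFCoord n) ℂ} {v₀ : PlaneVF n}
    (f : RatFun b)
    (h : ∀ᶠ v in 𝓝 v₀, ∃ hb : MvPolynomial.eval v b ≠ 0, RatFun.ev ⟨v, hb⟩ f = 0) : f = 0 := by
  obtain ⟨a, k, ha⟩ := RatFun.exists_num f
  have h0 : a = 0 := by
    refine PlaneVF.eq_zero_of_eventually_eval_eq_zero (v₀ := v₀) ?_
    filter_upwards [h] with v hv
    obtain ⟨hb, hv⟩ := hv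
    rw [ha] at hv
    exact (div_eq_zero_iff.1 hv).resolve_right (pow_ne_zero k hb)
  refine RatFun.ext_ev fun v => ?_
  rw [ha, h0]
  simp

namespace PlaneVF

variable {n : ℕ}

theorem continuous_eval (p : MvPolynomial (VFCoord n) ℂ) :
    Continuous fun v : PlaneVF n => MvPolynomial.eval v p := p.continuous_eval

/-- A nondegenerate zero depends holomorphically on the vector field. -/
theorem exists_implicit_zero {v₀ : PlaneVF n} {q₀ : ℂ × ℂ} (h₀ : v₀.field q₀ = 0)
    (hd : LinearMap.det (v₀.linFin q₀) ≠ 0) :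
    ∃ ψ : PlaneVF n → ℂ × ℂ, DifferentiableAt ℂ ψ v₀ ∧ ψ v₀ = q₀ ∧
      (∀ᶠ v : PlaneVF n in 𝓝 v₀, v.field (ψ v) = 0) ∧
      ∀ᶠ p : PlaneVF n × ℂ × ℂ in 𝓝 (v₀, q₀), p.1.field p.2 = 0 → p.2 = ψ p.1 :=
  exists_implicit_root (F := fun p : PlaneVF n × ℂ × ℂ => p.1.field p.2) contDiff_field h₀ hd

/-- Near a field with zeros of distinct abscissae, all zeros persist. -/
theorem Eliminants.eventually_map_R_eq_prod {N : ℕ} (E : Eliminants n N) {v₀ : PlaneVF n}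
    (hb : MvPolynomial.eval v₀ E.b ≠ 0) {q : Fin N → ℂ × ℂ} (hq : ∀ k, v₀.field (q k) = 0)
    (hinj : Function.Injective fun k => (q k).1)
    (hJ : ∀ k, LinearMap.det (v₀.linFin (q k)) ≠ 0) :
    ∀ᶠ v : PlaneVF n in 𝓝 v₀, ∃ (hb : MvPolynomial.eval v E.b ≠ 0) (q : Fin N → ℂ × ℂ),
      Function.Injective q ∧ (∀ k, v.field (q k) = 0) ∧
      E.R.map (RatFun.ev ⟨v, hb⟩) = ∏ i, (Polynomial.X - Polynomial.C (q i).1) := by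
  choose ψ hψd hψ0 hψz hψu using fun k => exists_implicit_zero (hq k) (hJ k)
  have h1 : ∀ᶠ v : PlaneVF n in 𝓝 v₀, MvPolynomial.eval v E.b ≠ 0 :=
    (continuous_eval E.b).continuousAt.eventually_ne hb
  have h2 : ∀ᶠ v : PlaneVF n in 𝓝 v₀, ∀ k, v.field (ψ k v) = 0 := Filter.eventually_all.2 hψz
  have h3 : ∀ᶠ v in 𝓝 v₀, ∀ i j, i ≠ j → (ψ i v) ≠ (ψ j v) := by
    refine Filter.eventually_all.2 fun i => Filter.eventually_all.2 fun j => ?_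
    by_cases hij : i = j
    · simp [hij]
    · have hne : ψ i v₀ ≠ ψ j v₀ := by
        rw [hψ0, hψ0]
        exact fun h => hij (hinj (congrArg Prod.fst h))
      filter_upwards [((hψd i).continuousAt.prodMk (hψd j).continuousAt).eventually
        (isOpen_ne_fun continuous_fst continuous_snd |>.mem_nhds hne)] with v hv _
      exact hv
  filter_upwards [h1, h2, h3] with v h1 h2 h3
  have hinj' : Function.Injective fun k => ψ k v := fun i j h => by
    by_contra hij
    exact h3 i j hij h
  exact ⟨h1, fun k => ψ k v, hinj', h2, E.map_R_eq_prod ⟨v, h1⟩ h2 hinj'⟩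

open Polynomial in
/-- The points `(x, Y(x))` over the roots `x` are zeros of the field. -/
theorem Eliminants.dvd_planeSum {N : ℕ} (E : Eliminants n N) {v₀ : PlaneVF n}
    (hb : MvPolynomial.eval v₀ E.b ≠ 0) {q : Fin N → ℂ × ℂ} (hq : ∀ k, v₀.field (q k) = 0)
    (hinj : Function.Injective fun k => (q k).1)
    (hJ : ∀ k, LinearMap.det (v₀.linFin (q k)) ≠ 0) (i : Fin 2) :
    E.R ∣ planeSum (univCoeff E.b) i X E.Y := by
  -- The coefficients of the remainder are rational functions of `v`. Near `v₀` the polynomial `R`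
  -- splits into linear factors over genuine zeros of the field, so the remainder vanishes there,
  -- and hence identically.
  rw [← modByMonic_eq_zero_iff_dvd E.monic_R]
  ext1 k
  rw [coeff_zero]
  refine RatFun.eq_zero_of_eventually (v₀ := v₀) _ ?_
  filter_upwards [E.eventually_map_R_eq_prod hb hq hinj hJ] with v hv
  obtain ⟨hb, q, hqinj, hq, hR⟩ := hv
  refine ⟨hb, ?_⟩
  rw [← coeff_map, map_modByMonic _ E.monic_R]
  have hdvd : E.R.map (RatFun.ev ⟨v, hb⟩) ∣
      (planeSum (univCoeff E.b) i X E.Y).map (RatFun.ev ⟨v, hb⟩) := by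
    rw [hR]
    have hi := E.injective_fst_of_zeros ⟨v, hb⟩ hq hqinj
    refine Finset.prod_dvd_of_coprime ?_ fun k _ => dvd_iff_isRoot.2 ?_
    · exact fun i _ j _ hij => isCoprime_X_sub_C_of_isUnit_sub
        (sub_ne_zero.2 fun h => hij (hi h)).isUnit
    · have h : ((planeSum (univCoeff E.b) i X E.Y).map (RatFun.ev ⟨v, hb⟩)).eval (q k).1 =
        E.evalAt ⟨v, hb⟩ (q k).1 (planeSum (univCoeff E.b) i X E.Y) := rfl
      rw [IsRoot.def, h, map_planeSum, E.evalAt_univCoeff]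
      have h1 : E.evalAt ⟨v, hb⟩ (q k).1 X = (q k).1 := by simp [Eliminants.evalAt]
      have h2 : E.evalAt ⟨v, hb⟩ (q k).1 E.Y = (q k).2 := E.eval_Y_eq ⟨v, hb⟩ (hq k)
      rw [h1, h2]
      have h3 := hq k
      rw [field_eq_planeSum] at h3
      fin_cases i
      · exact congrArg Prod.fst h3
      · exact congrArg Prod.snd h3
  rw [(modByMonic_eq_zero_iff_dvd (E.monic_R.map _)).2 hdvd, coeff_zero]

theorem _root_.hasDerivAt_mul_fst_add_mul_snd {a b : ℂ → ℂ} {F : ℂ → ℂ × ℂ} {t : ℂ}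
    (ha : DifferentiableAt ℂ a t) (hb : DifferentiableAt ℂ b t) (hF : HasDerivAt F 0 t)
    (h0 : F t = 0) : HasDerivAt (fun t => a t * (F t).1 + b t * (F t).2) 0 t := by
  have h1 : HasDerivAt (fun t => (F t).1) 0 t := hF.fst
  have h2 : HasDerivAt (fun t => (F t).2) 0 t := hF.snd
  refine ((ha.hasDerivAt.fun_mul h1).fun_add (hb.hasDerivAt.fun_mul h2)).congr_deriv ?_
  rw [h0]
  simp

theorem _root_.hasDerivAt_line (z u : ℂ × ℂ) (t : ℂ) : HasDerivAt (fun t : ℂ => z + t • u) u t :=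
  (((hasDerivAt_id' t).smul_const u).const_add z).congr_deriv (one_smul _ _)

/-- The derivative, in a direction of the kernel of the linearization at a zero, of an element of
the ideal of the components vanishes. -/
theorem hasDerivAt_ideal (v : PlaneVF n) {z u : ℂ × ℂ} (hz : v.field z = 0)
    (hu : fderiv ℂ v.field z u = 0) (A B : MvPolynomial (Fin 2) ℂ) :
    HasDerivAt (fun t : ℂ =>
      MvPolynomial.eval ![(z + t • u).1, (z + t • u).2] A * (v.field (z + t • u)).1 +
      MvPolynomial.eval ![(z + t • u).1, (z + t • u).2] B * (v.field (z + t • u)).2) 0 0 := by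
  have hl := hasDerivAt_line z u 0
  have hz0 : z + (0 : ℂ) • u = z := by rw [zero_smul, add_zero]
  have hA : ∀ A : MvPolynomial (Fin 2) ℂ, DifferentiableAt ℂ (fun t : ℂ =>
      MvPolynomial.eval ![(z + t • u).1, (z + t • u).2] A) 0 := fun A =>
    DifferentiableAt.comp (0 : ℂ) (g := fun q : ℂ × ℂ => MvPolynomial.eval ![q.1, q.2] A)
      (differentiable_eval_plane A _) hl.differentiableAt
  have hv : HasDerivAt (fun t : ℂ => v.field (z + t • u)) 0 0 := by
    have hf := (v.differentiable_field (z + (0 : ℂ) • u)).hasFDerivAt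
    have h := HasFDerivAt.comp_hasDerivAt (0 : ℂ) hf hl
    rw [hz0, hu] at h
    exact h
  exact hasDerivAt_mul_fst_add_mul_snd (hA A) (hA B) hv (by rw [hz0, hz])

open Polynomial in
/-- If the polynomial of the abscissae has simple roots, the zeros of the field are nondegenerate
and their number is the degree of the polynomial. -/
theorem Eliminants.singFin_of_simple_roots {N : ℕ} (E : Eliminants n N)
    (hdvd : ∀ i, E.R ∣ planeSum (univCoeff E.b) i X E.Y)
    (v : {v : PlaneVF n // MvPolynomial.eval v E.b ≠ 0}) {x : Fin N → ℂ}
    (hx : E.R.map (RatFun.ev v) = ∏ i, (X - C (x i)))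
    (hx' : ∀ i, ((derivative E.R).map (RatFun.ev v)).eval (x i) ≠ 0) :
    v.1.singFin.encard = (N : ℕ∞) ∧ ∀ q ∈ v.1.singFin, LinearMap.det (v.1.linFin q) ≠ 0 := by
  have hxinj : Function.Injective x := by
    refine injective_of_eval_derivative_ne_zero fun k => ?_
    rw [← hx, derivative_map]
    exact hx' k
  set q : Fin N → ℂ × ℂ := fun i => (x i, (E.Y.map (RatFun.ev v)).eval (x i)) with hq
  have hroot : ∀ i, (E.R.map (RatFun.ev v)).eval (x i) = 0 := by
    intro i
    rw [hx, eval_prod]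
    exact Finset.prod_eq_zero (Finset.mem_univ i) (by simp)
  have hmem : ∀ z ∈ v.1.singFin, ∃ i, z = q i := by
    intro z hz
    have h1 := E.eval_R_eq_zero v hz
    rw [hx, eval_prod, Finset.prod_eq_zero_iff] at h1
    obtain ⟨i, -, hi⟩ := h1
    have hi : z.1 = x i := by simpa [sub_eq_zero] using hi
    refine ⟨i, Prod.ext hi ?_⟩
    rw [← E.eval_Y_eq v hz, hi]
  have hS : v.1.singFin = Set.range q := by
    ext z
    constructor
    · intro hz
      obtain ⟨i, hi⟩ := hmem z hz
      exact ⟨i, hi.symm⟩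
    · rintro ⟨i, rfl⟩
      have key : ∀ s : Fin 2, planeSum v.1 s (x i) ((E.Y.map (RatFun.ev v)).eval (x i)) = 0 := by
        intro s
        have h : ((planeSum (univCoeff E.b) s X E.Y).map (RatFun.ev v)).eval (x i) =
          E.evalAt v (x i) (planeSum (univCoeff E.b) s X E.Y) := rfl
        rw [map_planeSum, E.evalAt_univCoeff] at h
        have h1 : E.evalAt v (x i) X = x i := by simp [Eliminants.evalAt]
        have h2 : E.evalAt v (x i) E.Y = (E.Y.map (RatFun.ev v)).eval (x i) := rfl
        rw [h1, h2] at h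
        rw [← h]
        obtain ⟨p, hp⟩ := hdvd s
        rw [hp, Polynomial.map_mul, eval_mul, hroot, zero_mul]
      show v.1.field (q i) = 0
      rw [field_eq_planeSum]
      exact Prod.ext (key 0) (key 1)
  constructor
  · have hqinj : Function.Injective q := fun i j h => hxinj (congrArg Prod.fst h)
    rw [hS, ← Set.image_univ, hqinj.encard_image, Set.encard_univ]
    simp
  · intro z hz hdet
    obtain ⟨i, hi⟩ := hmem z hz
    obtain ⟨A, B, A', B', hid⟩ := E.exists_identity v
    -- A kernel vector `u` of the linearization is annihilated by the differential of every element
    -- of the ideal. Applied to `R` this gives `R'(x) u₁ = 0`, so `u₁ = 0`; applied to `y - Y(x)` it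
    -- then gives `u₂ = 0`.
    obtain ⟨u, hu, hu0⟩ := (Submodule.ne_bot_iff _).1
      (ne_of_gt (LinearMap.bot_lt_ker_of_det_eq_zero hdet))
    have hu : fderiv ℂ v.1.field z u = 0 := hu
    have hz : v.1.field z = 0 := hz
    have hf := (v.1.differentiable_field z).hasFDerivAt
    have hl : HasDerivAt (fun t : ℂ => z + t • u) u 0 := by
      simpa using ((hasDerivAt_id (0 : ℂ)).smul_const u).const_add z
    have hz0 : z = z + (0 : ℂ) • u := by simp
    have hvanish := v.1.hasDerivAt_ideal hz hu
    have hx1 : HasDerivAt (fun t : ℂ => (z + t • u).1) u.1 0 := by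
      have := (hasFDerivAt_fst (𝕜 := ℂ) (p := z + (0 : ℂ) • u)).comp_hasDerivAt 0 hl
      exact this
    have hx2 : HasDerivAt (fun t : ℂ => (z + t • u).2) u.2 0 := by
      have := (hasFDerivAt_snd (𝕜 := ℂ) (p := z + (0 : ℂ) • u)).comp_hasDerivAt 0 hl
      exact this
    have hpoly : ∀ p : Polynomial ℂ, HasDerivAt (fun t : ℂ => p.eval (z + t • u).1)
        ((derivative p).eval z.1 * u.1) 0 := by
      intro p
      have h1 : HasDerivAt (fun w => p.eval w) ((derivative p).eval z.1)
          ((fun t : ℂ => (z + t • u).1) 0) := by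
        simpa using p.hasDerivAt z.1
      exact h1.comp 0 hx1
    have e1 : (derivative (E.R.map (RatFun.ev v))).eval z.1 * u.1 = 0 := by
      have h1 := hpoly (E.R.map (RatFun.ev v))
      simp only [(hid _).1] at h1
      exact h1.unique (hvanish A B)
    have hu1 : u.1 = 0 := by
      refine (mul_eq_zero.1 e1).resolve_left ?_
      have := hx' i
      rw [derivative_map, hi]
      exact this
    have e2 : u.2 - (derivative (E.Y.map (RatFun.ev v))).eval z.1 * u.1 = 0 := by
      have h1 := hx2.sub (hpoly (E.Y.map (RatFun.ev v)))
      have h2 : ((fun t : ℂ => (z + t • u).2) - fun t : ℂ =>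
          (E.Y.map (RatFun.ev v)).eval (z + t • u).1) = fun t : ℂ =>
        MvPolynomial.eval ![(z + t • u).1, (z + t • u).2] A' * (v.1.field (z + t • u)).1 +
        MvPolynomial.eval ![(z + t • u).1, (z + t • u).2] B' * (v.1.field (z + t • u)).2 := by
        funext t
        exact (hid (z + t • u)).2
      rw [h2] at h1
      exact h1.unique (hvanish A' B')
    rw [hu1, mul_zero, sub_zero] at e2
    exact hu0 (Prod.ext hu1 e2)

/-- The field `(y ^ n - 1) ∂/∂x + (x ^ n - y) ∂/∂y`. -/
theorem exists_field_distinct_abscissae (hn : 1 ≤ n) :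
    ∃ (v : PlaneVF n) (q : Fin (n ^ 2) → ℂ × ℂ), (∀ k, v.field (q k) = 0) ∧
      Function.Injective (fun k => (q k).1) ∧
      (∀ q, v.field q = 0 → LinearMap.det (v.linFin q) ≠ 0) ∧ (v.poly 0).totalDegree = n := by
  have h1 : IsPlanePoly n (fun q => q.2 ^ n + (-1)) :=
    (IsPlanePoly.snd.pow n).add (IsPlanePoly.const (-1))
  have h2 : IsPlanePoly n (fun q => q.1 ^ n + (-1) * q.2) :=
    (IsPlanePoly.fst.pow n).add ((IsPlanePoly.snd.mono hn).const_mul (-1))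
  obtain ⟨v, hv⟩ := exists_field_eq h1 h2
  have hN : n ^ 2 ≠ 0 := pow_ne_zero 2 (by omega)
  -- The equations say `y = x ^ n` and `y ^ n = 1`, so the abscissae are the roots of unity of order
  -- `n ^ 2`, all distinct.
  have hζ := Complex.isPrimitiveRoot_exp (n ^ 2) hN
  set ζ := Complex.exp (2 * Real.pi * Complex.I / ((n ^ 2 : ℕ) : ℂ))
  refine ⟨v, fun k => (ζ ^ (k : ℕ), (ζ ^ (k : ℕ)) ^ n), fun k => ?_, fun i j h => ?_,
    fun q hq => ?_, ?_⟩
  · rw [hv]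
    have : ((ζ ^ (k : ℕ)) ^ n) ^ n = 1 := by
      rw [← pow_mul, ← pow_mul, ← mul_assoc, mul_assoc, ← sq, mul_comm, pow_mul, hζ.pow_eq_one,
        one_pow]
    simp [this]
  · exact Fin.ext (hζ.pow_inj i.2 j.2 h)
  · rw [hv] at hq
    have hq1 : q.2 ^ n = 1 := by
      have := congrArg Prod.fst hq
      simp only [Prod.fst_zero] at this
      linear_combination this
    have hq2 : q.1 ^ n = q.2 := by
      have := congrArg Prod.snd hq
      simp only [Prod.snd_zero] at this
      linear_combination this
    have hy : q.2 ≠ 0 := by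
      intro h
      rw [h, zero_pow (by omega)] at hq1
      exact zero_ne_one hq1
    have hx : q.1 ≠ 0 := by
      intro h
      rw [h, zero_pow (by omega)] at hq2
      exact hy hq2.symm
    have hvf : v.field = fun q => (q.2 ^ n + (-1), q.1 ^ n + (-1) * q.2) := funext hv
    have d1 : v.linFin q (1, 0) = (0, n * q.1 ^ (n - 1)) := by
      refine fderiv_prod_apply_fst (v.differentiable_field q) ?_
      rw [hvf]
      show HasDerivAt (fun t : ℂ => (q.2 ^ n + (-1 : ℂ), t ^ n + (-1) * q.2)) _ _
      exact (hasDerivAt_const _ _).prodMk ((hasDerivAt_pow n q.1).add_const _)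
    have d2 : v.linFin q (0, 1) = (n * q.2 ^ (n - 1), -1) := by
      refine fderiv_prod_apply_snd (v.differentiable_field q) ?_
      rw [hvf]
      show HasDerivAt (fun t : ℂ => (t ^ n + (-1 : ℂ), q.1 ^ n + (-1) * t)) _ _
      have h : HasDerivAt (fun t : ℂ => q.1 ^ n + (-1) * t) (-1) q.2 :=
        (((hasDerivAt_id' q.2).const_mul (-1 : ℂ)).const_add (q.1 ^ n)).congr_deriv (by simp)
      exact ((hasDerivAt_pow n q.2).add_const _).prodMk h
    rw [prod_linearMap_det, d1, d2]
    have hn0 : (n : ℂ) ≠ 0 := by exact_mod_cast (by omega : n ≠ 0)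
    simp [hx, hy, hn0]
  · apply totalDegree_poly_of_ne_zero
    have hp : v.poly 0 = MvPolynomial.X 1 ^ n - 1 := planePoly_funext fun q => by
      rw [eval_poly_zero, hv]
      simp [sub_eq_add_neg]
    have hc : v (0, topExp n) = (v.poly 0).coeff (planeExpFinsupp (topExp n)) :=
      (coeff_planePoly (fun d => v (0, d)) (topExp n)).symm
    have he : planeExpFinsupp (topExp n) = Finsupp.single 1 n := by
      ext i
      fin_cases i
      · simp [planeExpFinsupp_zero, topExp]
      · simp [planeExpFinsupp_one, topExp]
    have hne : (0 : Fin 2 →₀ ℕ) ≠ Finsupp.single 1 n := by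
      intro h
      have := DFunLike.congr_fun h 1
      simp at this
      omega
    rw [hc, hp, he, MvPolynomial.coeff_sub, MvPolynomial.coeff_X_pow, if_pos rfl,
      MvPolynomial.coeff_one, if_neg hne, sub_zero]
    exact one_ne_zero

-- The denominator of the eliminants times the numerator of the discriminant of `R` is a polynomial
-- in `v`. It is nonzero because the roots of `R` at the model field are distinct, and off its zero
-- set `R` has only simple roots.
open Polynomial in
theorem forGeneric_singFin (hn : 1 ≤ n) : ForGeneric fun v : PlaneVF n =>
    v.singFin.encard = ((n ^ 2 : ℕ) : ℕ∞) ∧ ∀ q ∈ v.singFin, LinearMap.det (v.linFin q) ≠ 0 := by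
  obtain ⟨v₀, q, hq, hinj, hJ, hdeg⟩ := exists_field_distinct_abscissae hn
  obtain ⟨E, hb⟩ := exists_eliminants' hn rfl hq hinj hJ (Or.inl hdeg)
  have hdvd := E.dvd_planeSum hb hq hinj fun k => hJ _ (hq k)
  set δ := resultant E.R (derivative E.R)
  obtain ⟨a, k, ha⟩ := RatFun.exists_num δ
  have hδ : ∀ (v : {v : PlaneVF n // MvPolynomial.eval v E.b ≠ 0}) (x : Fin (n ^ 2) → ℂ),
      E.R.map (RatFun.ev v) = ∏ i, (X - C (x i)) →
      RatFun.ev v δ = ∏ i, ((derivative E.R).map (RatFun.ev v)).eval (x i) := fun v x hx =>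
    resultant_map_eq_prod (RatFun.ev v) E.monic_R (derivative E.R) hx
  refine ⟨E.b * a, mul_ne_zero (fun h => hb (by simp [h])) ?_, fun v hv => ?_⟩
  · rintro rfl
    have hR := E.map_R_eq_prod ⟨v₀, hb⟩ hq fun i j h => hinj (congrArg Prod.fst h)
    have h1 := hδ ⟨v₀, hb⟩ _ hR
    rw [ha, map_zero, zero_div] at h1
    refine Finset.prod_ne_zero_iff.2 (fun i _ => ?_) h1.symm
    rw [← derivative_map, hR]
    exact eval_derivative_prod_ne_zero hinj i
  · rw [map_mul] at hv
    have hbv := left_ne_zero_of_mul hv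
    obtain ⟨x, hx⟩ := exists_eq_prod_X_sub_C (E.monic_R.map (RatFun.ev ⟨v, hbv⟩))
      (E.natDegree_map_R ⟨v, hbv⟩)
    refine E.singFin_of_simple_roots hdvd ⟨v, hbv⟩ hx fun i => ?_
    have h1 := hδ ⟨v, hbv⟩ x hx
    rw [ha] at h1
    have h2 : MvPolynomial.eval v a / MvPolynomial.eval v E.b ^ k ≠ 0 :=
      div_ne_zero (right_ne_zero_of_mul hv) (pow_ne_zero k hbv)
    rw [h1] at h2
    exact Finset.prod_ne_zero_iff.1 h2 i (Finset.mem_univ i)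

/-- The field `y ^ n ∂/∂x + x ^ n ∂/∂y`. -/
theorem exists_field_simple_infinity (n : ℕ) : ∃ v : PlaneVF n, v (0, topExp n) = 1 ∧
    ∀ w, v.homogenized 0 1 w 0 = w ^ n ∧ v.homogenized 1 1 w 0 = 1 := by
  let xTop : PlaneExp n := ⟨(Fin.last n, 0), by simp⟩
  refine ⟨fun c => if c.1 = 0 then (if c.2 = topExp n then 1 else 0)
    else (if c.2 = xTop then 1 else 0), by simp, fun w => ⟨?_, ?_⟩⟩
  · rw [homogenized, Finset.sum_eq_single (topExp n) (fun d _ hd => by simp [hd]) (by simp)]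
    simp [topExp]
  · rw [homogenized, Finset.sum_eq_single xTop (fun d _ hd => by simp [hd]) (by simp)]
    simp [xTop]

open Polynomial in
/-- The discriminant of the singular points at infinity. -/
theorem exists_discriminant_singInf (n : ℕ) : ∃ D : MvPolynomial (VFCoord n) ℂ,
    (∀ v : PlaneVF n, MvPolynomial.eval v D ≠ 0 →
      v (0, topExp n) ≠ 0 ∧ v.singInf.encard = ((n + 1 : ℕ) : ℕ∞) ∧
        ∀ o ∈ v.singInf, LinearMap.det (v.linInf o) ≠ 0) ∧
    ∀ v : PlaneVF n, v (0, topExp n) ≠ 0 →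
      (∀ w, v.infFun w = 0 → LinearMap.det (v.linInf (w : OnePoint ℂ)) ≠ 0) →
        MvPolynomial.eval v D ≠ 0 := by
  set b := infDenom n with hbdef
  set P := planeSumTop (univCoeff b) 0 X
  set D := derivative (univInf b)
  -- Up to sign `P * D` is the determinant of the linearization. The factor `D` detects multiple
  -- roots, so nonvanishing of `δ` gives both the number of singular points and their nondegeneracy.
  set δ := resultant (infMonic n) (P * D)
  obtain ⟨a, k, ha⟩ := RatFun.exists_num δ
  have hδ : ∀ (v : {v : PlaneVF n // MvPolynomial.eval v b ≠ 0}) (w : Fin (n + 1) → ℂ),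
      (infMonic n).map (RatFun.ev v) = ∏ i, (X - C (w i)) →
      RatFun.ev v δ = ∏ i, (v.1.homogenized 0 1 (w i) 0 * deriv v.1.infFun (w i)) := by
    intro v w hw
    rw [resultant_map_eq_prod (RatFun.ev v) monic_infMonic (P * D) hw]
    refine Finset.prod_congr rfl fun i _ => ?_
    rw [Polynomial.map_mul, eval_mul, eval_univTop, eval_derivative_univInf]
  refine ⟨b * a, fun v hv => ?_, fun v h0 hdet => ?_⟩
  · rw [map_mul] at hv
    have hbv := left_ne_zero_of_mul hv
    have hv0 : v (0, topExp n) ≠ 0 := by rwa [hbdef, eval_infDenom] at hbv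
    obtain ⟨w, hw⟩ := exists_eq_prod_X_sub_C (monic_infMonic.map (RatFun.ev ⟨v, hbv⟩))
      (natDegree_map_infMonic ⟨v, hbv⟩)
    have h1 := hδ ⟨v, hbv⟩ w hw
    rw [ha] at h1
    have h2 : MvPolynomial.eval v a / MvPolynomial.eval v b ^ k ≠ 0 :=
      div_ne_zero (right_ne_zero_of_mul hv) (pow_ne_zero k hbv)
    rw [h1] at h2
    have h3 := fun i => Finset.prod_ne_zero_iff.1 h2 i (Finset.mem_univ i)
    have hwinj : Function.Injective w := by
      refine injective_of_eval_derivative_ne_zero fun i => ?_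
      rw [← hw, infMonic, Polynomial.map_mul, map_C, derivative_C_mul, eval_mul, eval_C,
        derivative_map, eval_derivative_univInf]
      refine mul_ne_zero ?_ (right_ne_zero_of_mul (h3 i))
      rw [RatFun.ev_mk]
      exact div_ne_zero (by simp) (pow_ne_zero _ hbv)
    have hroots : ∀ z, v.infFun z = 0 ↔ ∃ i, z = w i := by
      intro z
      have h4 := eval_infMonic ⟨v, hbv⟩ z
      have h5 : -(v (0, topExp n))⁻¹ ≠ 0 := neg_ne_zero.2 (inv_ne_zero hv0)
      rw [hw, eval_prod] at h4
      constructor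
      · intro hz
        rw [hz, mul_zero, Finset.prod_eq_zero_iff] at h4
        obtain ⟨i, -, hi⟩ := h4
        exact ⟨i, by simpa [sub_eq_zero] using hi⟩
      · rintro ⟨i, rfl⟩
        rw [Finset.prod_eq_zero (Finset.mem_univ i) (by simp)] at h4
        exact (mul_eq_zero.1 h4.symm).resolve_left h5
    have hS : v.singInf = Set.range fun i => (w i : OnePoint ℂ) := by
      ext o
      induction o using OnePoint.rec with
      | infty =>
        have := v.infty_notMem_singInf_iff.2 hv0
        simp [this]
      | coe z =>
        rw [coe_mem_singInf_iff, hroots]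
        simp [eq_comm]
    refine ⟨hv0, ?_, ?_⟩
    · have hinj : Function.Injective fun i => (w i : OnePoint ℂ) :=
        OnePoint.coe_injective.comp hwinj
      rw [hS, ← Set.image_univ, hinj.encard_image, Set.encard_univ]
      simp
    · rw [hS]
      rintro _ ⟨i, rfl⟩
      rw [det_linInf_coe]
      exact neg_ne_zero.2 (h3 i)
  · have hb : MvPolynomial.eval v b ≠ 0 := by
      rw [hbdef, eval_infDenom]
      exact h0
    rw [map_mul]
    refine mul_ne_zero hb fun ha0 => ?_
    obtain ⟨w, hw⟩ := exists_eq_prod_X_sub_C (monic_infMonic.map (RatFun.ev ⟨v, hb⟩))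
      (natDegree_map_infMonic ⟨v, hb⟩)
    have h1 := hδ ⟨v, hb⟩ w hw
    rw [ha, ha0, zero_div] at h1
    refine Finset.prod_ne_zero_iff.2 (fun i _ => ?_) h1.symm
    have hroot : v.infFun (w i) = 0 := by
      have h2 := eval_infMonic ⟨v, hb⟩ (w i)
      have h3 : ((infMonic n).map (RatFun.ev ⟨v, hb⟩)).eval (w i) = 0 := by
        rw [hw, eval_prod]
        exact Finset.prod_eq_zero (Finset.mem_univ i) (by simp)
      rw [h3] at h2
      exact (mul_eq_zero.1 h2.symm).resolve_left (neg_ne_zero.2 (inv_ne_zero h0))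
    have h4 := hdet _ hroot
    rw [det_linInf_coe] at h4
    exact neg_ne_zero.1 h4

/-- For `y ^ n ∂/∂x + x ^ n ∂/∂y` the polynomial at infinity is `1 - w ^ (n + 1)`. Its roots are
simple and nonzero, so neither factor of the determinant vanishes and the discriminant is a nonzero
polynomial. -/
theorem forGeneric_singInf : ForGeneric fun v : PlaneVF n =>
    v (0, topExp n) ≠ 0 ∧ v.singInf.encard = ((n + 1 : ℕ) : ℕ∞) ∧
      ∀ o ∈ v.singInf, LinearMap.det (v.linInf o) ≠ 0 := by
  obtain ⟨D, h1, h2⟩ := exists_discriminant_singInf n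
  obtain ⟨v, h0, hhom⟩ := exists_field_simple_infinity n
  have hD : MvPolynomial.eval v D ≠ 0 := by
    refine h2 v (h0 ▸ one_ne_zero) fun w hroot => ?_
    have hinf : v.infFun = fun w => 1 - w ^ (n + 1) := by
      funext w
      rw [infFun, (hhom w).1, (hhom w).2, pow_succ']
    have hw : w ≠ 0 := by
      rintro rfl
      rw [hinf] at hroot
      simp at hroot
    have hd : deriv v.infFun w = -((n + 1 : ℕ) * w ^ n) := by
      rw [hinf]
      exact ((hasDerivAt_pow (n + 1) w).const_sub 1).deriv
    rw [det_linInf_coe, (hhom _).1, hd]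
    have hn1 : ((n + 1 : ℕ) : ℂ) ≠ 0 := by exact_mod_cast Nat.succ_ne_zero n
    exact neg_ne_zero.2
      (mul_ne_zero (pow_ne_zero n hw) (neg_ne_zero.2 (mul_ne_zero hn1 (pow_ne_zero n hw))))
  exact ⟨D, fun h => hD (by rw [h, map_zero]), h1⟩

/-- Nondegeneracy is an open condition. -/
theorem IsNondegenerate.eventually (hn : 1 ≤ n) {v₀ : PlaneVF n} (hv₀ : v₀.IsNondegenerate)
    (htop : v₀ (0, topExp n) ≠ 0) {q : Fin (n ^ 2) → ℂ × ℂ} (hq : ∀ k, v₀.field (q k) = 0)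
    (hinj : Function.Injective fun k => (q k).1) : ∀ᶠ v : PlaneVF n in 𝓝 v₀, v.IsNondegenerate := by
  obtain ⟨D, h1, h2⟩ := exists_discriminant_singInf n
  have hD := h2 v₀ htop fun w hw => hv₀.2.2.1 _ ((v₀.coe_mem_singInf_iff w).2 hw)
  obtain ⟨E, hb⟩ := exists_eliminants' hn rfl hq hinj hv₀.2.2.2
    (Or.inl (totalDegree_poly_of_ne_zero htop))
  have hJ := fun k => hv₀.2.2.2 _ (hq k)
  filter_upwards [(continuous_eval D).continuousAt.eventually_ne hD,
    E.eventually_map_R_eq_prod hb hq hinj hJ] with v hvD ⟨hbv, x, hxinj, hx, hR⟩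
  have h3 := h1 v hvD
  have h4 := E.singFin_of_simple_roots (E.dvd_planeSum hb hq hinj hJ) ⟨v, hbv⟩ hR fun i => by
    rw [← Polynomial.derivative_map, hR]
    exact eval_derivative_prod_ne_zero (E.injective_fst_of_zeros ⟨v, hbv⟩ hx hxinj) i
  exact ⟨h3.2.1, h4.1, h3.2.2, h4.2⟩

theorem forGeneric_isNondegenerate (hn : 1 ≤ n) : ForGeneric fun v : PlaneVF n =>
    v.IsNondegenerate ∧ v (0, topExp n) ≠ 0 :=
  ((forGeneric_singFin hn).and forGeneric_singInf).mono fun _ h =>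
    ⟨⟨h.2.2.1, h.1.1, h.2.2.2, h.1.2⟩, h.2.1⟩

end PlaneVF

/-! ### Holomorphic branches of the moduli map. -/

theorem ContDiff.differentiableAt_comp {E F G : Type*} [NormedAddCommGroup E] [NormedSpace ℂ E]
    [NormedAddCommGroup F] [NormedSpace ℂ F] [NormedAddCommGroup G] [NormedSpace ℂ G] {g : F → G}
    {f : E → F} {x : E} (hg : ContDiff ℂ ⊤ g) (hf : DifferentiableAt ℂ f x) :
    DifferentiableAt ℂ (fun x => g (f x)) x :=
  (hg.differentiable (by simp) (f x)).comp x hf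

namespace PlaneVF

variable {n : ℕ}

/-- Joint smoothness in the field and the point: the derivative in the point is the total derivative
applied to `(0, e)`. -/
theorem contDiff_fderiv_field (e : ℂ × ℂ) :
    ContDiff ℂ ⊤ fun p : PlaneVF n × ℂ × ℂ => fderiv ℂ p.1.field p.2 e := by
  have h : (fun p : PlaneVF n × ℂ × ℂ => fderiv ℂ p.1.field p.2 e) = fun p =>
      fderiv ℂ (fun p : PlaneVF n × ℂ × ℂ => p.1.field p.2) p (0, e) := by
    funext p
    have h1 : HasFDerivAt (fun q : ℂ × ℂ => (p.1, q))
        (ContinuousLinearMap.inr ℂ (PlaneVF n) (ℂ × ℂ)) p.2 := hasFDerivAt_prodMk_right p.1 p.2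
    have h2 : HasFDerivAt (fun p : PlaneVF n × ℂ × ℂ => p.1.field p.2) _ (p.1, p.2) :=
      ((contDiff_field (n := n)).differentiable (by simp) p).hasFDerivAt
    have h3 : fderiv ℂ p.1.field p.2 = _ := (h2.comp p.2 h1).fderiv
    rw [h3]
    rfl
  rw [h]
  exact (contDiff_field.fderiv_right (m := ⊤) (by simp)).clm_apply contDiff_const

theorem contDiff_infFun : ContDiff ℂ ⊤ fun p : PlaneVF n × ℂ => p.1.infFun p.2 := by
  unfold infFun homogenized
  fun_prop

theorem contDiff_deriv_infFun : ContDiff ℂ ⊤ fun p : PlaneVF n × ℂ => deriv p.1.infFun p.2 := by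
  have h : (fun p : PlaneVF n × ℂ => deriv p.1.infFun p.2) = fun p =>
      fderiv ℂ (fun p : PlaneVF n × ℂ => p.1.infFun p.2) p (0, 1) := by
    funext p
    have h1 : HasFDerivAt (fun q : ℂ => (p.1, q))
        (ContinuousLinearMap.inr ℂ (PlaneVF n) ℂ) p.2 := hasFDerivAt_prodMk_right p.1 p.2
    have h2 : HasFDerivAt (fun p : PlaneVF n × ℂ => p.1.infFun p.2) _ (p.1, p.2) :=
      ((contDiff_infFun (n := n)).differentiable (by simp) p).hasFDerivAt
    have h3 : fderiv ℂ p.1.infFun p.2 = _ := (h2.comp p.2 h1).fderiv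
    rw [← fderiv_apply_one_eq_deriv, h3]
    rfl
  rw [h]
  exact (contDiff_infFun.fderiv_right (m := ⊤) (by simp)).clm_apply contDiff_const

theorem differentiableAt_bbIndex_linFin {v₀ : PlaneVF n} {ψ : PlaneVF n → ℂ × ℂ}
    (hψ : DifferentiableAt ℂ ψ v₀) (hd : LinearMap.det (v₀.linFin (ψ v₀)) ≠ 0) :
    DifferentiableAt ℂ (fun v : PlaneVF n => bbIndex (v.linFin (ψ v))) v₀ := by
  have h : ∀ e : ℂ × ℂ, DifferentiableAt ℂ (fun v : PlaneVF n => v.linFin (ψ v) e) v₀ := fun e =>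
    (contDiff_fderiv_field (n := n) e).differentiableAt_comp (f := fun v => (v, ψ v))
      (differentiableAt_id.prodMk hψ)
  have htr : DifferentiableAt ℂ
      (fun v : PlaneVF n => LinearMap.trace ℂ (ℂ × ℂ) (v.linFin (ψ v))) v₀ := by
    simp only [prod_linearMap_trace]
    exact (h _).fst.add (h _).snd
  have hdet : DifferentiableAt ℂ (fun v : PlaneVF n => LinearMap.det (v.linFin (ψ v))) v₀ := by
    simp only [prod_linearMap_det]
    exact ((h _).fst.mul (h _).snd).sub ((h _).fst.mul (h _).snd)
  simp only [bbIndex, div_eq_mul_inv]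
  refine DifferentiableAt.sub_const ((htr.fun_pow 2).fun_mul (hdet.fun_inv ?_)) 2
  exact hd

theorem differentiableAt_bbIndex_linInf {v₀ : PlaneVF n} {φ : PlaneVF n → ℂ}
    (hφ : DifferentiableAt ℂ φ v₀) (hd : LinearMap.det (v₀.linInf (φ v₀ : OnePoint ℂ)) ≠ 0) :
    DifferentiableAt ℂ (fun v : PlaneVF n => bbIndex (v.linInf (φ v : OnePoint ℂ))) v₀ := by
  have h1 : DifferentiableAt ℂ (fun v : PlaneVF n => deriv v.infFun (φ v)) v₀ :=
    (contDiff_deriv_infFun (n := n)).differentiableAt_comp (f := fun v => (v, φ v))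
      (differentiableAt_id.prodMk hφ)
  have h2 : DifferentiableAt ℂ (fun v : PlaneVF n => v.homogenized 0 1 (φ v) 0) v₀ :=
    (contDiff_homogenized (n := n) 0).differentiableAt_comp
      (f := fun v : PlaneVF n => (v, (1 : ℂ), φ v, (0 : ℂ)))
      (differentiableAt_id.prodMk ((differentiableAt_const _).prodMk
        (hφ.prodMk (differentiableAt_const _))))
  simp only [bbIndex_linInf_coe, div_eq_mul_inv]
  rw [det_linInf_coe] at hd
  refine DifferentiableAt.sub_const
    (((h1.fun_sub h2).fun_pow 2).fun_mul ((h2.fun_mul h1).fun_neg.fun_inv ?_)) 2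
  exact hd

/-- The functions `w` and `q` number the slopes of the singular points at infinity and the zeros of
all fields near `v₀`, holomorphically at `v₀`. -/
structure IsLocalBranch (v₀ : PlaneVF n) (w : PlaneVF n → Fin (n + 1) → ℂ)
    (q : PlaneVF n → Fin (n ^ 2) → ℂ × ℂ) : Prop where
  differentiableAt_slope : ∀ i, DifferentiableAt ℂ (fun v => w v i) v₀
  differentiableAt_zero : ∀ j, DifferentiableAt ℂ (fun v => q v j) v₀
  slope_unique : ∀ i, ∀ᶠ p : PlaneVF n × ℂ in 𝓝 (v₀, w v₀ i),
    p.1.infFun p.2 = 0 → p.2 = w p.1 i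
  zero_unique : ∀ j, ∀ᶠ p : PlaneVF n × ℂ × ℂ in 𝓝 (v₀, q v₀ j), p.1.field p.2 = 0 → p.2 = q p.1 j
  isNumbering : ∀ᶠ v : PlaneVF n in 𝓝 v₀, v.IsNumbering (fun i => (w v i : OnePoint ℂ)) (q v)

theorem eventually_injective {X Y : Type*} [TopologicalSpace X] [TopologicalSpace Y] [T2Space Y]
    {m : ℕ} {ψ : X → Fin m → Y} {x : X} (hc : ∀ i, ContinuousAt (fun v => ψ v i) x)
    (hinj : Function.Injective (ψ x)) : ∀ᶠ v in 𝓝 x, Function.Injective (ψ v) := by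
  have h : ∀ᶠ v in 𝓝 x, ∀ i j, i ≠ j → ψ v i ≠ ψ v j := by
    refine Filter.eventually_all.2 fun i => Filter.eventually_all.2 fun j => ?_
    by_cases hij : i = j
    · simp [hij]
    · filter_upwards [((hc i).prodMk (hc j)).eventually
        (isOpen_ne_fun continuous_fst continuous_snd |>.mem_nhds fun h => hij (hinj h))] with v hv _
      exact hv
  filter_upwards [h] with v hv i j hij
  by_contra hne
  exact hv i j hne hij

theorem range_eq_of_encard {α : Type*} {m : ℕ} {f : Fin m → α} (hf : Function.Injective f)
    {s : Set α} (hs : s.encard = (m : ℕ∞)) (hfs : ∀ i, f i ∈ s) : Set.range f = s := by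
  refine Set.Finite.eq_of_subset_of_encard_le (Set.finite_range f) (Set.range_subset_iff.2 hfs) ?_
  rw [← Set.image_univ, hf.encard_image, Set.encard_univ, hs]
  simp

/-- Near a nondegenerate field all singular points are given by implicit functions. -/
theorem exists_isLocalBranch {v₀ : PlaneVF n} (hnd : ∀ᶠ v : PlaneVF n in 𝓝 v₀, v.IsNondegenerate)
    {w₀ : Fin (n + 1) → ℂ} {q₀ : Fin (n ^ 2) → ℂ × ℂ}
    (h : v₀.IsNumbering (fun i => (w₀ i : OnePoint ℂ)) q₀) :
    ∃ w q, IsLocalBranch v₀ w q ∧ w v₀ = w₀ ∧ q v₀ = q₀ := by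
  obtain ⟨hOinj, hO, hQinj, hQ⟩ := h
  have hnd₀ := hnd.self_of_nhds
  have hw₀ : ∀ i, (w₀ i : OnePoint ℂ) ∈ v₀.singInf := fun i => hO ▸ Set.mem_range_self i
  have hq₀ : ∀ j, q₀ j ∈ v₀.singFin := fun j => hQ ▸ Set.mem_range_self j
  -- The derivative of `infFun` is the eigenvalue along the line at infinity, a factor of the
  -- determinant; nondegeneracy makes each root simple.
  have hderiv : ∀ i, deriv v₀.infFun (w₀ i) ≠ 0 := by
    intro i
    have h1 := hnd₀.2.2.1 _ (hw₀ i)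
    rw [det_linInf_coe] at h1
    exact right_ne_zero_of_mul (neg_ne_zero.1 h1)
  choose φ hφd hφ0 hφz hφu using fun i => exists_implicit_root (contDiff_infFun (n := n))
    ((v₀.coe_mem_singInf_iff _).1 (hw₀ i)) (by
      rw [LinearMap.det_ring]
      exact hderiv i)
  choose ψ hψd hψ0 hψz hψu using fun j => exists_implicit_zero (hq₀ j) (hnd₀.2.2.2 _ (hq₀ j))
  have e1 : (fun i => φ i v₀) = w₀ := funext hφ0
  have e2 : (fun j => ψ j v₀) = q₀ := funext hψ0
  refine ⟨fun v i => φ i v, fun v j => ψ j v, ⟨hφd, hψd, fun i => ?_, fun j => ?_, ?_⟩, e1, e2⟩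
  · simp only [hφ0]
    exact hφu i
  · simp only [hψ0]
    exact hψu j
  · have h1 := eventually_injective (x := v₀) (ψ := fun v i => φ i v)
      (fun i => (hφd i).continuousAt) (by
        rw [e1]
        exact fun i j hij => hOinj (congrArg _ hij))
    have h2 := eventually_injective (x := v₀) (ψ := fun v j => ψ j v)
      (fun i => (hψd i).continuousAt) (by
        rw [e2]
        exact hQinj)
    filter_upwards [h1, h2, hnd, Filter.eventually_all.2 hφz, Filter.eventually_all.2 hψz] with
      v h1 h2 hv hz hz'
    have h1' : Function.Injective fun i => (φ i v : OnePoint ℂ) := OnePoint.coe_injective.comp h1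
    exact ⟨h1', range_eq_of_encard h1' hv.1 fun i => (v.coe_mem_singInf_iff _).2 (hz i), h2,
      range_eq_of_encard h2 hv.2.1 hz'⟩

namespace IsLocalBranch

variable {v₀ : PlaneVF n} {w : PlaneVF n → Fin (n + 1) → ℂ} {q : PlaneVF n → Fin (n ^ 2) → ℂ × ℂ}

theorem isLocalNumbering (h : IsLocalBranch v₀ w q) :
    v₀.IsLocalNumbering (fun v i => (w v i : OnePoint ℂ)) q := by
  refine ⟨h.isNumbering, continuousAt_pi.2 fun i => ?_,
    continuousAt_pi.2 fun j => (h.differentiableAt_zero j).continuousAt⟩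
  exact OnePoint.continuous_coe.continuousAt.comp (h.differentiableAt_slope i).continuousAt

/-- Any numbering which is continuous at `v₀` coincides with the holomorphic one. -/
theorem eventually_eq (h : IsLocalBranch v₀ w q) {O : PlaneVF n → Fin (n + 1) → OnePoint ℂ}
    {Q : PlaneVF n → Fin (n ^ 2) → ℂ × ℂ} (hOQ : v₀.IsLocalNumbering O Q)
    (hO : ∀ i, O v₀ i = (w v₀ i : OnePoint ℂ)) (hQ : Q v₀ = q v₀) :
    ∀ᶠ v in 𝓝 v₀, O v = (fun i => (w v i : OnePoint ℂ)) ∧ Q v = q v := by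
  obtain ⟨hnum, hOc, hQc⟩ := hOQ
  have h1 : ∀ i, ∀ᶠ v : PlaneVF n in 𝓝 v₀, O v i ∈ v.singInf → O v i = (w v i : OnePoint ℂ) := by
    intro i
    have h2 : Filter.Tendsto (fun v => (v, O v i)) (𝓝 v₀)
        (Filter.map (fun p : PlaneVF n × ℂ => (p.1, (p.2 : OnePoint ℂ))) (𝓝 (v₀, w v₀ i))) := by
      -- A neighbourhood of a finite point of `OnePoint ℂ` comes from one in `ℂ`, so local
      -- uniqueness of the root `w` transfers to any continuous numbering by points of `OnePoint ℂ`.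
      have h3 : Filter.map (fun p : PlaneVF n × ℂ => (p.1, (p.2 : OnePoint ℂ))) (𝓝 (v₀, w v₀ i)) =
          𝓝 v₀ ×ˢ 𝓝 (O v₀ i) := by
        rw [hO, ← OnePoint.isOpenEmbedding_coe.map_nhds_eq, nhds_prod_eq]
        exact (Filter.prod_map_map_eq (m₁ := id)).symm.trans (by rw [Filter.map_id])
      rw [h3]
      exact Filter.tendsto_id.prodMk (continuousAt_pi.1 hOc i)
    have h4 : ∀ᶠ p : PlaneVF n × OnePoint ℂ in
        Filter.map (fun p : PlaneVF n × ℂ => (p.1, (p.2 : OnePoint ℂ))) (𝓝 (v₀, w v₀ i)),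
        p.2 ∈ p.1.singInf → p.2 = (w p.1 i : OnePoint ℂ) := by
      rw [Filter.eventually_map]
      filter_upwards [h.slope_unique i] with p hp hmem
      rw [← hp ((coe_mem_singInf_iff _ _).1 hmem)]
    exact h2.eventually h4
  have h2 : ∀ j, ∀ᶠ v : PlaneVF n in 𝓝 v₀, v.field (Q v j) = 0 → Q v j = q v j := by
    intro j
    have h3 : Filter.Tendsto (fun v => (v, Q v j)) (𝓝 v₀) (𝓝 (v₀, q v₀ j)) := by
      rw [← hQ]
      exact (continuousAt_id.prodMk (continuousAt_pi.1 hQc j) :)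
    exact h3.eventually (h.zero_unique j)
  filter_upwards [hnum, Filter.eventually_all.2 h1, Filter.eventually_all.2 h2] with v hv h1 h2
  refine ⟨funext fun i => h1 i ?_, funext fun j => h2 j ?_⟩
  · exact hv.2.1 ▸ Set.mem_range_self i
  · have : Q v j ∈ v.singFin := hv.2.2.2 ▸ Set.mem_range_self j
    exact this

theorem differentiableAt_bbTuple (h : IsLocalBranch v₀ w q) (hnd : v₀.IsNondegenerate) :
    DifferentiableAt ℂ
      (fun v : PlaneVF n => v.bbTuple (fun i => (w v i : OnePoint ℂ)) (q v)) v₀ := by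
  have hnum := h.isNumbering.self_of_nhds
  refine differentiableAt_pi.2 fun k => ?_
  cases k with
  | inl i =>
    exact differentiableAt_bbIndex_linInf (h.differentiableAt_slope i)
      (hnd.2.2.1 _ (hnum.2.1 ▸ Set.mem_range_self i))
  | inr j =>
    exact differentiableAt_bbIndex_linFin (h.differentiableAt_zero j)
      (hnd.2.2.2 _ (hnum.2.2.2 ▸ Set.mem_range_self j))

end IsLocalBranch

/-- Every local numbering agrees with a holomorphic one. -/
theorem IsLocalNumbering.exists_isLocalBranch {v₀ : PlaneVF n}
    (hnd : ∀ᶠ v : PlaneVF n in 𝓝 v₀, v.IsNondegenerate) (htop : v₀ (0, topExp n) ≠ 0)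
    {O : PlaneVF n → Fin (n + 1) → OnePoint ℂ} {Q : PlaneVF n → Fin (n ^ 2) → ℂ × ℂ}
    (hOQ : v₀.IsLocalNumbering O Q) :
    ∃ w q, IsLocalBranch v₀ w q ∧
      ∀ᶠ v in 𝓝 v₀, O v = (fun i => (w v i : OnePoint ℂ)) ∧ Q v = q v := by
  have h0 := hOQ.1.self_of_nhds
  obtain ⟨w₀, -, hw₀, -⟩ := exists_coe_of_isNumbering h0 htop
  have hO : O v₀ = fun i => (w₀ i : OnePoint ℂ) := funext hw₀
  rw [hO] at h0
  obtain ⟨w, q, hb, hw, hq⟩ := PlaneVF.exists_isLocalBranch hnd h0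
  refine ⟨w, q, hb, hb.eventually_eq hOQ (fun i => ?_) hq.symm⟩
  rw [hw₀, hw]

end PlaneVF

/-! ### Constancy along orbits and the dimension of orbits. -/

/-- The finitely many other values form a closed set that misses `f x`. Applied to `bbTuples`, this
makes a continuous branch constant along an orbit although numberings are not canonical. -/
theorem ContinuousAt.eventually_const {X Y : Type*} [TopologicalSpace X] [TopologicalSpace Y]
    [T1Space Y] {f : X → Y} {x : X} (hf : ContinuousAt f x) {S : Set Y} (hS : S.Finite)
    (h : ∀ᶠ t in 𝓝 x, f t ∈ S) : ∀ᶠ t in 𝓝 x, f t = f x := by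
  have h1 : (S \ {f x})ᶜ ∈ 𝓝 (f x) :=
    (hS.subset Set.sdiff_subset).isClosed.isOpen_compl.mem_nhds (by simp)
  filter_upwards [h, hf.eventually h1] with t ht ht'
  by_contra hne
  exact ht' ⟨ht, hne⟩

namespace PlaneVF

variable {n : ℕ}

theorem finite_bbTuples (v : PlaneVF n) : v.bbTuples.Finite := by
  by_cases hv : v.IsNondegenerate
  · have h1 : v.singInf.Finite := Set.finite_of_encard_eq_coe hv.1
    have h2 : v.singFin.Finite := Set.finite_of_encard_eq_coe hv.2.1
    refine (Set.Finite.pi (t := Sum.elim (fun _ => (fun o => bbIndex (v.linInf o)) '' v.singInf)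
      (fun _ => (fun q => bbIndex (v.linFin q)) '' v.singFin)) ?_).subset ?_
    · rintro (i | j)
      · exact h1.image _
      · exact h2.image _
    · rintro _ ⟨-, O, Q, h, rfl⟩ (i | j) -
      · exact ⟨O i, h.2.1 ▸ Set.mem_range_self i, rfl⟩
      · exact ⟨Q j, h.2.2.2 ▸ Set.mem_range_self j, rfl⟩
  · convert Set.finite_empty
    exact Set.eq_empty_of_forall_notMem fun t ht => hv ht.1

/-- Every vector of the tangent space of an orbit is the velocity of a curve in the orbit. -/
theorem exists_curve_of_mem_orbitTangent {v w : PlaneVF n} (hw : w ∈ v.orbitTangent) :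
    ∃ γ : ℂ → PlaneVF n, γ 0 = v ∧ HasDerivAt γ w 0 ∧ ∀ᶠ t in 𝓝 0, AffEquiv (γ t) v := by
  obtain ⟨X, c, hw⟩ := hw
  set A : (ℂ × ℂ) →L[ℂ] (ℂ × ℂ) := LinearMap.toContinuousLinearMap X.linear with hA
  have hAX : ∀ x, A x = X.linear x := fun x => rfl
  have hA0 : (0 : ℂ) • A = 0 := ContinuousLinearMap.ext fun x => zero_smul ℂ (A x)
  -- With `h_t(q) = q - t X(q)`, the curve is `1 + c t` times the push-forward of `v` under the
  -- inverse of `h_t`. Its value is `(1 + c t) (1 - t A)⁻¹ v(h_t(q))`, so the affine map itself need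
  -- not be inverted; only its linear part is. For singular `1 - t A` the inverse is `0` by
  -- convention, which matters only away from `t = 0`.
  set T : ℂ → (ℂ × ℂ) →L[ℂ] (ℂ × ℂ) := fun t => Ring.inverse (1 - t • A) with hT
  have hγ : ∀ t : ℂ, ∃ u : PlaneVF n, ∀ q,
      u.field q = (1 + c * t) • T t (v.field (q - t • X q)) := by
    intro t
    obtain ⟨h1, h2⟩ := v.isPlanePoly_field_affine (AffineMap.id ℂ (ℂ × ℂ) - t • X)
    obtain ⟨u, hu⟩ := exists_field_eq
      (((h1.const_mul (T t (1, 0)).1).add (h2.const_mul (T t (0, 1)).1)).const_mul (1 + c * t))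
      (((h1.const_mul (T t (1, 0)).2).add (h2.const_mul (T t (0, 1)).2)).const_mul (1 + c * t))
    refine ⟨u, fun q => ?_⟩
    rw [hu]
    have e : (AffineMap.id ℂ (ℂ × ℂ) - t • X) q = q - t • X q := rfl
    rw [e]
    have e2 : ∀ p : ℂ × ℂ, T t p = p.1 • T t (1, 0) + p.2 • T t (0, 1) := by
      intro p
      rw [← map_smul, ← map_smul, ← map_add]
      congr 1
      ext <;> simp
    rw [e2 (v.field _)]
    ext <;> simp <;> ring
  choose γ hγ using hγ
  have hline : HasDerivAt (fun t : ℂ => 1 - t • A) (-A) 0 :=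
    (((hasDerivAt_id' (0 : ℂ)).smul_const A).const_sub 1).congr_deriv (by simp)
  have hT0 : T 0 = 1 := by
    show Ring.inverse (1 - (0 : ℂ) • A) = 1
    rw [hA0, sub_zero, Ring.inverse_one]
  have hTd : HasDerivAt T A 0 := by
    have h1 := hasFDerivAt_ringInverse (𝕜 := ℂ) (1 : ((ℂ × ℂ) →L[ℂ] (ℂ × ℂ))ˣ)
    have h2 : ((1 : ((ℂ × ℂ) →L[ℂ] (ℂ × ℂ))ˣ) : (ℂ × ℂ) →L[ℂ] (ℂ × ℂ)) =
        (fun t : ℂ => 1 - t • A) 0 := by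
      show (1 : (ℂ × ℂ) →L[ℂ] (ℂ × ℂ)) = 1 - (0 : ℂ) • A
      rw [hA0, sub_zero]
    rw [h2] at h1
    refine (h1.comp_hasDerivAt (0 : ℂ) hline).congr_deriv ?_
    simp
  refine ⟨γ, field_injective fun q => ?_, hasDerivAt_of_field fun q => ?_, ?_⟩
  · rw [hγ, hT0]
    simp
  · have h1 : HasDerivAt (fun t : ℂ => q - t • X q) (-X q) 0 :=
      (((hasDerivAt_id' (0 : ℂ)).smul_const (X q)).const_sub q).congr_deriv (by simp)
    have h2 : HasDerivAt (fun t : ℂ => v.field (q - t • X q)) (fderiv ℂ v.field q (-X q)) 0 := by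
      have h3 : HasFDerivAt v.field (fderiv ℂ v.field q) (q - (0 : ℂ) • X q) := by
        rw [zero_smul, sub_zero]
        exact (v.differentiable_field q).hasFDerivAt
      exact h3.comp_hasDerivAt (0 : ℂ) h1
    have h4 : HasDerivAt (fun t : ℂ => 1 + c * t) c 0 :=
      (((hasDerivAt_id' (0 : ℂ)).const_mul c).const_add 1).congr_deriv (mul_one c)
    have h5 := h4.fun_smul (hTd.clm_apply h2)
    simp only [hγ]
    refine h5.congr_deriv ?_
    rw [hw, hT0, hAX]
    simp only [zero_smul, sub_zero, one_apply_eq_self, map_neg, mul_zero, add_zero,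
      one_smul]
    abel
  · have h1 : ∀ᶠ t : ℂ in 𝓝 0, IsUnit (1 - t • A) :=
      hline.continuousAt.eventually (Units.isOpen.mem_nhds (by
        show IsUnit (1 - (0 : ℂ) • A)
        rw [hA0, sub_zero]
        exact isUnit_one))
    have h2 : ∀ᶠ t : ℂ in 𝓝 0, 1 + c * t ≠ 0 := by
      have h : ContinuousAt (fun t : ℂ => 1 + c * t) 0 := by fun_prop
      exact h.eventually_ne (by simp)
    filter_upwards [h1, h2] with t ⟨U, hU⟩ h2
    let e : (ℂ × ℂ) ≃L[ℂ] (ℂ × ℂ) := ContinuousLinearEquiv.ofUnit U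
    have he : ∀ x, e x = x - t • X.linear x := by
      intro x
      have : e x = (U : (ℂ × ℂ) →L[ℂ] (ℂ × ℂ)) x := rfl
      rw [this, hU]
      rfl
    have heT : ∀ x, e (T t x) = x := by
      intro x
      have h3 : e (T t x) = ((U : (ℂ × ℂ) →L[ℂ] (ℂ × ℂ)) * T t) x := rfl
      have h4 : T t = Ring.inverse (U : (ℂ × ℂ) →L[ℂ] (ℂ × ℂ)) := by rw [hU]
      rw [h3, h4, Ring.inverse_unit, Units.mul_inv]
      rfl
    refine ⟨AffineEquiv.mk' (fun q => q - t • X q) e.toLinearEquiv 0 fun p => ?_,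
      (Units.mk0 _ h2)⁻¹, fun q => ?_⟩
    · show p - t • X p = e (p - 0) + (0 - t • X 0)
      have h3 : X.linear p = X p - X 0 := by
        have := X.linearMap_vsub p 0
        simpa using this
      rw [he, sub_zero, h3, smul_sub]
      abel
    · show v.field (q - t • X q) = _ • e ((γ t).field q)
      rw [hγ, map_smul, heT, smul_smul]
      simp [h2]

/-- The derivative of a branch of the moduli map vanishes along orbits. -/
theorem IsLocalNumbering.eq_zero_of_mem_orbitTangent {v w : PlaneVF n}
    (hnd : ∀ᶠ v' : PlaneVF n in 𝓝 v, v'.IsNondegenerate)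
    {O : PlaneVF n → Fin (n + 1) → OnePoint ℂ} {Q : PlaneVF n → Fin (n ^ 2) → ℂ × ℂ}
    (hOQ : v.IsLocalNumbering O Q) {M' : PlaneVF n →L[ℂ] (Fin (n + 1) ⊕ Fin (n ^ 2) → ℂ)}
    (hM : HasFDerivAt (fun w : PlaneVF n => w.bbTuple (O w) (Q w)) M' v)
    (hw : w ∈ v.orbitTangent) : M' w = 0 := by
  obtain ⟨γ, hγ0, hγ, hγv⟩ := exists_curve_of_mem_orbitTangent hw
  have hc : Filter.Tendsto γ (𝓝 0) (𝓝 v) := hγ0 ▸ hγ.continuousAt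
  have hd : HasDerivAt (fun t => (γ t).bbTuple (O (γ t)) (Q (γ t))) (M' w) 0 := by
    rw [← hγ0] at hM
    exact hM.comp_hasDerivAt (0 : ℂ) hγ
  have hmem : ∀ᶠ t in 𝓝 (0 : ℂ), (γ t).bbTuple (O (γ t)) (Q (γ t)) ∈ v.bbTuples := by
    filter_upwards [hγv, hc.eventually hnd, hc.eventually hOQ.1] with t h1 h2 h3
    rw [← bbTuples_eq_of_affEquiv h1]
    exact ⟨h2, _, _, h3, rfl⟩
  have hconst := hd.continuousAt.eventually_const v.finite_bbTuples hmem
  exact hd.unique ((hasDerivAt_const (0 : ℂ) _).congr_of_eventuallyEq hconst)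

theorem IsNondegenerate.injective_linFin {v : PlaneVF n} (hv : v.IsNondegenerate) {q : ℂ × ℂ}
    (hq : v.field q = 0) {u : ℂ × ℂ} (hu : fderiv ℂ v.field q u = 0) : u = 0 := by
  by_contra hne
  refine hv.2.2.2 q hq ?_
  by_contra hd
  have hk : LinearMap.ker (v.linFin q) = ⊥ :=
    LinearMap.ker_eq_bot.2 (LinearEquiv.ofIsUnitDet (f := v.linFin q)
      (v := Module.finBasis ℂ (ℂ × ℂ)) (v' := Module.finBasis ℂ (ℂ × ℂ))
      (by rw [LinearMap.det_toMatrix]; exact Ne.isUnit hd)).injective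
  exact hne ((LinearMap.ker_eq_bot'.1 hk) u hu)

open Polynomial in
/-- On a line the components of a field are polynomials of degree at most `n`. -/
theorem exists_eval_line (v : PlaneVF n) (z u : ℂ × ℂ) (i : Fin 2) :
    ∃ p : Polynomial ℂ, p.natDegree ≤ n ∧ ∀ t : ℂ, p.eval t =
      ∑ d : PlaneExp n, v (i, d) * (z + t • u).1 ^ (d.1.1 : ℕ) * (z + t • u).2 ^ (d.1.2 : ℕ) := by
  refine ⟨∑ d : PlaneExp n, C (v (i, d)) * (C u.1 * X + C z.1) ^ (d.1.1 : ℕ) *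
    (C u.2 * X + C z.2) ^ (d.1.2 : ℕ), ?_, fun t => ?_⟩
  · refine natDegree_sum_le_of_forall_le _ _ fun d _ => ?_
    have h : ∀ (a b : ℂ) (k : ℕ), ((C a * X + C b) ^ k).natDegree ≤ k := fun a b k =>
      (natDegree_pow_le_of_le k natDegree_linear_le).trans (by simp)
    refine (natDegree_mul_le_of_le (natDegree_mul_le_of_le (natDegree_C _).le (h _ _ _))
      (h _ _ _)).trans ?_
    have := d.2
    omega
  · have h1 : (z + t • u).1 = u.1 * t + z.1 := by
      rw [Prod.fst_add, Prod.smul_fst, smul_eq_mul]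
      ring
    have h2 : (z + t • u).2 = u.2 * t + z.2 := by
      rw [Prod.snd_add, Prod.smul_snd, smul_eq_mul]
      ring
    simp only [eval_finsetSum, eval_mul, eval_pow, eval_add, eval_C, eval_X, h1, h2]

/-- A nondegenerate field of degree at least two has three zeros that are not on a line. -/
theorem IsNondegenerate.not_collinear {v : PlaneVF n} (hn : 2 ≤ n) (hv : v.IsNondegenerate)
    (z u : ℂ × ℂ) (h : ∀ q, v.field q = 0 → ∃ t : ℂ, q = z + t • u) : False := by
  obtain ⟨O, Q, -, -, hQinj, hQ⟩ := hv.exists_isNumbering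
  have hQ0 : ∀ j, v.field (Q j) = 0 := fun j => by
    have : Q j ∈ v.singFin := hQ ▸ Set.mem_range_self j
    exact this
  choose t ht using fun j => h (Q j) (hQ0 j)
  have htinj : Function.Injective t := fun i j hij => hQinj (by rw [ht i, ht j, hij])
  -- Restricted to a line, both components have degree at most `n` in the parameter. Having `n ^ 2 >
  -- n` zeros they vanish on the whole line, against finiteness of the zero set.
  have hlt : n < n ^ 2 := by nlinarith
  have hzero : ∀ s : ℂ, v.field (z + s • u) = 0 := by
    intro s
    have key : ∀ i : Fin 2, ∑ d : PlaneExp n,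
        v (i, d) * (z + s • u).1 ^ (d.1.1 : ℕ) * (z + s • u).2 ^ (d.1.2 : ℕ) = 0 := by
      intro i
      obtain ⟨p, hp, hpe⟩ := v.exists_eval_line z u i
      have : p = 0 := by
        refine Polynomial.eq_zero_of_natDegree_lt_card_of_eval_eq_zero p htinj (fun j => ?_) ?_
        · rw [hpe, ← ht]
          have := hQ0 j
          fin_cases i
          · exact congrArg Prod.fst this
          · exact congrArg Prod.snd this
        · rw [Fintype.card_fin]
          omega
      rw [← hpe, this, Polynomial.eval_zero]
    exact Prod.ext (key 0) (key 1)
  have hu : u ≠ 0 := by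
    rintro rfl
    have h01 : Q ⟨0, by omega⟩ = Q ⟨1, by omega⟩ := by
      rw [ht ⟨0, by omega⟩, ht ⟨1, by omega⟩, smul_zero, smul_zero]
    have := hQinj h01
    simp at this
  have hfin : v.singFin.Finite := Set.finite_of_encard_eq_coe hv.2.1
  refine Set.infinite_of_injective_forall_mem (f := fun s : ℂ => z + s • u) ?_ hzero hfin
  intro a b hab
  exact smul_left_injective ℂ hu (add_left_cancel hab)

/-- An affine vector field vanishing at all zeros of a nondegenerate field is zero. -/
theorem IsNondegenerate.affine_eq_zero {v : PlaneVF n} (hn : 2 ≤ n) (hv : v.IsNondegenerate)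
    (X : (ℂ × ℂ) →ᵃ[ℂ] (ℂ × ℂ)) (hX : ∀ q, v.field q = 0 → X q = 0) : X = 0 := by
  obtain ⟨O, Q, -, -, hQinj, hQ⟩ := hv.exists_isNumbering
  have hQ0 : ∀ j, v.field (Q j) = 0 := fun j => by
    have : Q j ∈ v.singFin := hQ ▸ Set.mem_range_self j
    exact this
  have h4 : 4 ≤ n ^ 2 := by nlinarith
  set z := Q ⟨0, by omega⟩
  set u := Q ⟨1, by omega⟩ - z with hu
  have hu0 : u ≠ 0 := by
    refine sub_ne_zero.2 fun h => ?_
    have := hQinj h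
    simp at this
  have hlin : ∀ q, X q = X.linear (q - z) := by
    intro q
    have := X.linearMap_vsub q z
    rw [hX z (hQ0 _)] at this
    simpa using this.symm
  -- A nonzero linear part has kernel of dimension at most one, which would place all zeros on one
  -- line through `z`.
  have hL : X.linear = 0 := by
    by_contra hne
    refine hv.not_collinear hn z u fun q hq => ?_
    have h1 : u ∈ LinearMap.ker X.linear := by
      rw [LinearMap.mem_ker, hu, ← hlin]
      exact hX _ (hQ0 _)
    have h2 : q - z ∈ LinearMap.ker X.linear := by
      rw [LinearMap.mem_ker, ← hlin]
      exact hX _ hq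
    have h3 : Module.finrank ℂ (LinearMap.ker X.linear) ≤ 1 := by
      have h4 := LinearMap.finrank_range_add_finrank_ker X.linear
      have h5 : 0 < Module.finrank ℂ (LinearMap.range X.linear) := by
        rw [Module.finrank_pos_iff_of_free, Submodule.nontrivial_iff_ne_bot]
        exact fun h => hne (LinearMap.range_eq_bot.1 h)
      simp at h4
      omega
    obtain ⟨x, hx⟩ := finrank_le_one_iff.1 h3
    obtain ⟨a, ha⟩ := hx ⟨u, h1⟩
    obtain ⟨b, hb⟩ := hx ⟨q - z, h2⟩
    have ha : a • (x : ℂ × ℂ) = u := congrArg Subtype.val ha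
    have hb : b • (x : ℂ × ℂ) = q - z := congrArg Subtype.val hb
    have ha0 : a ≠ 0 := by
      rintro rfl
      exact hu0 (by rw [← ha, zero_smul])
    refine ⟨b / a, ?_⟩
    rw [← ha, smul_smul, div_mul_cancel₀ _ ha0, hb]
    abel
  ext q : 1
  rw [hlin, hL]
  rfl

/-- The orbits of nondegenerate fields have dimension seven. -/
theorem IsNondegenerate.finrank_orbitTangent {v : PlaneVF n} (hn : 2 ≤ n)
    (hv : v.IsNondegenerate) : Module.finrank ℂ v.orbitTangent = 7 := by
  choose τ hτ using fun p : ((ℂ × ℂ) →ᵃ[ℂ] (ℂ × ℂ)) × ℂ => v.exists_orbitTangent_field p.1 p.2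
  let T : (((ℂ × ℂ) →ᵃ[ℂ] (ℂ × ℂ)) × ℂ) →ₗ[ℂ] PlaneVF n :=
    { toFun := τ
      map_add' := fun p p' => field_injective fun q => by
        rw [field_add, hτ, hτ, hτ, Prod.fst_add, Prod.snd_add, AffineMap.add_linear,
          LinearMap.add_apply, AffineMap.coe_add, Pi.add_apply, map_add, add_smul]
        abel
      map_smul' := fun a p => field_injective fun q => by
        rw [RingHom.id_apply, field_smul, hτ, hτ, Prod.smul_fst, Prod.smul_snd,
          AffineMap.smul_linear, LinearMap.smul_apply, AffineMap.coe_smul, Pi.smul_apply, map_smul,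
          smul_eq_mul, mul_smul, smul_add, smul_sub] }
  have hrange : LinearMap.range T = v.orbitTangent := by
    ext w
    constructor
    · rintro ⟨p, rfl⟩
      exact ⟨p.1, p.2, hτ p⟩
    · rintro ⟨X, c, h⟩
      exact ⟨(X, c), field_injective fun q => by rw [h]; exact hτ (X, c) q⟩
  -- At a zero `q` of `v` a relation reads `Dv(q) (X q) = 0`, so `X` vanishes at all zeros.
  -- Injectivity then gives the dimension of the affine fields plus scalars, `6 + 1`.
  have hinj : LinearMap.ker T = ⊥ := by
    refine LinearMap.ker_eq_bot'.2 fun p hp => ?_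
    have hp : ∀ q, p.1.linear (v.field q) - fderiv ℂ v.field q (p.1 q) + p.2 • v.field q = 0 := by
      intro q
      rw [← hτ]
      have : τ p = 0 := hp
      rw [this]
      ext <;> simp [field]
    have h1 : p.1 = 0 := hv.affine_eq_zero hn p.1 fun q hq => by
      have h2 := hp q
      rw [hq, map_zero, smul_zero, zero_sub, add_zero, neg_eq_zero] at h2
      exact hv.injective_linFin hq h2
    have h2 : p.2 = 0 := by
      by_contra hne
      refine hv.not_collinear hn 0 0 fun q _ => ?_
      exfalso
      -- Only `c v = 0` remains; for `c ≠ 0` every point would be singular, whereas the zeros are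
      -- finite in number.
      have hall : ∀ q, v.field q = 0 := fun q => by
        have h3 := hp q
        rw [h1] at h3
        simpa [hne] using h3
      have hfin : v.singFin.Finite := Set.finite_of_encard_eq_coe hv.2.1
      have huniv : v.singFin = Set.univ := Set.eq_univ_of_forall hall
      rw [huniv] at hfin
      exact Set.infinite_univ hfin
    exact Prod.ext h1 h2
  rw [← hrange, LinearMap.finrank_range_of_inj (LinearMap.ker_eq_bot.1 hinj), Module.finrank_prod,
    (AffineMap.toConstProdLinearMap ℂ).finrank_eq, Module.finrank_prod, Module.finrank_linearMap]
  simp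

theorem IsNondegenerate.finrank_quotient_orbitTangent {v : PlaneVF 2} (hv : v.IsNondegenerate) :
    Module.finrank ℂ (PlaneVF 2 ⧸ v.orbitTangent) = 5 := by
  have h1 := Submodule.finrank_quotient_add_finrank v.orbitTangent
  rw [hv.finrank_orbitTangent le_rfl, Module.finrank_fintype_fun_eq_card, Fintype.card_prod,
    Fintype.card_fin] at h1
  have h2 := card_planeExp 2
  omega

end PlaneVF

/-! ### From injectivity of the derivative at one field to generic fields. -/

open Polynomial in
/-- The coefficients of `∏ (X - tᵢ)` are differentiable in the roots. -/
theorem differentiable_coeff_prod_X_sub_C {ι : Type*} [Fintype ι] (k : ℕ) :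
    Differentiable ℂ fun t : ι → ℂ => (∏ i, (X - C (t i))).coeff k := by
  classical
  suffices h : ∀ (s : Finset ι) (k : ℕ),
      Differentiable ℂ fun t : ι → ℂ => (∏ i ∈ s, (X - C (t i))).coeff k from h _ k
  intro s
  induction s using Finset.induction_on with
  | empty => intro k; simp
  | insert i s hi ih =>
    intro k
    simp only [Finset.prod_insert hi, sub_mul, coeff_sub, coeff_C_mul]
    refine Differentiable.fun_sub ?_ (Differentiable.fun_mul (by fun_prop) (ih k))
    cases k with
    | zero => simp
    | succ k =>
      simp only [coeff_X_mul]
      exact ih k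

open Polynomial in
theorem hasDerivAt_coeff_prod_zero {ι : Type*} [Fintype ι] {g : ℂ → ι → ℂ} {t : ℂ}
    (h : HasDerivAt g 0 t) (k : ℕ) :
    HasDerivAt (fun s => (∏ i, (X - C (g s i))).coeff k) 0 t := by
  have h1 := ((differentiable_coeff_prod_X_sub_C (ι := ι) k) (g t)).hasFDerivAt
  exact (h1.comp_hasDerivAt t h).congr_deriv (map_zero _)

open Polynomial in
/-- If the coefficients of `∏ (X - gᵢ)` have derivative zero and the roots are distinct, then the
roots have derivative zero. -/
theorem eq_zero_of_hasDerivAt_coeff_prod {N : ℕ} {g : ℂ → Fin N → ℂ} {τ : Fin N → ℂ} {t : ℂ}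
    (hg : HasDerivAt g τ t) (hinj : Function.Injective (g t))
    (h : ∀ k < N + 1, HasDerivAt (fun s => (∏ i, (X - C (g s i))).coeff k) 0 t) : τ = 0 := by
  funext j
  -- Evaluate the moving polynomial at the fixed point `g t j`. The derivative is zero by
  -- stationarity of the coefficients, and it is also `-τ j` times the product of the differences to
  -- the other roots, which is nonzero.
  have h1 : HasDerivAt (fun s => (∏ i, (X - C (g s i))).eval (g t j)) 0 t := by
    have e : (fun s => (∏ i, (X - C (g s i))).eval (g t j)) = fun s =>
        ∑ k ∈ Finset.range (N + 1), (∏ i, (X - C (g s i))).coeff k * g t j ^ k := by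
      funext s
      refine eval_eq_sum_range' ?_ _
      have h2 : (∏ i, (X - C (g s i))).natDegree = N := by
        rw [natDegree_prod_of_monic _ _ fun i _ => monic_X_sub_C _]
        simp
      omega
    rw [e]
    have h2 := HasDerivAt.fun_sum (u := Finset.range (N + 1)) (x := t)
      (A := fun k s => (∏ i, (X - C (g s i))).coeff k * g t j ^ k) (A' := fun _ => 0) fun k hk =>
        ((h k (Finset.mem_range.1 hk)).mul_const (g t j ^ k)).congr_deriv (zero_mul _)
    simpa using h2
  have hgi := hasDerivAt_pi.1 hg
  have h2 : HasDerivAt (fun s => (g t j - g s j) * ∏ i ∈ Finset.univ.erase j, (g t j - g s i))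
      (-τ j * ∏ i ∈ Finset.univ.erase j, (g t j - g t i)) t := by
    have h3 : DifferentiableAt ℂ (fun s => ∏ i ∈ Finset.univ.erase j, (g t j - g s i)) t :=
      DifferentiableAt.fun_finsetProd fun i _ => ((hgi i).const_sub _).differentiableAt
    refine (((hgi j).const_sub (g t j)).fun_mul h3.hasDerivAt).congr_deriv ?_
    simp
  have h3 : (fun s => (∏ i, (X - C (g s i))).eval (g t j)) = fun s =>
      (g t j - g s j) * ∏ i ∈ Finset.univ.erase j, (g t j - g s i) := by
    funext s
    rw [eval_prod, ← Finset.mul_prod_erase Finset.univ _ (Finset.mem_univ j)]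
    simp
  rw [h3] at h1
  have h4 := h2.unique h1
  refine neg_eq_zero.1 ((mul_eq_zero.1 h4).resolve_right ?_)
  exact Finset.prod_ne_zero_iff.2 fun i hi =>
    sub_ne_zero.2 fun h => (Finset.mem_erase.1 hi).1 (hinj h).symm

/-- The directional derivatives of a polynomial function are polynomial functions. -/
theorem MvPolynomial.exists_hasDerivAt_eval {σ : Type*} [Fintype σ] {m : ℕ}
    (ι : (Fin m → ℂ) →ₗ[ℂ] (σ → ℂ)) (a : MvPolynomial σ ℂ) :
    ∃ a' : Fin m → MvPolynomial σ ℂ, ∀ (v : σ → ℂ) (s : Fin m → ℂ),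
      HasDerivAt (fun t : ℂ => MvPolynomial.eval (v + t • ι s) a)
        (∑ j, s j * MvPolynomial.eval v (a' j)) 0 := by
  induction a using MvPolynomial.induction_on with
  | C c => exact ⟨fun _ => 0, fun v s => by simpa using hasDerivAt_const (0 : ℂ) c⟩
  | add p q hp hq =>
    obtain ⟨p', hp⟩ := hp
    obtain ⟨q', hq⟩ := hq
    refine ⟨fun j => p' j + q' j, fun v s => ?_⟩
    simp only [map_add]
    refine ((hp v s).fun_add (hq v s)).congr_deriv ?_
    rw [← Finset.sum_add_distrib]
    exact Finset.sum_congr rfl fun j _ => by ring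
  | mul_X p c hp =>
    obtain ⟨p', hp⟩ := hp
    refine ⟨fun j => p' j * MvPolynomial.X c + p * MvPolynomial.C (ι (Pi.single j 1) c),
      fun v s => ?_⟩
    simp only [map_mul, MvPolynomial.eval_X, map_add, MvPolynomial.eval_C]
    have h1 : HasDerivAt (fun t : ℂ => (v + t • ι s) c) (ι s c) 0 :=
      (((hasDerivAt_id' (0 : ℂ)).mul_const (ι s c)).const_add (v c)).congr_deriv (one_mul _)
    refine ((hp v s).fun_mul h1).congr_deriv ?_
    have h2 : ι s c = ∑ j, s j * ι (Pi.single j 1) c := by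
      rw [LinearMap.pi_apply_eq_sum_univ ι s, Finset.sum_apply]
      refine Finset.sum_congr rfl fun j _ => ?_
      have e : (fun i => if j = i then 1 else 0) = (Pi.single j 1 : Fin m → ℂ) := by
        funext i
        simp [Pi.single_apply, eq_comm]
      rw [Pi.smul_apply, smul_eq_mul, e]
    rw [zero_smul, add_zero, h2, Finset.sum_mul, Finset.mul_sum, ← Finset.sum_add_distrib]
    exact Finset.sum_congr rfl fun j _ => by ring

/-- The injectivity of a matrix with polynomial entries is an open condition in the Zariski
topology. -/
theorem MvPolynomial.exists_minor {σ κ : Type*} [Fintype κ] {m : ℕ}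
    (N : κ → Fin m → MvPolynomial σ ℂ) {v₀ : σ → ℂ}
    (h : ∀ s : Fin m → ℂ, (∀ k, ∑ j, s j * MvPolynomial.eval v₀ (N k j) = 0) → s = 0) :
    ∃ D : MvPolynomial σ ℂ, MvPolynomial.eval v₀ D ≠ 0 ∧ ∀ v, MvPolynomial.eval v D ≠ 0 →
      ∀ s : Fin m → ℂ, (∀ k, ∑ j, s j * MvPolynomial.eval v (N k j) = 0) → s = 0 := by
  classical
  let A : Matrix κ (Fin m) ℂ := fun k j => MvPolynomial.eval v₀ (N k j)
  have hA : ∀ s k, (A.mulVec s) k = ∑ j, s j * MvPolynomial.eval v₀ (N k j) := fun s k => by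
    simp [A, Matrix.mulVec, dotProduct, mul_comm]
  have hker : LinearMap.ker A.mulVecLin = ⊥ := by
    refine LinearMap.ker_eq_bot'.2 fun s hs => h s fun k => ?_
    rw [← hA]
    exact congrFun hs k
  -- A constant left inverse `p` of the matrix at `v₀` makes `det (p N)` a polynomial equal to `1`
  -- at `v₀`. It plays the part of a maximal minor without a choice of rows, and its nonvanishing
  -- implies injectivity of `N`.
  obtain ⟨g, hg⟩ := A.mulVecLin.exists_leftInverse_of_injective hker
  set p := LinearMap.toMatrix' g
  have hpA : p * A = 1 := by
    have h1 := congrArg LinearMap.toMatrix' hg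
    rw [LinearMap.toMatrix'_comp, LinearMap.toMatrix'_id] at h1
    rw [← h1]
    congr 1
    exact (LinearMap.toMatrix'_toLin' A).symm
  let p' : Matrix (Fin m) κ (MvPolynomial σ ℂ) := p.map MvPolynomial.C
  let N' : Matrix κ (Fin m) (MvPolynomial σ ℂ) := Matrix.of N
  refine ⟨(p' * N').det, ?_, fun v hv s hs => ?_⟩
  · rw [RingHom.map_det, RingHom.mapMatrix_apply, Matrix.map_mul]
    have h1 : p'.map (MvPolynomial.eval v₀) = p := by
      ext i j
      simp [p']
    have h2 : N'.map (MvPolynomial.eval v₀) = A := rfl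
    rw [h1, h2, hpA, Matrix.det_one]
    exact one_ne_zero
  · rw [RingHom.map_det, RingHom.mapMatrix_apply, Matrix.map_mul] at hv
    refine Matrix.eq_zero_of_mulVec_eq_zero hv ?_
    rw [← Matrix.mulVec_mulVec]
    have h3 : (N'.map (MvPolynomial.eval v)).mulVec s = 0 := by
      funext k
      refine Eq.trans ?_ (hs k)
      simp [N', Matrix.mulVec, dotProduct, mul_comm]
    rw [h3, Matrix.mulVec_zero]

namespace PlaneVF

variable {n : ℕ}

theorem tendsto_line (v u : PlaneVF n) :
    Filter.Tendsto (fun t : ℂ => v + t • u) (𝓝 0) (𝓝 v) := by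
  have h : ContinuousAt (fun t : ℂ => v + t • u) 0 := by fun_prop
  simpa [ContinuousAt] using h

theorem _root_.HasFDerivAt.hasDerivAt_line {F : Type*} [NormedAddCommGroup F] [NormedSpace ℂ F]
    {f : PlaneVF n → F} {v : PlaneVF n} {f' : PlaneVF n →L[ℂ] F} (h : HasFDerivAt f f' v)
    (u : PlaneVF n) : HasDerivAt (fun t : ℂ => f (v + t • u)) (f' u) 0 := by
  have h1 : HasDerivAt (fun t : ℂ => v + t • u) u 0 :=
    (((hasDerivAt_id' (0 : ℂ)).smul_const u).const_add v).congr_deriv (one_smul _ _)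
  have h2 : HasFDerivAt f f' (v + (0 : ℂ) • u) := by
    rw [zero_smul, add_zero]
    exact h
  exact h2.comp_hasDerivAt (0 : ℂ) h1

/-- Coefficients of the polynomials of the Baum-Bott indices at infinity and in the plane. -/
noncomputable def bbCoeff (v : PlaneVF n) : Fin (n + 2) ⊕ Fin (n ^ 2 + 1) → ℂ :=
  Sum.elim (fun k => v.bbPolyInf.coeff k) (fun k => v.bbPolyFin.coeff k)

theorem eventually_bbPoly_eq {v : PlaneVF n} {O : PlaneVF n → Fin (n + 1) → OnePoint ℂ}
    {Q : PlaneVF n → Fin (n ^ 2) → ℂ × ℂ} (hOQ : v.IsLocalNumbering O Q) (u : PlaneVF n) :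
    ∀ᶠ t in 𝓝 (0 : ℂ), (v + t • u).bbPolyInf = ∏ i, (Polynomial.X - Polynomial.C
        ((v + t • u).bbTuple (O (v + t • u)) (Q (v + t • u)) (Sum.inl i))) ∧
      (v + t • u).bbPolyFin = ∏ j, (Polynomial.X - Polynomial.C
        ((v + t • u).bbTuple (O (v + t • u)) (Q (v + t • u)) (Sum.inr j))) := by
  filter_upwards [(tendsto_line v u).eventually hOQ.1] with t ht
  exact bbPoly_eq_of_isNumbering ht

/-- If the indices are stationary, so are their symmetric functions. -/
theorem hasDerivAt_bbCoeff_zero {v u : PlaneVF n} {O : PlaneVF n → Fin (n + 1) → OnePoint ℂ}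
    {Q : PlaneVF n → Fin (n ^ 2) → ℂ × ℂ} (hOQ : v.IsLocalNumbering O Q)
    (h : HasDerivAt (fun t : ℂ => (v + t • u).bbTuple (O (v + t • u)) (Q (v + t • u))) 0 0)
    (k : Fin (n + 2) ⊕ Fin (n ^ 2 + 1)) :
    HasDerivAt (fun t : ℂ => (v + t • u).bbCoeff k) 0 0 := by
  have h1 := hasDerivAt_pi.1 h
  cases k with
  | inl k =>
    refine (hasDerivAt_coeff_prod_zero (hasDerivAt_pi.2 fun i => h1 (Sum.inl i))
      (k : ℕ)).congr_of_eventuallyEq ?_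
    filter_upwards [eventually_bbPoly_eq hOQ u] with t ht
    exact congrArg (fun p => Polynomial.coeff p k) ht.1
  | inr k =>
    refine (hasDerivAt_coeff_prod_zero (hasDerivAt_pi.2 fun i => h1 (Sum.inr i))
      (k : ℕ)).congr_of_eventuallyEq ?_
    filter_upwards [eventually_bbPoly_eq hOQ u] with t ht
    exact congrArg (fun p => Polynomial.coeff p k) ht.2

/-- If the symmetric functions of distinct indices are stationary, so are the indices. -/
theorem eq_zero_of_hasDerivAt_bbCoeff {v u : PlaneVF n}
    {O : PlaneVF n → Fin (n + 1) → OnePoint ℂ} {Q : PlaneVF n → Fin (n ^ 2) → ℂ × ℂ}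
    (hOQ : v.IsLocalNumbering O Q) {τ : Fin (n + 1) ⊕ Fin (n ^ 2) → ℂ}
    (h : HasDerivAt (fun t : ℂ => (v + t • u).bbTuple (O (v + t • u)) (Q (v + t • u))) τ 0)
    (hinf : Function.Injective fun i => bbIndex (v.linInf (O v i)))
    (hfin : Function.Injective fun j => bbIndex (v.linFin (Q v j)))
    (hk : ∀ k, HasDerivAt (fun t : ℂ => (v + t • u).bbCoeff k) 0 0) : τ = 0 := by
  have h1 := hasDerivAt_pi.1 h
  have hv : v + (0 : ℂ) • u = v := by rw [zero_smul, add_zero]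
  have e1 : (fun i => τ (Sum.inl i)) = 0 := by
    refine eq_zero_of_hasDerivAt_coeff_prod (hasDerivAt_pi.2 fun i => h1 (Sum.inl i)) ?_
      fun k hkn => (hk (Sum.inl ⟨k, hkn⟩)).congr_of_eventuallyEq ?_
    · simp only [hv]
      exact hinf
    · filter_upwards [eventually_bbPoly_eq hOQ u] with t ht
      exact (congrArg (fun p => Polynomial.coeff p k) ht.1).symm
  have e2 : (fun j => τ (Sum.inr j)) = 0 := by
    refine eq_zero_of_hasDerivAt_coeff_prod (hasDerivAt_pi.2 fun i => h1 (Sum.inr i)) ?_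
      fun k hkn => (hk (Sum.inr ⟨k, hkn⟩)).congr_of_eventuallyEq ?_
    · simp only [hv]
      exact hfin
    · filter_upwards [eventually_bbPoly_eq hOQ u] with t ht
      exact (congrArg (fun p => Polynomial.coeff p k) ht.2).symm
  funext k
  cases k with
  | inl i => exact congrFun e1 i
  | inr j => exact congrFun e2 j

/-- If the derivative of the moduli map is injective on a subspace at one field with distinct
indices, it is so at generic fields. -/
theorem forGeneric_injective (hn : 1 ≤ n) {v₀ : PlaneVF n}
    (hnd₀ : ∀ᶠ v : PlaneVF n in 𝓝 v₀, v.IsNondegenerate) (htop : v₀ (0, topExp n) ≠ 0)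
    {w : PlaneVF n → Fin (n + 1) → ℂ} {q : PlaneVF n → Fin (n ^ 2) → ℂ × ℂ}
    (hb : IsLocalBranch v₀ w q) (hinj : Function.Injective fun j => (q v₀ j).1)
    (hinf : Function.Injective fun i => bbIndex (v₀.linInf (w v₀ i : OnePoint ℂ)))
    (hfin : Function.Injective fun j => bbIndex (v₀.linFin (q v₀ j)))
    {m : ℕ} (ι : (Fin m → ℂ) →ₗ[ℂ] PlaneVF n)
    (hι : ∀ s, HasDerivAt (fun t : ℂ => (v₀ + t • ι s).bbTuple
      (fun i => (w (v₀ + t • ι s) i : OnePoint ℂ)) (q (v₀ + t • ι s))) 0 0 → s = 0) :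
    ForGeneric fun v : PlaneVF n => (∀ᶠ v' : PlaneVF n in 𝓝 v, v'.IsNondegenerate) ∧
      v (0, topExp n) ≠ 0 ∧ ∀ O Q, v.IsLocalNumbering O Q →
      ∀ M' : PlaneVF n →L[ℂ] (Fin (n + 1) ⊕ Fin (n ^ 2) → ℂ),
        HasFDerivAt (fun w : PlaneVF n => w.bbTuple (O w) (Q w)) M' v →
        ∀ s, M' (ι s) = 0 → s = 0 := by
  classical
  -- The branches are not rational in `v`, but the coefficients of the two polynomials of indices
  -- are. Their derivatives along `ι s` are linear in `s` with rational coefficients.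
  have hrat : ∀ k : Fin (n + 2) ⊕ Fin (n ^ 2 + 1), ∃ a b : MvPolynomial (VFCoord n) ℂ,
      MvPolynomial.eval v₀ b ≠ 0 ∧ ∀ v : PlaneVF n, v.IsNondegenerate →
        MvPolynomial.eval v b ≠ 0 →
          v.bbCoeff k = MvPolynomial.eval v a / MvPolynomial.eval v b := by
    intro k
    have h := fun k => exists_coeff_bbPoly hn hnd₀.self_of_nhds htop hb.isNumbering.self_of_nhds
      hinj k
    cases k with
    | inl k => exact (h k).1
    | inr k => exact (h k).2
  choose a b hb₀ hab using hrat
  choose a' ha' using fun k => MvPolynomial.exists_hasDerivAt_eval ι (a k)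
  choose b' hb' using fun k => MvPolynomial.exists_hasDerivAt_eval ι (b k)
  have hderiv : ∀ (k) (v : PlaneVF n) (s), (∀ᶠ v' : PlaneVF n in 𝓝 v, v'.IsNondegenerate) →
      MvPolynomial.eval v (b k) ≠ 0 → HasDerivAt (fun t : ℂ => (v + t • ι s).bbCoeff k)
        ((∑ j, s j * MvPolynomial.eval v (a' k j * b k - a k * b' k j)) /
          MvPolynomial.eval v (b k) ^ 2) 0 := by
    intro k v s hnd hbk
    have hv : v + (0 : ℂ) • ι s = v := by rw [zero_smul, add_zero]
    have h1 := (ha' k v s).fun_div (hb' k v s) (by rwa [hv])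
    have h2 := h1.congr_of_eventuallyEq (f₁ := fun t : ℂ => (v + t • ι s).bbCoeff k) (by
      filter_upwards [(tendsto_line v (ι s)).eventually hnd, (tendsto_line v (ι s)).eventually
        ((continuous_eval (b k)).continuousAt.eventually_ne hbk)] with t h1 h2
      exact hab k _ h1 h2)
    refine h2.congr_deriv ?_
    rw [hv, Finset.sum_mul, Finset.mul_sum, ← Finset.sum_sub_distrib]
    congr 1
    refine Finset.sum_congr rfl fun j _ => ?_
    rw [map_sub, map_mul, map_mul]
    ring
  -- Distinctness of the indices is used only here, at `v₀`: stationary coefficients give stationary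
  -- indices, and hence `s = 0`.
  obtain ⟨D, hD₀, hD⟩ := MvPolynomial.exists_minor
    (fun k j => a' k j * b k - a k * b' k j) (v₀ := v₀) fun s hs => by
      obtain ⟨M, hM⟩ : DifferentiableAt ℂ _ v₀ := hb.differentiableAt_bbTuple hnd₀.self_of_nhds
      have h1 := hM.hasDerivAt_line (ι s)
      have h2 := eq_zero_of_hasDerivAt_bbCoeff hb.isLocalNumbering h1 hinf hfin fun k => by
        have h3 := hderiv k v₀ s hnd₀ (hb₀ k)
        rwa [hs k, zero_div] at h3
      rw [h2] at h1
      exact hι s h1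
  obtain ⟨D', hD'₀, hD'⟩ := forGeneric_isNondegenerate hn
  have hprod : ∏ k, b k ≠ 0 := Finset.prod_ne_zero_iff.2 fun k _ h => hb₀ k (by rw [h, map_zero])
  refine ⟨D' * (∏ k, b k) * D, mul_ne_zero (mul_ne_zero hD'₀ hprod)
    fun h => hD₀ (by rw [h, map_zero]), fun v hv => ?_⟩
  rw [map_mul, map_mul] at hv
  have hv1 := left_ne_zero_of_mul (left_ne_zero_of_mul hv)
  have hv2 := right_ne_zero_of_mul (left_ne_zero_of_mul hv)
  have hnd : ∀ᶠ v' : PlaneVF n in 𝓝 v, v'.IsNondegenerate := by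
    filter_upwards [(continuous_eval D').continuousAt.eventually_ne hv1] with v' h
    exact (hD' v' h).1
  rw [map_prod, Finset.prod_ne_zero_iff] at hv2
  refine ⟨hnd, (hD' v hv1).2, fun O Q hOQ M' hM' s hs => ?_⟩
  refine hD v (right_ne_zero_of_mul hv) s fun k => ?_
  have h1 := hM'.hasDerivAt_line (ι s)
  rw [hs] at h1
  have hbk := hv2 k (Finset.mem_univ k)
  -- At the generic field the passage goes from indices to coefficients, which holds even when some
  -- indices coincide.
  have h2 := (hderiv k v s hnd hbk).unique (hasDerivAt_bbCoeff_zero hOQ h1 k)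
  exact (div_eq_zero_iff.1 h2).resolve_right (pow_ne_zero 2 hbk)

end PlaneVF

/-! ### An explicit quadratic field and five independent directions. -/

namespace PlaneVF

/-- A quadratic polynomial with given coefficients. -/
def quadEval (a : Fin 6 → ℂ) (q : ℂ × ℂ) : ℂ :=
  a 0 + a 1 * q.1 + a 2 * q.2 + a 3 * q.1 ^ 2 + a 4 * (q.1 * q.2) + a 5 * q.2 ^ 2

theorem isPlanePoly_quadEval (a : Fin 6 → ℂ) : IsPlanePoly 2 (quadEval a) := by
  have h1 : IsPlanePoly 2 fun q : ℂ × ℂ => q.1 := IsPlanePoly.fst.mono (by norm_num)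
  have h2 : IsPlanePoly 2 fun q : ℂ × ℂ => q.2 := IsPlanePoly.snd.mono (by norm_num)
  exact ((((((IsPlanePoly.const (a 0)).add (h1.const_mul (a 1))).add (h2.const_mul (a 2))).add
    ((IsPlanePoly.fst.pow 2).const_mul (a 3))).add
    ((IsPlanePoly.fst.mul IsPlanePoly.snd).const_mul (a 4))).add
    ((IsPlanePoly.snd.pow 2).const_mul (a 5)))

/-- `v` is the quadratic field with coefficients `a` and `b`. -/
def HasCoeffs (v : PlaneVF 2) (a b : Fin 6 → ℂ) : Prop :=
  ∀ q, v.field q = (quadEval a q, quadEval b q)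

namespace HasCoeffs

variable {v : PlaneVF 2} {a b : Fin 6 → ℂ}

/-- For `z ≠ 0` the homogenization is determined by the values of the field; continuity gives the
leading part at `z = 0`, without matching coefficients with the index type `PlaneExp 2`. -/
theorem homogenized_eq (h : v.HasCoeffs a b) (x y : ℂ) :
    v.homogenized 0 x y 0 = a 3 * x ^ 2 + a 4 * (x * y) + a 5 * y ^ 2 ∧
      v.homogenized 1 x y 0 = b 3 * x ^ 2 + b 4 * (x * y) + b 5 * y ^ 2 := by
  have key : ∀ (i : Fin 2) (c : Fin 6 → ℂ), (∀ z : ℂ, z ≠ 0 →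
      v.homogenized i x y z = z ^ 2 * quadEval c (x / z, y / z)) →
      v.homogenized i x y 0 = c 3 * x ^ 2 + c 4 * (x * y) + c 5 * y ^ 2 := by
    intro i c hc
    have h1 : Continuous fun z : ℂ => v.homogenized i x y z := by
      unfold homogenized
      fun_prop
    have h2 : Continuous fun z : ℂ => c 0 * z ^ 2 + c 1 * (x * z) + c 2 * (y * z) +
        c 3 * x ^ 2 + c 4 * (x * y) + c 5 * y ^ 2 := by fun_prop
    have h3 := Continuous.ext_on (dense_compl_singleton (0 : ℂ)) h1 h2 fun z hz => by
      have hz : z ≠ 0 := hz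
      show v.homogenized i x y z = _
      rw [hc z hz]
      simp only [quadEval]
      field_simp
    have h4 := congrFun h3 0
    simpa using h4
  refine ⟨key 0 a fun z hz => ?_, key 1 b fun z hz => ?_⟩
  · rw [homogenized_eq_fst v hz, h]
  · rw [homogenized_eq_snd v hz, h]

theorem apply_topExp (h : v.HasCoeffs a b) : v (0, topExp 2) = a 5 := by
  rw [← homogenized_zero_one_zero v 0, (h.homogenized_eq 0 1).1]
  ring

theorem infFun_eq (h : v.HasCoeffs a b) (w : ℂ) :
    v.infFun w = b 3 + b 4 * w + b 5 * w ^ 2 - w * (a 3 + a 4 * w + a 5 * w ^ 2) := by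
  rw [infFun, (h.homogenized_eq 1 w).1, (h.homogenized_eq 1 w).2]
  ring

theorem deriv_infFun (h : v.HasCoeffs a b) (w : ℂ) : deriv v.infFun w =
    b 4 + 2 * b 5 * w - a 3 - 2 * a 4 * w - 3 * a 5 * w ^ 2 := by
  have h1 : v.infFun = fun w => b 3 + b 4 * w + b 5 * w ^ 2 -
      w * (a 3 + a 4 * w + a 5 * w ^ 2) := funext h.infFun_eq
  rw [h1]
  have h2 : HasDerivAt (fun w : ℂ => w) 1 w := hasDerivAt_id' w
  have h3 := hasDerivAt_pow 2 w
  refine (((((h2.const_mul (b 4)).const_add (b 3)).fun_add (h3.const_mul (b 5))).fun_sub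
    (h2.fun_mul (((h2.const_mul (a 4)).const_add (a 3)).fun_add
      (h3.const_mul (a 5))))).congr_deriv ?_).deriv
  push_cast
  ring

theorem hasDerivAt_quadEval_fst (c : Fin 6 → ℂ) (q : ℂ × ℂ) :
    HasDerivAt (fun t => quadEval c (t, q.2)) (c 1 + 2 * c 3 * q.1 + c 4 * q.2) q.1 := by
  have h2 : HasDerivAt (fun t : ℂ => t) 1 q.1 := hasDerivAt_id' q.1
  refine (((((h2.const_mul (c 1)).const_add (c 0)).add_const (c 2 * q.2)).fun_add
    ((hasDerivAt_pow 2 q.1).const_mul (c 3))).fun_add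
    ((h2.mul_const q.2).const_mul (c 4))).add_const (c 5 * q.2 ^ 2) |>.congr_deriv ?_
  push_cast
  ring

theorem hasDerivAt_quadEval_snd (c : Fin 6 → ℂ) (q : ℂ × ℂ) :
    HasDerivAt (fun t => quadEval c (q.1, t)) (c 2 + c 4 * q.1 + 2 * c 5 * q.2) q.2 := by
  have h2 : HasDerivAt (fun t : ℂ => t) 1 q.2 := hasDerivAt_id' q.2
  refine (((((h2.const_mul (c 2)).const_add (c 0 + c 1 * q.1)).add_const (c 3 * q.1 ^ 2)).fun_add
    ((h2.const_mul q.1).const_mul (c 4))).fun_add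
    ((hasDerivAt_pow 2 q.2).const_mul (c 5))) |>.congr_deriv ?_
  push_cast
  ring

theorem linFin_eq (h : v.HasCoeffs a b) (q : ℂ × ℂ) :
    v.linFin q (1, 0) = (a 1 + 2 * a 3 * q.1 + a 4 * q.2, b 1 + 2 * b 3 * q.1 + b 4 * q.2) ∧
      v.linFin q (0, 1) = (a 2 + a 4 * q.1 + 2 * a 5 * q.2, b 2 + b 4 * q.1 + 2 * b 5 * q.2) := by
  have hf : v.field = fun q => (quadEval a q, quadEval b q) := funext h
  constructor
  · refine fderiv_prod_apply_fst (v.differentiable_field q) ?_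
    rw [hf]
    exact (hasDerivAt_quadEval_fst a q).prodMk (hasDerivAt_quadEval_fst b q)
  · refine fderiv_prod_apply_snd (v.differentiable_field q) ?_
    rw [hf]
    exact (hasDerivAt_quadEval_snd a q).prodMk (hasDerivAt_quadEval_snd b q)

theorem det_linFin (h : v.HasCoeffs a b) (q : ℂ × ℂ) : LinearMap.det (v.linFin q) =
    (a 1 + 2 * a 3 * q.1 + a 4 * q.2) * (b 2 + b 4 * q.1 + 2 * b 5 * q.2) -
      (a 2 + a 4 * q.1 + 2 * a 5 * q.2) * (b 1 + 2 * b 3 * q.1 + b 4 * q.2) := by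
  rw [prod_linearMap_det, (h.linFin_eq q).1, (h.linFin_eq q).2]

theorem bbIndex_linFin (h : v.HasCoeffs a b) (q : ℂ × ℂ) : bbIndex (v.linFin q) =
    (a 1 + 2 * a 3 * q.1 + a 4 * q.2 + (b 2 + b 4 * q.1 + 2 * b 5 * q.2)) ^ 2 /
    ((a 1 + 2 * a 3 * q.1 + a 4 * q.2) * (b 2 + b 4 * q.1 + 2 * b 5 * q.2) -
      (a 2 + a 4 * q.1 + 2 * a 5 * q.2) * (b 1 + 2 * b 3 * q.1 + b 4 * q.2)) - 2 := by
  rw [bbIndex, h.det_linFin, prod_linearMap_trace, (h.linFin_eq q).1, (h.linFin_eq q).2]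

end HasCoeffs

theorem exists_hasCoeffs (a b : Fin 6 → ℂ) : ∃ v : PlaneVF 2, v.HasCoeffs a b :=
  exists_field_eq (isPlanePoly_quadEval a) (isPlanePoly_quadEval b)

end PlaneVF

/-- A nonzero variation of one eigenvalue changes the Baum-Bott index to first order. -/
theorem eq_zero_of_hasDerivAt_index {h p δ : ℂ} (hh : h ≠ 0) (hp : p ≠ 0) (hhp : h ^ 2 - p ^ 2 ≠ 0)
    (H : HasDerivAt (fun t : ℂ => (h - (p + t * δ)) ^ 2 / -((p + t * δ) * h) - 2) 0 0) :
    δ = 0 := by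
  have h1 : HasDerivAt (fun t : ℂ => p + t * δ) δ 0 :=
    (((hasDerivAt_id' (0 : ℂ)).mul_const δ).const_add p).congr_deriv (one_mul _)
  have h2 := (((h1.const_sub h).fun_pow 2).fun_div (h1.mul_const h).fun_neg
    (by simpa using ⟨hp, hh⟩)).sub_const 2
  have h3 := h2.unique H
  have hne : (-((p + 0 * δ) * h)) ^ 2 ≠ 0 := by
    simpa using ⟨hp, hh⟩
  have h4 := (div_eq_zero_iff.1 h3).resolve_right hne
  -- The eigenvalues are `h` and `-p`, and the index is `-h / p - p / h`. It is stationary in `p`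
  -- exactly where `h ^ 2 = p ^ 2`, the case excluded by hypothesis.
  have h5 : δ * ((h ^ 2 - p ^ 2) * h) = 0 := by
    push_cast at h4
    linear_combination h4
  exact (mul_eq_zero.1 h5).resolve_right (mul_ne_zero hhp hh)

/-- The numerator of the derivative carries a factor `T`: where the trace is zero the index is
stationary whatever the velocities, so the linear equation requires `T t ≠ 0`. -/
theorem hasDerivAt_sq_div_sub {T D : ℂ → ℂ} {T' D' t : ℂ} (hT : HasDerivAt T T' t)
    (hD : HasDerivAt D D' t) (hT0 : T t ≠ 0) (hD0 : D t ≠ 0)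
    (H : HasDerivAt (fun t => T t ^ 2 / D t - 2) 0 t) : 2 * T' * D t - T t * D' = 0 := by
  have h1 := (((hT.fun_pow 2).fun_div hD hD0).sub_const 2).unique H
  have h2 := (div_eq_zero_iff.1 h1).resolve_right (pow_ne_zero 2 hD0)
  have h3 : T t * (2 * T' * D t - T t * D') = 0 := by
    push_cast at h2
    linear_combination h2
  exact (mul_eq_zero.1 h3).resolve_left hT0

namespace PlaneVF

/-- The field `(2 x² + y² - 2 y - 26) ∂/∂x + (3 y² - 48) ∂/∂y` with the zeros `(±1, -4)`,
`(±3, 4)`. -/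
theorem exists_quadratic : ∃ v : PlaneVF 2,
    v.HasCoeffs ![-26, 0, -2, 2, 0, 1] ![-48, 0, 0, 0, 0, 3] :=
  -- The field is `(2f + g, 3g)` with `f = x ^ 2 - y - 5` and `g = y ^ 2 - 16`. Thus `y = ±4` and `x
  -- ^ 2 = y + 5` is a perfect square, so all zeros are integral.
  exists_hasCoeffs _ _

/-- The slopes of the singular points at infinity of the quadratic example. -/
def slopes : Fin 3 → ℂ := ![0, 1, 2]

/-- The zeros of the quadratic example. -/
def zeros : Fin 4 → ℂ × ℂ := ![(1, -4), (-1, -4), (-3, 4), (3, 4)]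

theorem zeros_field {v : PlaneVF 2} (h : v.HasCoeffs ![-26, 0, -2, 2, 0, 1] ![-48, 0, 0, 0, 0, 3])
    (q : ℂ × ℂ) : v.field q = 0 ↔ ∃ j, zeros j = q := by
  rw [h]
  constructor
  · intro hq
    have h1 : quadEval ![-26, 0, -2, 2, 0, 1] q = 0 := congrArg Prod.fst hq
    have h2 : quadEval ![-48, 0, 0, 0, 0, 3] q = 0 := congrArg Prod.snd hq
    simp [quadEval] at h1 h2
    obtain ⟨x, y⟩ := q
    simp only at h1 h2
    have h3 : (y + 4) * (y - 4) = 0 := by linear_combination h2 / 3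
    rcases mul_eq_zero.1 h3 with hy | hy
    · have hy : y = -4 := by linear_combination hy
      subst hy
      have h4 : (x - 1) * (x + 1) = 0 := by linear_combination h1 / 2
      rcases mul_eq_zero.1 h4 with hx | hx
      · exact ⟨0, by simp [zeros]; linear_combination -hx⟩
      · exact ⟨1, by simp [zeros]; linear_combination -hx⟩
    · have hy : y = 4 := by linear_combination hy
      subst hy
      have h4 : (x + 3) * (x - 3) = 0 := by linear_combination h1 / 2
      rcases mul_eq_zero.1 h4 with hx | hx
      · exact ⟨2, by simp [zeros]; linear_combination -hx⟩
      · exact ⟨3, by simp [zeros]; linear_combination -hx⟩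
  · rintro ⟨j, rfl⟩
    fin_cases j <;> simp [zeros, quadEval] <;> norm_num

theorem slopes_infFun {v : PlaneVF 2}
    (h : v.HasCoeffs ![-26, 0, -2, 2, 0, 1] ![-48, 0, 0, 0, 0, 3]) (w : ℂ) :
    v.infFun w = 0 ↔ ∃ i, slopes i = w := by
  rw [h.infFun_eq]
  simp only [Matrix.cons_val]
  constructor
  · intro hw
    have h1 : w * ((w - 1) * (w - 2)) = 0 := by linear_combination -hw
    rcases mul_eq_zero.1 h1 with h2 | h2
    · exact ⟨0, by simp [slopes, h2]⟩
    · rcases mul_eq_zero.1 h2 with h2 | h2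
      · exact ⟨1, by simp [slopes]; linear_combination -h2⟩
      · exact ⟨2, by simp [slopes]; linear_combination -h2⟩
  · rintro ⟨i, rfl⟩
    fin_cases i <;> simp [slopes] <;> norm_num

theorem injective_slopes : Function.Injective slopes := by
  intro i j h
  fin_cases i <;> fin_cases j <;> first | rfl | (exfalso; revert h; norm_num [slopes])

theorem injective_fst_zeros : Function.Injective fun j => (zeros j).1 := by
  intro i j h
  fin_cases i <;> fin_cases j <;> first | rfl | (exfalso; revert h; norm_num [zeros])

theorem isNumbering_quadratic {v : PlaneVF 2}
    (h : v.HasCoeffs ![-26, 0, -2, 2, 0, 1] ![-48, 0, 0, 0, 0, 3]) :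
    v.IsNumbering (fun i => (slopes i : OnePoint ℂ)) zeros := by
  refine ⟨OnePoint.coe_injective.comp injective_slopes, ?_,
    fun i j hij => injective_fst_zeros (congrArg Prod.fst hij), ?_⟩
  · ext o
    induction o using OnePoint.rec with
    | infty =>
      have h1 : OnePoint.infty ∉ v.singInf := by
        rw [infty_notMem_singInf_iff, h.apply_topExp]
        simp
      simp [h1]
    | coe w =>
      rw [coe_mem_singInf_iff, slopes_infFun h]
      simp
  · ext q
    exact (zeros_field h q).symm

theorem isNondegenerate_quadratic {v : PlaneVF 2}
    (h : v.HasCoeffs ![-26, 0, -2, 2, 0, 1] ![-48, 0, 0, 0, 0, 3]) : v.IsNondegenerate := by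
  obtain ⟨hO, hOr, hQ, hQr⟩ := isNumbering_quadratic h
  refine ⟨?_, ?_, ?_, ?_⟩
  · rw [← hOr, ← Set.image_univ, hO.encard_image, Set.encard_univ]
    simp
  · rw [← hQr, ← Set.image_univ, hQ.encard_image, Set.encard_univ]
    simp
  · rw [← hOr]
    rintro _ ⟨i, rfl⟩
    rw [det_linInf_coe, h.deriv_infFun, (h.homogenized_eq _ _).1]
    fin_cases i <;> simp [slopes] <;> norm_num
  · rw [← hQr]
    rintro _ ⟨j, rfl⟩
    rw [h.det_linFin]
    revert j
    show ∀ j : Fin 4, _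
    intro j
    fin_cases j <;> simp [zeros]

theorem injective_bbIndex_linInf {v : PlaneVF 2}
    (h : v.HasCoeffs ![-26, 0, -2, 2, 0, 1] ![-48, 0, 0, 0, 0, 3]) :
    Function.Injective fun i => bbIndex (v.linInf (slopes i : OnePoint ℂ)) := by
  have e : (fun i => bbIndex (v.linInf (slopes i : OnePoint ℂ))) = ![2, -10 / 3, 10 / 3] := by
    funext i
    rw [bbIndex_linInf_coe, h.deriv_infFun, (h.homogenized_eq _ _).1]
    fin_cases i <;> simp [slopes] <;> norm_num
  rw [e]
  intro i j hij
  fin_cases i <;> fin_cases j <;> first | rfl | (exfalso; revert hij; norm_num)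

theorem injective_bbIndex_linFin {v : PlaneVF 2}
    (h : v.HasCoeffs ![-26, 0, -2, 2, 0, 1] ![-48, 0, 0, 0, 0, 3]) :
    Function.Injective fun j => bbIndex (v.linFin (zeros j)) := by
  have e : (fun j => bbIndex (v.linFin (zeros j))) = ![-37 / 6, 37 / 6, -5 / 2, 5 / 2] := by
    funext i
    rw [h.bbIndex_linFin]
    fin_cases i <;> simp [zeros] <;> norm_num
  rw [e]
  intro i j hij
  fin_cases i <;> fin_cases j <;> first | rfl | (exfalso; revert hij; norm_num)

end PlaneVF

namespace PlaneVF

theorem quadEval_add_smul (a a' : Fin 6 → ℂ) (t : ℂ) (q : ℂ × ℂ) :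
    quadEval (a + t • a') q = quadEval a q + t * quadEval a' q := by
  simp only [quadEval, Pi.add_apply, Pi.smul_apply, smul_eq_mul]
  ring

theorem HasCoeffs.add_smul {v v' : PlaneVF 2} {a b a' b' : Fin 6 → ℂ} (h : v.HasCoeffs a b)
    (h' : v'.HasCoeffs a' b') (t : ℂ) :
    HasCoeffs (v + t • v') (a + t • a') (b + t • b') := fun q => by
  rw [field_add, field_smul, h, h', quadEval_add_smul, quadEval_add_smul]
  rfl

/-- Five directions: three that change the part of degree at most one, and two that change the
part of degree two along a radial field. -/
theorem exists_directions : ∃ ι : (Fin 5 → ℂ) →ₗ[ℂ] PlaneVF 2, ∀ s,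
    (ι s).HasCoeffs ![-(2 * s 0 + s 1), -s 2, 0, s 3, s 4, 0]
      ![-(3 * s 1), -(3 * s 2), 0, 0, s 3, s 4] := by
  -- For the field `(2f + g, 3g)` with `f = x ^ 2 - y - 5` and `g = y ^ 2 - 16`, the parameters
  -- subtract `s 0` from `f` and `s 1 + s 2 * x` from `g`, and add the radial field `(s 3 * x + s 4
  -- * y) • (x, y)`.
  choose τ hτ using fun s : Fin 5 → ℂ => exists_hasCoeffs
    ![-(2 * s 0 + s 1), -s 2, 0, s 3, s 4, 0] ![-(3 * s 1), -(3 * s 2), 0, 0, s 3, s 4]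
  refine ⟨{ toFun := τ, map_add' := fun s s' => ?_, map_smul' := fun c s => ?_ }, hτ⟩
  · refine field_injective fun q => ?_
    rw [field_add, hτ, hτ, hτ]
    ext <;> simp [quadEval] <;> ring
  · refine field_injective fun q => ?_
    rw [RingHom.id_apply, field_smul, hτ, hτ]
    ext <;> simp [quadEval] <;> ring

/-- The linear equations for the velocity of a zero of the quadratic example, whose index is
stationary, along a direction that changes the part of degree at most one. -/
theorem index_equation {x y : ℂ → ℂ} {x' y' s₀ s₁ s₂ : ℂ} (hx : HasDerivAt x x' 0)
    (hy : HasDerivAt y y' 0)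
    (hP : ∀ᶠ t in 𝓝 (0 : ℂ), 2 * x t ^ 2 + y t ^ 2 - 2 * y t - 26 -
      t * (2 * s₀ + s₁ + s₂ * x t) = 0)
    (hQ : ∀ᶠ t in 𝓝 (0 : ℂ), y t ^ 2 - 16 - t * (s₁ + s₂ * x t) = 0)
    (hT : 4 * x 0 + 6 * y 0 ≠ 0) (hD : 24 * (x 0 * y 0) ≠ 0)
    (H : HasDerivAt (fun t => (4 * x t + 6 * y t - t * s₂) ^ 2 /
      (24 * (x t * y t) - t * (6 * s₂)) - 2) 0 0) :
    4 * x 0 * x' + 2 * (y 0 - 1) * y' = 2 * s₀ + s₁ + s₂ * x 0 ∧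
      2 * y 0 * y' = s₁ + s₂ * x 0 ∧
      2 * (4 * x' + 6 * y' - s₂) * (24 * (x 0 * y 0)) -
        (4 * x 0 + 6 * y 0) * (24 * (x' * y 0 + x 0 * y') - 6 * s₂) = 0 := by
  have ht := hasDerivAt_id' (0 : ℂ)
  have zero_deriv : ∀ {f : ℂ → ℂ} {f' : ℂ}, HasDerivAt f f' 0 → (∀ᶠ t in 𝓝 (0 : ℂ), f t = 0) →
      f' = 0 := fun hf h =>
    hf.unique ((hasDerivAt_const (0 : ℂ) (0 : ℂ)).congr_of_eventuallyEq h)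
  refine ⟨?_, ?_, ?_⟩
  · have h1 := zero_deriv ((((((hx.fun_pow 2).const_mul 2).fun_add (hy.fun_pow 2)).fun_sub
      (hy.const_mul 2)).sub_const 26).fun_sub
      (ht.fun_mul ((hx.const_mul s₂).const_add (2 * s₀ + s₁)))) hP
    push_cast at h1
    linear_combination h1
  · have h1 := zero_deriv (((hy.fun_pow 2).sub_const 16).fun_sub
      (ht.fun_mul ((hx.const_mul s₂).const_add s₁))) hQ
    push_cast at h1
    linear_combination h1
  · have h1 := hasDerivAt_sq_div_sub
      (((hx.const_mul 4).fun_add (hy.const_mul 6)).fun_sub (ht.mul_const s₂))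
      (((hx.fun_mul hy).const_mul 24).fun_sub (ht.mul_const (6 * s₂)))
      (by simpa using hT) (by simpa using hD) H
    linear_combination h1

/-- The derivative of the moduli map at the quadratic example is injective on the five
directions. -/
theorem directions_eq_zero {v : PlaneVF 2}
    (h : v.HasCoeffs ![-26, 0, -2, 2, 0, 1] ![-48, 0, 0, 0, 0, 3])
    {w : PlaneVF 2 → Fin (2 + 1) → ℂ} {q : PlaneVF 2 → Fin (2 ^ 2) → ℂ × ℂ}
    (hb : IsLocalBranch v w q) (hw : w v = slopes) (hq : q v = zeros)
    {u : PlaneVF 2} {s : Fin 5 → ℂ}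
    (hu : u.HasCoeffs ![-(2 * s 0 + s 1), -s 2, 0, s 3, s 4, 0]
      ![-(3 * s 1), -(3 * s 2), 0, 0, s 3, s 4])
    (H : HasDerivAt (fun t : ℂ => (v + t • u).bbTuple
      (fun i => (w (v + t • u) i : OnePoint ℂ)) (q (v + t • u))) 0 0) : s = 0 := by
  have hc := fun t => h.add_smul hu t
  have hv0 : v + (0 : ℂ) • u = v := by rw [zero_smul, add_zero]
  have H := hasDerivAt_pi.1 H
  -- A radial leading part induces the zero field on directions, so the singular points at infinity
  -- and the eigenvalues along the line stay fixed. Only the transversal eigenvalue changes,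
  -- linearly in `t`.
  have hinf : ∀ (t z : ℂ), (v + t • u).infFun z = 3 * z ^ 2 - 2 * z - z ^ 3 := by
    intro t z
    rw [(hc t).infFun_eq]
    simp
    ring
  have hderiv : ∀ (t z : ℂ), deriv (v + t • u).infFun z = 6 * z - 2 - 3 * z ^ 2 := by
    intro t z
    rw [(hc t).deriv_infFun]
    simp
    ring
  have hhom : ∀ (t z : ℂ), (v + t • u).homogenized 0 1 z 0 = 2 + z ^ 2 + t * (s 3 + s 4 * z) := by
    intro t z
    rw [((hc t).homogenized_eq 1 z).1]
    simp
    ring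
  have hslope : ∀ i, ∀ᶠ t in 𝓝 (0 : ℂ), w (v + t • u) i = slopes i := by
    intro i
    have h1 := hb.slope_unique i
    rw [hw] at h1
    have h2 : Filter.Tendsto (fun t : ℂ => (v + t • u, slopes i)) (𝓝 0) (𝓝 (v, slopes i)) := by
      rw [nhds_prod_eq]
      exact (tendsto_line v u).prodMk tendsto_const_nhds
    filter_upwards [h2.eventually h1] with t ht
    refine (ht ?_).symm
    rw [hinf, ← hinf 0, hv0, slopes_infFun h]
    exact ⟨i, rfl⟩
  have key : ∀ i, 6 * slopes i - 2 - 3 * slopes i ^ 2 ≠ 0 → 2 + slopes i ^ 2 ≠ 0 →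
      (6 * slopes i - 2 - 3 * slopes i ^ 2) ^ 2 - (2 + slopes i ^ 2) ^ 2 ≠ 0 →
      s 3 + s 4 * slopes i = 0 := by
    intro i h1 h2 h3
    refine eq_zero_of_hasDerivAt_index h1 h2 h3 ((H (Sum.inl i)).congr_of_eventuallyEq ?_)
    filter_upwards [hslope i] with t ht
    show _ = bbIndex ((v + t • u).linInf (w (v + t • u) i : OnePoint ℂ))
    rw [ht, bbIndex_linInf_coe, hderiv, hhom]
  -- The slopes `1` and `2` determine `s 3` and `s 4`. Slope `0` gives nothing: both its eigenvalues
  -- are `-2`, so its index is stationary in first order.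
  have e1 := key 1 (by simp [slopes]; norm_num) (by simp [slopes]; norm_num)
    (by simp [slopes]; norm_num)
  have e2 := key 2 (by simp [slopes]; norm_num) (by simp [slopes]; norm_num)
    (by simp [slopes]; norm_num)
  have hs1 : slopes 1 = 1 := by simp [slopes]
  have hs2 : slopes 2 = 2 := by simp [slopes]
  rw [hs1] at e1
  rw [hs2] at e2
  have s4 : s 4 = 0 := by linear_combination e2 - e1
  have s3 : s 3 = 0 := by linear_combination 2 * e1 - e2
  have hfin : ∀ j : Fin 4, 4 * (zeros j).1 + 6 * (zeros j).2 ≠ 0 →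
      24 * ((zeros j).1 * (zeros j).2) ≠ 0 → ∃ x' y' : ℂ,
      4 * (zeros j).1 * x' + 2 * ((zeros j).2 - 1) * y' = 2 * s 0 + s 1 + s 2 * (zeros j).1 ∧
      2 * (zeros j).2 * y' = s 1 + s 2 * (zeros j).1 ∧
      2 * (4 * x' + 6 * y' - s 2) * (24 * ((zeros j).1 * (zeros j).2)) -
        (4 * (zeros j).1 + 6 * (zeros j).2) *
          (24 * (x' * (zeros j).2 + (zeros j).1 * y') - 6 * s 2) = 0 := by
    intro j hT hD
    obtain ⟨ψ, hψ⟩ := hb.differentiableAt_zero j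
    have h1 := hψ.hasDerivAt_line u
    have hz : ∀ᶠ t in 𝓝 (0 : ℂ), (v + t • u).field (q (v + t • u) j) = 0 := by
      filter_upwards [(tendsto_line v u).eventually hb.isNumbering] with t ht
      have : q (v + t • u) j ∈ (v + t • u).singFin := ht.2.2.2 ▸ Set.mem_range_self j
      exact this
    have hx : HasDerivAt (fun t : ℂ => (q (v + t • u) j).1) (ψ u).1 0 := h1.fst
    have hy : HasDerivAt (fun t : ℂ => (q (v + t • u) j).2) (ψ u).2 0 := h1.snd
    have e : q (v + (0 : ℂ) • u) j = zeros j := by rw [hv0, hq]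
    have h2 := index_equation (s₀ := s 0) (s₁ := s 1) (s₂ := s 2) hx hy ?_ ?_ (by rwa [e])
      (by rwa [e]) ((H (Sum.inr j)).congr_of_eventuallyEq ?_)
    · rw [e] at h2
      exact ⟨_, _, h2⟩
    · filter_upwards [hz] with t ht
      rw [hc t] at ht
      have h3 := congrArg Prod.fst ht
      simp [quadEval, s3, s4] at h3
      linear_combination h3
    · filter_upwards [hz] with t ht
      rw [hc t] at ht
      have h3 := congrArg Prod.snd ht
      simp [quadEval, s3, s4] at h3
      linear_combination h3 / 3
    · filter_upwards with t
      show _ = bbIndex ((v + t • u).linFin (q (v + t • u) j))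
      rw [(hc t).bbIndex_linFin]
      simp [s3, s4]
      ring
  -- Three of the four zeros suffice for the three remaining parameters.
  obtain ⟨x₀, y₀, a₀, b₀, c₀⟩ := hfin 0 (by simp [zeros]; norm_num) (by simp [zeros])
  obtain ⟨x₁, y₁, a₁, b₁, c₁⟩ := hfin 1 (by simp [zeros]; norm_num) (by simp [zeros])
  obtain ⟨x₂, y₂, a₂, b₂, c₂⟩ := hfin 2 (by simp [zeros]; norm_num) (by simp [zeros])
  have z₀ : zeros 0 = (1, -4) := rfl
  have z₁ : zeros 1 = (-1, -4) := rfl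
  have z₂ : zeros 2 = (-3, 4) := rfl
  simp only [z₀] at a₀ b₀ c₀
  simp only [z₁] at a₁ b₁ c₁
  simp only [z₂] at a₂ b₂ c₂
  -- The multipliers of the two velocity equations are those that cancel the velocity `(x₀, y₀)` of
  -- the zero from the index equation; likewise for the next two. The resulting system in `s 0, s 1,
  -- s 2` is nonsingular.
  have d₀ : -112 * s 0 + 21 * s 1 + 27 * s 2 = 0 := by
    linear_combination (c₀ + 672 * a₀ - 924 * b₀) / 12
  have d₁ : 16 * s 0 - 3 * s 1 - 3 * s 2 = 0 := by
    linear_combination (c₁ - 480 * a₁ + 660 * b₁) / 60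
  have d₂ : 48 * s 0 - 21 * s 1 + 117 * s 2 = 0 := by
    linear_combination (c₂ - 288 * a₂ + 540 * b₂) / 12
  have s2 : s 2 = 0 := by linear_combination (d₀ + 7 * d₁) / 6
  have s1 : s 1 = 0 := by linear_combination (3 * d₁ - d₂ + 126 * s2) / 12
  have s0 : s 0 = 0 := by linear_combination (d₁ + 3 * s1 + 3 * s2) / 16
  funext k
  fin_cases k
  exacts [s0, s1, s2, s3, s4]

end PlaneVF

/-! ### The rank in degree two and the final statement. -/

namespace PlaneVF

/-- The rank of the derivative of the moduli map at generic quadratic fields. -/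
theorem forGeneric_quadratic : ForGeneric (n := 2) fun v => v.IsNondegenerate ∧
    (∃ O Q, v.IsLocalNumbering O Q) ∧
    Module.finrank ℂ (PlaneVF 2 ⧸ v.orbitTangent) = 5 ∧
    ∀ O Q, v.IsLocalNumbering O Q →
      ∃ L : (PlaneVF 2 ⧸ v.orbitTangent) →ₗ[ℂ] (Fin (2 + 1) ⊕ Fin (2 ^ 2) → ℂ),
        v.IsModuliDerivative O Q L ∧ Module.finrank ℂ (LinearMap.range L) = 5 := by
  obtain ⟨v₀, h₀⟩ := exists_quadratic
  obtain ⟨ι, hι⟩ := exists_directions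
  have htop : v₀ (0, topExp 2) ≠ 0 := by
    rw [h₀.apply_topExp]
    simp
  have hnd₀ := (isNondegenerate_quadratic h₀).eventually one_le_two htop (q := zeros)
    (fun j => (zeros_field h₀ _).2 ⟨j, rfl⟩) injective_fst_zeros
  obtain ⟨w, q, hb, hw, hq⟩ := exists_isLocalBranch hnd₀ (isNumbering_quadratic h₀)
  refine (forGeneric_injective one_le_two hnd₀ htop hb (by rw [hq]; exact injective_fst_zeros)
    (by rw [hw]; exact injective_bbIndex_linInf h₀) (by rw [hq]; exact injective_bbIndex_linFin h₀)
    ι fun s hs => directions_eq_zero h₀ hb hw hq (hι s) hs).mono fun v hv => ?_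
  obtain ⟨hnd, hvtop, hinj⟩ := hv
  have hv := hnd.self_of_nhds
  have hfr := hv.finrank_quotient_orbitTangent
  refine ⟨hv, ?_, hfr, fun O Q hOQ => ?_⟩
  · obtain ⟨O₀, Q₀, hnum⟩ := hv.exists_isNumbering
    obtain ⟨w₀, -, hw₀, -⟩ := exists_coe_of_isNumbering hnum hvtop
    rw [show O₀ = fun i => (w₀ i : OnePoint ℂ) from funext hw₀] at hnum
    obtain ⟨w, q, hb, -, -⟩ := exists_isLocalBranch hnd hnum
    exact ⟨_, _, hb.isLocalNumbering⟩
  · obtain ⟨w, q, hb, hOQe⟩ := hOQ.exists_isLocalBranch hnd hvtop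
    obtain ⟨M', hM'⟩ : DifferentiableAt ℂ _ v := hb.differentiableAt_bbTuple hv
    have hM : HasFDerivAt (fun w : PlaneVF 2 => w.bbTuple (O w) (Q w)) M' v := by
      refine hM'.congr_of_eventuallyEq ?_
      filter_upwards [hOQe] with v' h
      rw [h.1, h.2]
    let f : PlaneVF 2 →ₗ[ℂ] (Fin (2 + 1) ⊕ Fin (2 ^ 2) → ℂ) := M'.toLinearMap
    have hle : v.orbitTangent ≤ LinearMap.ker f := fun u hu =>
      hOQ.eq_zero_of_mem_orbitTangent hnd hM hu
    have hML : ∀ u, M' u = (v.orbitTangent.liftQ f hle) (v.orbitTangent.mkQ u) := fun u => rfl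
    -- The source of dimension five bounds the rank from above. From below, the five directions of
    -- the quadratic example, used unchanged at `v`, have linearly independent images.
    refine ⟨v.orbitTangent.liftQ f hle, ⟨M', hM, hML⟩, le_antisymm ?_ ?_⟩
    · rw [← hfr]
      exact LinearMap.finrank_range_le _
    · rw [Submodule.range_liftQ]
      have h1 : Function.Injective (f ∘ₗ ι) :=
        LinearMap.ker_eq_bot.1 (LinearMap.ker_eq_bot'.2 fun s hs => hinj O Q hOQ M' hM s hs)
      have h2 := LinearMap.finrank_range_of_inj h1
      rw [Module.finrank_fin_fun] at h2
      rw [← h2]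
      exact Submodule.finrank_mono (LinearMap.range_comp_le_range _ _)

end PlaneVF

theorem theorem1p5 :
    -- the moduli map is algebraic, in every degree
    (∀ n : ℕ, 1 ≤ n →
      PlaneVF.ForGeneric (n := n) PlaneVF.IsNondegenerate ∧
      (∀ v : PlaneVF n, PlaneVF.moduliMap (Quotient.mk (PlaneVF.affSetoid n) v) = v.bbTuples) ∧
      ∀ k : ℕ, ∃ f g : PlaneVF n → ℂ, PlaneVF.IsRegularFun f ∧ PlaneVF.IsRegularFun g ∧
        ∀ v : PlaneVF n, v.IsNondegenerate →
          ∀ t ∈ PlaneVF.moduliMap (Quotient.mk (PlaneVF.affSetoid n) v),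
            (∏ i, (Polynomial.X - Polynomial.C (t (Sum.inl i)))).coeff k = f v ∧
            (∏ j, (Polynomial.X - Polynomial.C (t (Sum.inr j)))).coeff k = g v) ∧
    -- for generic quadratic vector fields its derivative has full rank
    PlaneVF.ForGeneric (n := 2) (fun v =>
      v.IsNondegenerate ∧
      (∃ O Q, v.IsLocalNumbering O Q) ∧
      Module.finrank ℂ (PlaneVF 2 ⧸ v.orbitTangent) = 5 ∧
      ∀ O Q, v.IsLocalNumbering O Q →
        ∃ L : (PlaneVF 2 ⧸ v.orbitTangent) →ₗ[ℂ] (Fin (2 + 1) ⊕ Fin (2 ^ 2) → ℂ),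
          v.IsModuliDerivative O Q L ∧ Module.finrank ℂ (LinearMap.range L) = 5) := by
  refine ⟨fun n hn => ⟨(PlaneVF.forGeneric_isNondegenerate hn).mono fun v h => h.1,
    PlaneVF.moduliMap_mk, fun k => ?_⟩, PlaneVF.forGeneric_quadratic⟩
  refine ⟨fun v => v.bbPolyInf.coeff k, fun v => v.bbPolyFin.coeff k,
    (PlaneVF.isRegularFun_coeff_bbPoly hn k).1, (PlaneVF.isRegularFun_coeff_bbPoly hn k).2,
    fun v _ t ht => ?_⟩
  rw [PlaneVF.moduliMap_mk] at ht
  have h := PlaneVF.bbPoly_eq_of_mem_bbTuples ht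
  exact ⟨congrArg (fun p => Polynomial.coeff p k) h.1.symm,
    congrArg (fun p => Polynomial.coeff p k) h.2.symm⟩
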